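/- **Setting.** Let $X$ be a countably infinite connected simple graph of bounded degree, with vertex set $VX$; subgraphs are full subgraphs, $|K|$ is the number of vertices of a finite subgraph $K$, and its frontier $\mathcal F(K)$ is the set of vertices of $K$ adjacent to some vertex outside $K$. Let $X$ be self-similar: there are finite subgraphs $K_0\subset K_1\subset\cdots$ with union $X$ and $|\mathcal F(K_n)|/|K_n|\to0$, and for every $n$ a finite set $\mathcal G(n,n+1)$ of graph isomorphisms $\gamma$ of $K_n$ onto subgraphs $\gamma K_n$ of $K_{n+1}$, such that $\bigcup_\gamma\gamma K_n=K_{n+1}$ (for vertices and edges), $V(\gamma K_n)\cap V(\gamma'K_n)=\mathcal F(\gamma K_n)\cap\mathcal F(\gamma'K_n)$ for $\gamma\ne\gamma'$, and $|\mathcal F_{\mathcal G}(K_n)|/|K_n|\to0$. Here $\mathcal G(n,m)$ ($m\ge n$) is the set of all products $\gamma_{m-1}\cdots\gamma_n$ with $\gamma_i\in\mathcal G(i,i+1)$ (with $\mathcal G(n,n)=\{\mathrm{id}_{K_n}\}$), and $\mathcal F_{\mathcal G}(K_n)=\bigcup_{m\ge n}\bigcup_{\gamma\in\mathcal G(n,m)}\gamma^{-1}\mathcal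 F(\gamma K_n)$. Let $q\ge1$ be an integer and let $X$ be essentially $(q+1)$-regular: $\deg v=q+1$ for all but finitely many vertices $v$. **Euler product.** A prime cycle is a closed path without backtracking and without tail that is not a proper multiple of a closed path, up to the choice of its origin; $|C|$ is its length. $\mathcal G$-equivalence of prime cycles is the equivalence relation generated by $C\sim\gamma(C)$ for $\gamma\in\mathcal G(n,m)$ and $C\subset K_n$. The average multiplicity of $C$ is $$\mu(C)=\lim_{n\to\infty}\frac{|\{D : D\sim_{\mathcal G}C,\ D\subset K_n\}|}{|K_n|},$$ and $Z(u)=\prod_{[C]_{\mathcal G}}(1-u^{|C|})^{-\mu(C)}$ for $|u|<\frac1q$, the product being over the $\mathcal G$-equivalence classes of prime cycles. **Determinant.** Let $A$ be the adjacency operator on $\ell^2(VX)$ and $\Delta(u)=(1+qu^2)I-uA$. For operators $T$ for which the limit exists put $\mathrm{Tr}_{\mathcal G}(T)=\lim_n|K_n|^{-1}\sum_{v\in K_n}\langle v,Tv\rangle$, and, if $0\notin\mathrm{conv}\,\sigma(T)$, $\det_{\mathcal G}(T)=\exp \mathrm{Tr}_{\mathcal G}\bigl(\frac1{2\pi i}\oint_\Gamma\log\lambda\,(\lambda-T)^{-1}d\lambda\bigr)$,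 where $\Gamma$ is the boundary of a disc that contains $\mathrm{conv}\,\sigma(T)$ and whose closure does not contain $0$, and $\log$ is a branch of the logarithm near that closed disc. **Domains.** Let $\sigma_q=\{x\in\mathbb R:\frac1q\le|x|\le1\}$, $\Omega=\mathbb C\setminus(\{|u|^2=\frac1q\}\cup\sigma_q)$ and $\Omega'=\mathbb C\setminus(\{|u|^2=\frac1q,\ \mathrm{Im}\,u\le0\}\cup\sigma_q)$. The functions $(1-u^2)^{a/2}$ ($a=1-q,\ q,\ q-1$), $(1-q^2u^2)^{1/2}$ and $(1+u)^{(q-1)/2}(1-u)^{(q+1)/2}$ are given by principal powers for $|u|<\frac1q$ and by holomorphic extension in $\Omega'$. **Theorem.** (a) *All these objects are well defined.* The limits $\mu(C)$ exist. If each inclusion $K_n\subset K_{n+1}$ belongs to $\mathcal G(n,n+1)$ and no prime cycle lies in $\gamma K_n$ and in $\gamma'K_n$ for distinct $\gamma,\gamma'\in\mathcal G(n,m)$, then $\mu(C)=\lim_n|\mathcal G(s(C),n)|/|K_n|$, where the size $s(C)$ is the least $p$ such that $C\subset\gamma K_p$ for some $\gamma\in\mathcal G(p,m)$, $m\ge p$.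 For $u\in\Omega$ one has $0\notin\mathrm{conv}\,\sigma(\Delta(u))$, and the limit defining $\mathrm{Tr}_{\mathcal G}$ of the logarithm of $\Delta(u)$ exists. The extensions to $\Omega'$ exist. The Euler product converges for $|u|<\frac1q$ and equals $(1-u^2)^{(1-q)/2}\det_{\mathcal G}(\Delta(u))^{-1}$ there; by this formula $Z$ is extended to a holomorphic function on $\Omega$. (b) *Functional equations.* For all $u\in\Omega\setminus\{0\}$: (i) $\Lambda_X(u):=(1-u^2)^{q/2}(1-q^2u^2)^{1/2}Z(u)$ satisfies $\Lambda_X(u)=-\Lambda_X\bigl(\frac1{qu}\bigr)$; (ii) $\xi_X(u):=(1+u)^{(q-1)/2}(1-u)^{(q+1)/2}(1-qu)Z(u)$ satisfies $\xi_X(u)=\xi_X\bigl(\frac1{qu}\bigr)$; (iii) $\Xi_X(u):=(1-u^2)^{(q-1)/2}(1+qu^2)Z(u)$ satisfies $\Xi_X(u)=\Xi_X\bigl(\frac1{qu}\bigr)$. -/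

import Mathlib

open Filter Topology

noncomputable section

/-! Graphs, copies and self-similarity -/

/-- The frontier of a set `K` of vertices: the vertices of `K` at distance `1` from the
complement of `K`. -/
def vertexFrontier {V : Type*} (X : SimpleGraph V) (K : Set V) : Set V :=
  {v | v ∈ K ∧ ∃ w, w ∉ K ∧ X.Adj v w}

/-- A sequence of finite full subgraphs `K 0, K 1, …` of `X`, given by their vertex sets, with,
for every `n`, a set `G n = 𝒢(n, n + 1)` of graph isomorphisms of `K n` onto full subgraphs
of `K (n + 1)`. -/
structure GraphTower {V : Type*} (X : SimpleGraph V) where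
  K : ℕ → Finset V
  G : ∀ n, Set (X.induce (K n : Set V) ↪g X.induce (K (n + 1) : Set V))

namespace GraphTower

variable {V : Type*} {X : SimpleGraph V}

/-- The set `𝒢(n, n + k)` of all products `γ_{n+k-1} ⋯ γ_n` with `γ_i ∈ 𝒢(i, i + 1)`;
`𝒢(n, n)` consists of the identity of `K n`. -/
def copies (S : GraphTower X) (n : ℕ) :
    ∀ k : ℕ, Set (X.induce (S.K n : Set V) ↪g X.induce (S.K (n + k) : Set V))
  | 0 => {SimpleGraph.Embedding.refl}
  | k + 1 => {δ | ∃ β ∈ S.copies n k, ∃ γ ∈ S.G (n + k), δ = γ.comp β}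

/-- The vertex set of the copy `γ (K n)`. -/
def image (S : GraphTower X) {n m : ℕ}
    (γ : X.induce (S.K n : Set V) ↪g X.induce (S.K m : Set V)) : Set V :=
  Set.range fun v => (γ v : V)

/-- The `𝒢`-invariant frontier of `K n`. -/
def invariantFrontier (S : GraphTower X) (n : ℕ) : Set V :=
  {v | ∃ hv : v ∈ (S.K n : Set V), ∃ k, ∃ γ ∈ S.copies n k,
    (γ ⟨v, hv⟩ : V) ∈ vertexFrontier X (S.image γ)}

/-- `X` is self-similar, with amenable exhaustion `K` and local isomorphisms `G`. -/
structure IsSelfSimilar (S : GraphTower X) : Prop where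
  mono : Monotone S.K
  exhausts : ∀ v, ∃ n, v ∈ S.K n
  amenable : Tendsto (fun n => ((vertexFrontier X (S.K n)).ncard : ℝ) / ((S.K n).card : ℝ))
    atTop (𝓝 0)
  finite_G : ∀ n, (S.G n).Finite
  cover_vertices : ∀ n, ∀ v ∈ S.K (n + 1), ∃ γ ∈ S.G n, v ∈ S.image γ
  cover_edges : ∀ n, ∀ v ∈ S.K (n + 1), ∀ w ∈ S.K (n + 1), X.Adj v w →
    ∃ γ ∈ S.G n, v ∈ S.image γ ∧ w ∈ S.image γ
  overlap : ∀ n, ∀ γ ∈ S.G n, ∀ γ' ∈ S.G n, γ ≠ γ' →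
    S.image γ ∩ S.image γ' =
      vertexFrontier X (S.image γ) ∩ vertexFrontier X (S.image γ')
  invariant_amenable :
    Tendsto (fun n => ((S.invariantFrontier n).ncard : ℝ) / ((S.K n).card : ℝ)) atTop (𝓝 0)

end GraphTower

/-! Closed paths and prime cycles -/

/-- A closed path `(v_0, …, v_m = v_0)` of length `m = len ≥ 1`, recorded as the `m`-periodic
sequence `i ↦ v_{i mod m}`. -/
structure ClosedPath {V : Type*} (X : SimpleGraph V) where
  len : ℕ
  vert : ℤ → V
  len_pos : 0 < len
  periodic : ∀ i, vert (i + len) = vert i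
  adj : ∀ i, X.Adj (vert i) (vert (i + 1))

namespace ClosedPath

variable {V : Type*} {X : SimpleGraph V}

/-- No backtracking, and no tail (that is, no backtracking at the origin either). -/
def IsReduced (C : ClosedPath X) : Prop := ∀ i, C.vert (i - 1) ≠ C.vert (i + 1)

/-- `C` is not obtained by going `n ≥ 2` times around some closed path. -/
def IsPrimitive (C : ClosedPath X) : Prop :=
  ¬ ∃ (D : ClosedPath X) (n : ℕ), 2 ≤ n ∧ C.len = n * D.len ∧ C.vert = D.vert

end ClosedPath

/-- Primitive reduced closed paths. -/
def PrimePath {V : Type*} (X : SimpleGraph V) : Type _ :=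
  {C : ClosedPath X // C.IsReduced ∧ C.IsPrimitive}

/-- Two closed paths are equivalent if they differ by a shift of the origin. -/
instance primePathSetoid {V : Type*} (X : SimpleGraph V) : Setoid (PrimePath X) where
  r C D := C.1.len = D.1.len ∧ ∃ k : ℤ, ∀ i, D.1.vert i = C.1.vert (i + k)
  iseqv :=
    { refl := fun _ => ⟨rfl, 0, fun i => by rw [add_zero]⟩
      symm := by
        rintro C D ⟨h, k, hk⟩
        exact ⟨h.symm, -k, fun i => by rw [hk, neg_add_cancel_right]⟩
      trans := by
        rintro C D E ⟨h, k, hk⟩ ⟨h', l, hl⟩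
        exact ⟨h.trans h', l + k, fun i => by rw [hl, hk, add_assoc]⟩ }

/-- Prime cycles: primitive reduced closed paths up to the choice of the origin. -/
def PrimeCycle {V : Type*} (X : SimpleGraph V) : Type _ := Quotient (primePathSetoid X)

namespace PrimeCycle

variable {V : Type*} {X : SimpleGraph V}

/-- The length `|c|`. -/
def length : PrimeCycle X → ℕ :=
  Quotient.lift (fun C : PrimePath X => C.1.len) fun _ _ h => h.1

/-- The set of vertices of a cycle. -/
def support : PrimeCycle X → Set V :=
  Quotient.lift (fun C : PrimePath X => Set.range C.1.vert) (by
    rintro C D ⟨-, k, hk⟩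
    ext v
    constructor
    · rintro ⟨i, rfl⟩
      exact ⟨i - k, by rw [hk, sub_add_cancel]⟩
    · rintro ⟨i, rfl⟩
      exact ⟨i + k, (hk i).symm⟩)

end PrimeCycle

namespace GraphTower

variable {V : Type*} {X : SimpleGraph V}

/-- `d = γ(c)` for some `γ ∈ 𝒢(n, n + k)` whose source `K n` contains `c`. -/
def Maps (S : GraphTower X) (c d : PrimeCycle X) : Prop :=
  ∃ C D : PrimePath X, c = Quotient.mk _ C ∧ d = Quotient.mk _ D ∧
    ∃ n k, ∃ γ ∈ S.copies n k, ∃ h : ∀ i, C.1.vert i ∈ (S.K n : Set V),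
      D.1.len = C.1.len ∧ ∀ i, D.1.vert i = γ ⟨C.1.vert i, h i⟩

/-- The `𝒢`-equivalence classes of prime cycles, for the equivalence relation generated by the
local isomorphisms in the sets `𝒢(n, m)` (and hence by their products and inverses). -/
def PrimeClass (S : GraphTower X) : Type _ := Quot S.Maps

/-- The length of the cycles in a class. -/
def classLength (S : GraphTower X) : S.PrimeClass → ℕ :=
  Quot.lift PrimeCycle.length (by
    rintro c d ⟨C, D, rfl, rfl, n, k, γ, -, -, h, -⟩
    exact h.symm)

/-- The number of cycles of the class `ξ` that lie in `K n`. -/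
def multiplicity (S : GraphTower X) (ξ : S.PrimeClass) (n : ℕ) : ℕ :=
  {c : PrimeCycle X | Quot.mk S.Maps c = ξ ∧ c.support ⊆ (S.K n : Set V)}.ncard

/-- The average multiplicity of a class of prime cycles: the limit of the number of cycles of the
class in `K n`, divided by the number of vertices of `K n`. -/
def avgMultiplicity (S : GraphTower X) (ξ : S.PrimeClass) : ℝ :=
  limUnder atTop fun n => (S.multiplicity ξ n : ℝ) / ((S.K n).card : ℝ)

/-- The size of a prime cycle: the least `p` such that the cycle lies in a copy of `K p`. -/
def size (S : GraphTower X) (c : PrimeCycle X) : ℕ :=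
  sInf {p | ∃ k, ∃ γ ∈ S.copies p k, c.support ⊆ S.image γ}

/-- The factor `(1 - u ^ |c|) ^ (-μ(c))` of the Euler product. -/
def eulerFactor (S : GraphTower X) (u : ℂ) (ξ : S.PrimeClass) : ℂ :=
  (1 - u ^ S.classLength ξ) ^ (-(S.avgMultiplicity ξ : ℂ))

/-- The Ihara zeta function, as an Euler product. -/
def eulerProduct (S : GraphTower X) (u : ℂ) : ℂ := ∏' ξ, S.eulerFactor u ξ

end GraphTower

/-! Operators on `ℓ²(V)`, trace and determinant -/

/-- The Hilbert space `ℓ²(V)`. -/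
abbrev EllTwo (V : Type*) : Type _ := lp (fun _ : V => ℂ) 2

/-- Square-summability of `v ↦ ∑_{w ∼ v} f w`, with the bound for its norm. -/
theorem adjacency_sq_bound {V : Type*} (X : SimpleGraph V) [X.LocallyFinite] (d : ℕ)
    (hd : ∀ v, X.degree v ≤ d) (f : EllTwo V) (s : Finset V) :
    ∑ v ∈ s, ‖∑ w ∈ X.neighborFinset v, f w‖ ^ (2 : ℝ) ≤ ((d : ℝ) * ‖f‖) ^ (2 : ℝ) := by
  classical
  have hs : ∀ t : Finset V, ∑ w ∈ t, ‖f w‖ ^ 2 ≤ ‖f‖ ^ 2 := fun t => by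
    have h := lp.sum_rpow_le_norm_rpow (p := 2) (by norm_num) f t
    simpa using h
  have h1 : ∀ v, ‖∑ w ∈ X.neighborFinset v, f w‖ ^ 2 ≤
      d * ∑ w ∈ X.neighborFinset v, ‖f w‖ ^ 2 := fun v => by
    calc ‖∑ w ∈ X.neighborFinset v, f w‖ ^ 2
        ≤ (∑ w ∈ X.neighborFinset v, ‖f w‖) ^ 2 := by
          gcongr
          exact norm_sum_le _ _
      _ ≤ (X.neighborFinset v).card * ∑ w ∈ X.neighborFinset v, ‖f w‖ ^ 2 :=
          sq_sum_le_card_mul_sum_sq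
      _ ≤ d * ∑ w ∈ X.neighborFinset v, ‖f w‖ ^ 2 := by
          gcongr
          rw [SimpleGraph.card_neighborFinset_eq_degree]
          exact hd v
  have h2 : ∑ v ∈ s, ∑ w ∈ X.neighborFinset v, ‖f w‖ ^ 2 ≤ d * ‖f‖ ^ 2 := by
    calc ∑ v ∈ s, ∑ w ∈ X.neighborFinset v, ‖f w‖ ^ 2
        = ∑ w ∈ (s.biUnion fun v => X.neighborFinset v), ∑ v ∈ s with X.Adj w v, ‖f w‖ ^ 2 := by
          refine Finset.sum_comm' fun v w => ?_
          simp only [SimpleGraph.mem_neighborFinset, Finset.mem_filter, Finset.mem_biUnion]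
          constructor
          · rintro ⟨hv, ha⟩
            exact ⟨⟨hv, ha.symm⟩, v, hv, ha⟩
          · rintro ⟨⟨hv, ha⟩, -⟩
            exact ⟨hv, ha.symm⟩
      _ ≤ ∑ w ∈ (s.biUnion fun v => X.neighborFinset v), d * ‖f w‖ ^ 2 := by
          refine Finset.sum_le_sum fun w _ => ?_
          rw [Finset.sum_const, nsmul_eq_mul]
          gcongr
          refine le_trans (Finset.card_le_card ?_) (hd w)
          intro v hv
          simpa using (Finset.mem_filter.1 hv).2
      _ ≤ d * ‖f‖ ^ 2 := by
          rw [← Finset.mul_sum]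
          gcongr
          exact hs _
  simp only [Real.rpow_two]
  calc ∑ v ∈ s, ‖∑ w ∈ X.neighborFinset v, f w‖ ^ 2
      ≤ ∑ v ∈ s, d * ∑ w ∈ X.neighborFinset v, ‖f w‖ ^ 2 :=
        Finset.sum_le_sum fun v _ => h1 v
    _ ≤ d * (d * ‖f‖ ^ 2) := by
        rw [← Finset.mul_sum]
        gcongr
    _ = ((d : ℝ) * ‖f‖) ^ 2 := by ring

/-- The adjacency operator `(A f)(v) = ∑_{w ∼ v} f(w)` of a graph of bounded degree. -/
def adjacencyOp {V : Type*} (X : SimpleGraph V) [X.LocallyFinite]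
    (hd : ∃ d : ℕ, ∀ v, X.degree v ≤ d) : EllTwo V →L[ℂ] EllTwo V :=
  LinearMap.mkContinuousOfExistsBound
    { toFun := fun f => ⟨fun v => ∑ w ∈ X.neighborFinset v, f w, by
        obtain ⟨d, hd⟩ := hd
        exact memℓp_gen' (p := 2) (C := ((d : ℝ) * ‖f‖) ^ (2 : ℝ))
          (by simpa using adjacency_sq_bound X d hd f)⟩
      map_add' := fun f g => by
        ext v
        exact Finset.sum_add_distrib
      map_smul' := fun c f => by
        ext v
        simp [Finset.mul_sum] }
    (by
      obtain ⟨d, hd⟩ := hd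
      refine ⟨d, fun f => ?_⟩
      refine lp.norm_le_of_forall_sum_le (p := 2) (by norm_num) (by positivity) ?_
      simpa using adjacency_sq_bound X d hd f)

theorem adjacencyOp_apply {V : Type*} (X : SimpleGraph V) [X.LocallyFinite]
    (hd : ∃ d : ℕ, ∀ v, X.degree v ≤ d) (f : EllTwo V) (v : V) :
    adjacencyOp X hd f v = ∑ w ∈ X.neighborFinset v, f w := rfl

/-- The convex hull of a compact set of complex numbers is compact. -/
theorem isCompact_convexHull_complex {s : Set ℂ} (hs : IsCompact s) :
    IsCompact (convexHull ℝ s) := by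
  let S : ℕ → Set ℂ := fun n => (fun p : (Fin n → ℝ) × (Fin n → ℂ) => ∑ i, p.1 i • p.2 i) ''
    (stdSimplex ℝ (Fin n) ×ˢ Set.univ.pi fun _ => s)
  have hS : ∀ n, IsCompact (S n) := fun n =>
    ((isCompact_stdSimplex ℝ (Fin n)).prod (isCompact_univ_pi fun _ => hs)).image (by fun_prop)
  have hU : convexHull ℝ s = ⋃ n ∈ Finset.range 4, S n := by
    apply subset_antisymm
    · intro x hx
      obtain ⟨ι, _, z, w, hz, hind, hw, hw1, rfl⟩ := eq_pos_convex_span_of_mem_convexHull hx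
      have hc : Fintype.card ι ≤ 3 := by
        have := hind.card_le_finrank_succ
        have h2 := Submodule.finrank_le (vectorSpan ℝ (Set.range z))
        rw [Complex.finrank_real_complex] at h2
        omega
      refine Set.mem_biUnion (x := Fintype.card ι) (by simp; omega) ?_
      let e := Fintype.equivFin ι
      refine ⟨(w ∘ e.symm, z ∘ e.symm), ⟨⟨fun i => (hw _).le, ?_⟩, fun i _ => hz ⟨_, rfl⟩⟩, ?_⟩
      · exact (Equiv.sum_comp e.symm w).trans hw1
      · exact Equiv.sum_comp e.symm fun i => w i • z i
    · refine Set.iUnion₂_subset fun n _ => ?_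
      rintro _ ⟨⟨w, z⟩, ⟨⟨hw, hw1⟩, hz⟩, rfl⟩
      exact (convex_convexHull ℝ s).sum_mem (fun i _ => hw i) hw1
        fun i _ => subset_convexHull ℝ s (hz i trivial)
  rw [hU]
  exact (Finset.range 4).isCompact_biUnion fun n _ => hS n

/-- If `0 ∉ conv s` and `s` is compact, then `conv s` lies in a disc whose closure does not
contain `0`. -/
theorem exists_disc {s : Set ℂ} (hs : IsCompact s) (h0 : (0 : ℂ) ∉ convexHull ℝ s) :
    ∃ p : ℂ × ℝ, 0 < p.2 ∧ p.2 < ‖p.1‖ ∧ convexHull ℝ s ⊆ Metric.ball p.1 p.2 := by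
  obtain ⟨f, u, hu, hf⟩ := geometric_hahn_banach_point_closed (convex_convexHull ℝ s)
    (isCompact_convexHull_complex hs).isClosed h0
  rw [map_zero] at hu
  obtain ⟨a, ha⟩ := (InnerProductSpace.toDual ℝ ℂ).surjective f
  have hf' : ∀ b ∈ s, u < inner ℝ a b := fun b hb => by
    have := hf b (subset_convexHull ℝ s hb)
    rwa [← ha, InnerProductSpace.toDual_apply_apply] at this
  obtain ⟨M, hM⟩ := hs.isBounded.exists_norm_le
  by_cases ha0 : a = 0
  · have hse : s = ∅ := by
      by_contra hne
      obtain ⟨b, hb⟩ := Set.nonempty_iff_ne_empty.2 hne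
      have := hf' b hb
      rw [ha0, inner_zero_left] at this
      linarith
    refine ⟨(2, 1), by norm_num, by norm_num, ?_⟩
    simp [hse]
  have hpos : 0 < ‖a‖ := norm_pos_iff.2 ha0
  obtain ⟨R, hR0, hR⟩ : ∃ R : ℝ, 0 < R ∧ M ^ 2 + 1 ≤ R * u ∧ R * u < R ^ 2 * ‖a‖ ^ 2 := by
    refine ⟨(M ^ 2 + 1) / u + u / ‖a‖ ^ 2, by positivity, ?_, ?_⟩
    · have : ((M ^ 2 + 1) / u + u / ‖a‖ ^ 2) * u = M ^ 2 + 1 + u ^ 2 / ‖a‖ ^ 2 := by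
        field_simp
      rw [this]
      have : 0 ≤ u ^ 2 / ‖a‖ ^ 2 := by positivity
      linarith
    · rw [sq ((M ^ 2 + 1) / u + u / ‖a‖ ^ 2), mul_assoc]
      refine mul_lt_mul_of_pos_left ?_ (by positivity)
      rw [add_mul, div_mul_cancel₀ _ (by positivity)]
      have : 0 < (M ^ 2 + 1) / u * ‖a‖ ^ 2 := by positivity
      linarith
  have hrad : 0 < R ^ 2 * ‖a‖ ^ 2 - R * u := by linarith [hR.2]
  refine ⟨(R • a, √(R ^ 2 * ‖a‖ ^ 2 - R * u)), Real.sqrt_pos.2 hrad, ?_, ?_⟩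
  · rw [Real.sqrt_lt' (by rw [norm_smul]; exact mul_pos (norm_pos_iff.2 hR0.ne') hpos), norm_smul, mul_pow, Real.norm_eq_abs, sq_abs]
    have : 0 < R * u := by positivity
    linarith
  · refine convexHull_min (fun b hb => ?_) (convex_ball _ _)
    rw [mem_ball_iff_norm]
    refine Real.lt_sqrt_of_sq_lt ?_
    have h1 := norm_sub_sq_real b (R • a)
    rw [real_inner_smul_right, real_inner_comm, norm_smul, mul_pow, Real.norm_eq_abs, sq_abs] at h1
    have h2 : R * u < R * inner ℝ a b := mul_lt_mul_of_pos_left (hf' b hb) hR0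
    have h3 : ‖b‖ ^ 2 ≤ M ^ 2 := by
      have := hM b hb
      gcongr
    dsimp only
    rw [h1]
    linarith [hR.1]

open Classical in
/-- The logarithm `(2πi)⁻¹ ∮_Γ log λ (λ - a)⁻¹ dλ` of an element with `0 ∉ conv σ(a)`. Here `Γ`
is the boundary of a disc with centre `c` that contains `conv σ(a)` and has radius less than
`|c|`, and `λ ↦ log c + log (λ / c)` is a branch of the logarithm on a neighbourhood of that
closed disc. Other choices change the result only by a multiple of `2πi`. -/
def analyticLog {𝔸 : Type*} [NormedRing 𝔸] [NormedAlgebra ℂ 𝔸] [CompleteSpace 𝔸] (a : 𝔸) : 𝔸 :=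
  if h : (0 : ℂ) ∉ convexHull ℝ (spectrum ℂ a) then
    let p := Classical.choose (exists_disc (spectrum.isCompact (𝕜 := ℂ) a) h)
    (2 * Real.pi * Complex.I : ℂ)⁻¹ •
      ∮ z in C(p.1, p.2), (Complex.log p.1 + Complex.log (z / p.1)) • resolvent a z
  else 0

namespace GraphTower

variable {V : Type*} {X : SimpleGraph V}

open Classical in
/-- `Tr(P(K n) T) / Tr(P(K n))`. -/
def normalizedTrace (S : GraphTower X) (T : EllTwo V →L[ℂ] EllTwo V) (n : ℕ) : ℂ :=
  (∑ v ∈ S.K n, T (lp.single 2 v 1) v) / ((S.K n).card : ℂ)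

/-- The trace `Tr_𝒢 T`. -/
def trace (S : GraphTower X) (T : EllTwo V →L[ℂ] EllTwo V) : ℂ :=
  limUnder atTop (S.normalizedTrace T)

/-- The analytic determinant `det_𝒢 T = exp Tr_𝒢 log T`. -/
def det (S : GraphTower X) (T : EllTwo V →L[ℂ] EllTwo V) : ℂ :=
  Complex.exp (S.trace (analyticLog T))

end GraphTower

/-- The deformed Laplacian `Δ(u) = (1 + q u²) I - u A`. -/
def deformedLaplacian {V : Type*} (X : SimpleGraph V) [X.LocallyFinite]
    (hd : ∃ d : ℕ, ∀ v, X.degree v ≤ d) (q : ℕ) (u : ℂ) : EllTwo V →L[ℂ] EllTwo V :=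
  (1 + q * u ^ 2) • (1 : EllTwo V →L[ℂ] EllTwo V) - u • adjacencyOp X hd

/-! The domains, and the branches of the powers -/

/-- The open set `Ω`. -/
def domainΩ (q : ℕ) : Set ℂ :=
  ({u : ℂ | ‖u‖ ^ 2 = 1 / q} ∪ {u : ℂ | u.im = 0 ∧ 1 / q ≤ |u.re| ∧ |u.re| ≤ 1})ᶜ

/-- The open set `Ω' ⊇ Ω`, in which only the lower half of the circle is removed. -/
def domainΩ' (q : ℕ) : Set ℂ :=
  ({u : ℂ | ‖u‖ ^ 2 = 1 / q ∧ u.im ≤ 0} ∪ {u : ℂ | u.im = 0 ∧ 1 / q ≤ |u.re| ∧ |u.re| ≤ 1})ᶜ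

/-- `F` is the holomorphic extension to `Ω'` of the function `f` on the disc `|u| < 1 / q`. -/
def IsHolomorphicExtension (q : ℕ) (f F : ℂ → ℂ) : Prop :=
  DifferentiableOn ℂ F (domainΩ' q) ∧ ∀ u : ℂ, ‖u‖ < 1 / q → F u = f u

open Classical in
/-- The holomorphic extension to `Ω'` of a function on the disc `|u| < 1 / q`. -/
def holomorphicExtension (q : ℕ) (f : ℂ → ℂ) : ℂ → ℂ :=
  if h : ∃ F, IsHolomorphicExtension q f F then Classical.choose h else 0

/-- `u ↦ (1 - u²) ^ (a / 2)` on the unit disc (principal branch). -/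
def halfPow (a : ℤ) (u : ℂ) : ℂ := (1 - u ^ 2) ^ ((a : ℂ) / 2)

/-- `u ↦ (1 - q² u²) ^ (1 / 2)` on the disc `|u| < 1 / q` (principal branch). -/
def sqrtFactor (q : ℕ) (u : ℂ) : ℂ := (1 - (q : ℂ) ^ 2 * u ^ 2) ^ ((1 : ℂ) / 2)

/-- `u ↦ (1 + u) ^ ((q - 1) / 2) (1 - u) ^ ((q + 1) / 2)` on the unit disc (principal
branches). -/
def xiFactor (q : ℕ) (u : ℂ) : ℂ :=
  (1 + u) ^ (((q : ℂ) - 1) / 2) * (1 - u) ^ (((q : ℂ) + 1) / 2)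

namespace GraphTower

variable {V : Type*} {X : SimpleGraph V} [X.LocallyFinite]

/-- The right-hand side `(1 - u²) ^ ((1 - q) / 2) det_𝒢(Δ(u))⁻¹` of the determinant formula. -/
def determinantExpression (S : GraphTower X) (hd : ∃ d : ℕ, ∀ v, X.degree v ≤ d) (q : ℕ)
    (u : ℂ) : ℂ :=
  holomorphicExtension q (halfPow (1 - q)) u * (S.det (deformedLaplacian X hd q u))⁻¹

open Classical in
/-- The zeta function `Z` on `Ω`: the Euler product for `|u| < 1 / q`, extended by means of the
determinant formula. -/
def zeta (S : GraphTower X) (hd : ∃ d : ℕ, ∀ v, X.degree v ≤ d) (q : ℕ) (u : ℂ) : ℂ :=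
  if ‖u‖ < 1 / q then S.eulerProduct u else S.determinantExpression hd q u

/-- `Λ(u) = (1 - u²) ^ (q / 2) (1 - q² u²) ^ (1 / 2) Z(u)`. -/
def completedΛ (S : GraphTower X) (hd : ∃ d : ℕ, ∀ v, X.degree v ≤ d) (q : ℕ) (u : ℂ) : ℂ :=
  holomorphicExtension q (halfPow q) u * holomorphicExtension q (sqrtFactor q) u *
    S.zeta hd q u

/-- `ξ(u) = (1 + u) ^ ((q - 1) / 2) (1 - u) ^ ((q + 1) / 2) (1 - q u) Z(u)`. -/
def completedξ (S : GraphTower X) (hd : ∃ d : ℕ, ∀ v, X.degree v ≤ d) (q : ℕ) (u : ℂ) : ℂ :=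
  holomorphicExtension q (xiFactor q) u * (1 - q * u) * S.zeta hd q u

/-- `Ξ(u) = (1 - u²) ^ ((q - 1) / 2) (1 + q u²) Z(u)`. -/
def completedΞ (S : GraphTower X) (hd : ∃ d : ℕ, ∀ v, X.degree v ≤ d) (q : ℕ) (u : ℂ) : ℂ :=
  holomorphicExtension q (halfPow (q - 1)) u * (1 + q * u ^ 2) * S.zeta hd q u

end GraphTower

end

/-! Averages. For `n ≤ m` the graph `K m` is the union of its copies of `K n`, and these overlap
only in images of the invariant frontier. A family of closed paths that is invariant under the local
isomorphisms therefore has, up to an error proportional to the invariant frontier, `g` times as many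
members in `K m` as in `K n`, where `g` is the number of copies. The vertices themselves form such a
family (constant sequences), so dividing eliminates `g`, and the number per vertex is a Cauchy
sequence (`LocalFamily.exists_limit`). Its rate depends only on the length and the degree bound, and
this uniformity allows the multiplicities of the infinitely many classes of one length to be summed
(`hasSum_avgMultiplicity`).

The determinant. A vertex of maximal degree has infinitely many copies of the same degree, so
degrees are at most `q + 1` and `σ(A) ⊆ [-(q+1), q+1]`. Diagonal entries of `A ^ k` count closed
paths, hence polynomials in `A` have traces; by Weierstrass so do all continuous functions of `A`,
which gives a bounded functional `τ` with `τ 1 = 1` on the functions on this interval. Now `Δ(u)` is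
the function `1 + q u² - u x` of `A`, and for `u ∈ Ω` it avoids `0` on the whole interval. With any
continuous logarithm `g` of it, the determinant is `exp (τ g)` (`det_eq`). Holomorphy in `u`
follows, and so does `det Δ(1/(qu)) = (q u²)⁻¹ det Δ(u)`, because the function itself has this
symmetry.

The Euler product. The average number of reduced closed paths of length `m` is computed twice. In
terms of prime cycles it is the sum of `l p_l` over the divisors `l` of `m`, with `p_l` the density
of prime cycles of length `l`. In terms of the nonbacktracking operator on darts, whose powers
satisfy a Chebyshev type recursion, it is `τ(α^m + β^m) + (q-1)/2 (1 + (-1)^m)`, where `α + β = x`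
and `α β = q`. Multiplying by `u^m / m` and summing, the first form gives the logarithm of the Euler
product, the second gives `-τ(log(1 - xu + qu²)) - (q-1)/2 log(1 - u²)`.

Functional equations. Once the powers of `1 - u²` are combined, `ξ` and `Ξ` become `(1-u)(1-qu)` and
`1 + qu²` over the determinant; numerator and denominator acquire the same factor under inversion.
In `Λ` the square roots remain. The domain `Ω'` connects the inside and the outside of the circle
only through the upper half-plane, so outside `(1 - u²)^(1/2)` becomes `-iu (1 - u⁻²)^(1/2)`; the
two roots contribute `(-i)² = -1`, the sign in (i). -/

noncomputable section

/-! ### Copies of `K n` in `K m`: composition, covering and overlaps -/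

namespace GraphTower

variable {V : Type*} {X : SimpleGraph V}

/-- The maps `K n → V` underlying the local isomorphisms in `𝒢(n, m)`. -/
def copyMaps (S : GraphTower X) (n m : ℕ) : Set (↥(S.K n : Set V) → V) :=
  {f | ∃ k, n + k = m ∧ ∃ γ ∈ S.copies n k, ∀ v, f v = γ v}

variable {S : GraphTower X} {n m l : ℕ}

theorem copyMaps_le {f} (hf : f ∈ S.copyMaps n m) : n ≤ m := by
  obtain ⟨k, rfl, -⟩ := hf
  omega

theorem copyMaps_mem {f} (hf : f ∈ S.copyMaps n m) (v) : f v ∈ (S.K m : Set V) := by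
  obtain ⟨k, rfl, γ, -, h⟩ := hf
  rw [h]
  exact (γ v).2

theorem copyMaps_injective {f} (hf : f ∈ S.copyMaps n m) : Function.Injective f := by
  obtain ⟨k, rfl, γ, -, h⟩ := hf
  intro v w hvw
  rw [h, h] at hvw
  exact γ.injective (Subtype.ext hvw)

theorem copyMaps_adj {f} (hf : f ∈ S.copyMaps n m) (v w) :
    X.Adj (f v) (f w) ↔ X.Adj (v : V) w := by
  obtain ⟨k, rfl, γ, -, h⟩ := hf
  rw [h, h]
  exact γ.map_adj_iff (v := v) (w := w)

theorem copyMaps_self : S.copyMaps n n = {Subtype.val} := by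
  ext f
  constructor
  · rintro ⟨k, hk, γ, hγ, h⟩
    obtain rfl : k = 0 := by omega
    obtain rfl : γ = SimpleGraph.Embedding.refl := hγ
    funext v
    exact h v
  · rintro rfl
    exact ⟨0, rfl, _, rfl, fun v => rfl⟩

theorem copyMaps_succ (hnm : n ≤ m) (f : ↥(S.K n : Set V) → V) :
    f ∈ S.copyMaps n (m + 1) ↔ ∃ (β : ↥(S.K n : Set V) → V) (hβ : β ∈ S.copyMaps n m),
      ∃ γ ∈ S.G m, ∀ v, f v = γ ⟨β v, copyMaps_mem hβ v⟩ := by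
  constructor
  · rintro ⟨k, hk, γ, hγ, h⟩
    obtain ⟨j, rfl⟩ : ∃ j, k = j + 1 := ⟨m - n, by omega⟩
    obtain rfl : m = n + j := by omega
    obtain ⟨β, hβ, γ, hγ, rfl⟩ := hγ
    exact ⟨fun v => β v, ⟨j, rfl, β, hβ, fun v => rfl⟩, γ, hγ, h⟩
  · rintro ⟨β, hβ, γ, hγ, h⟩
    obtain ⟨k, rfl, δ, hδ, h'⟩ := id hβ
    refine ⟨k + 1, rfl, γ.comp δ, ⟨δ, hδ, γ, hγ, rfl⟩, fun v => ?_⟩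
    rw [h]
    have : (⟨β v, copyMaps_mem hβ v⟩ : (S.K (n + k) : Set V)) = δ v := Subtype.ext (h' v)
    rw [this]
    rfl

/-- The composition of copies. -/
theorem copyMaps_comp {f} (hf : f ∈ S.copyMaps n m) {g} (hg : g ∈ S.copyMaps m l) :
    (fun v => g ⟨f v, copyMaps_mem hf v⟩) ∈ S.copyMaps n l := by
  have hml := copyMaps_le hg
  induction l, hml using Nat.le_induction generalizing g with
  | base =>
    rw [copyMaps_self] at hg
    subst hg
    exact hf
  | succ l hml ih =>
    obtain ⟨β, hβ, γ, hγ, h⟩ := (copyMaps_succ hml _).1 hg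
    refine (copyMaps_succ ((copyMaps_le hf).trans hml) _).2 ⟨_, ih hβ, γ, hγ, fun v => ?_⟩
    rw [h]

/-- A product of local isomorphisms can be cut at any intermediate level. This locates a copy of `K
n` inside a copy of `K m`. -/
theorem copyMaps_decomp (hnm : n ≤ m) (hml : m ≤ l) {f} (hf : f ∈ S.copyMaps n l) :
    ∃ (β : ↥(S.K n : Set V) → V) (hβ : β ∈ S.copyMaps n m), ∃ g ∈ S.copyMaps m l,
      ∀ v, f v = g ⟨β v, copyMaps_mem hβ v⟩ := by
  induction l, hml using Nat.le_induction generalizing f with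
  | base => exact ⟨f, hf, Subtype.val, by rw [copyMaps_self]; rfl, fun v => rfl⟩
  | succ l hml ih =>
    obtain ⟨β, hβ, γ, hγ, h⟩ := (copyMaps_succ (hnm.trans hml) _).1 hf
    obtain ⟨δ, hδ, g, hg, h'⟩ := ih hβ
    refine ⟨δ, hδ, _, (copyMaps_succ hml _).2 ⟨g, hg, γ, hγ, fun v => rfl⟩, fun v => ?_⟩
    rw [h]
    congr 2
    exact Subtype.ext (h' v)

theorem mem_copyMaps_of_copies {k : ℕ} {γ} (hγ : γ ∈ S.copies n k) :
    (fun v => (γ v : V)) ∈ S.copyMaps n (n + k) := ⟨k, rfl, γ, hγ, fun _ => rfl⟩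

theorem mem_invariantFrontier {f} (hf : f ∈ S.copyMaps n m) {v : (S.K n : Set V)}
    (h : f v ∈ vertexFrontier X (Set.range f)) : (v : V) ∈ S.invariantFrontier n := by
  obtain ⟨k, rfl, γ, hγ, hf⟩ := hf
  refine ⟨v.2, k, γ, hγ, ?_⟩
  have : f = fun v => (γ v : V) := funext hf
  subst this
  exact h

theorem invariantFrontier_subset : S.invariantFrontier n ⊆ (S.K n : Set V) := fun _ h => h.1

theorem copyMaps_finite (hS : S.IsSelfSimilar) (hnm : n ≤ m) : (S.copyMaps n m).Finite := by
  induction m, hnm using Nat.le_induction with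
  | base => rw [copyMaps_self]; exact Set.finite_singleton _
  | succ m hnm ih =>
    classical
    have := ih.to_subtype
    have := (hS.finite_G m).to_subtype
    refine (Set.finite_range fun p : S.copyMaps n m × S.G m =>
      fun v => ((p.2.1 ⟨p.1.1 v, copyMaps_mem p.1.2 v⟩ : (S.K (m + 1) : Set V)) : V)).subset ?_
    intro f hf
    obtain ⟨β, hβ, γ, hγ, h⟩ := (copyMaps_succ hnm _).1 hf
    exact ⟨(⟨β, hβ⟩, ⟨γ, hγ⟩), (funext h).symm⟩

theorem copyMaps_cover (hS : S.IsSelfSimilar) (hnm : n ≤ m) {v : V} (hv : v ∈ S.K m) :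
    ∃ f ∈ S.copyMaps n m, v ∈ Set.range f := by
  induction m, hnm using Nat.le_induction generalizing v with
  | base => exact ⟨Subtype.val, by rw [copyMaps_self]; rfl, ⟨v, hv⟩, rfl⟩
  | succ m hnm ih =>
    obtain ⟨γ, hγ, w, rfl⟩ := hS.cover_vertices m v hv
    obtain ⟨β, hβ, x, hx⟩ := ih w.2
    refine ⟨_, (copyMaps_succ hnm _).2 ⟨β, hβ, γ, hγ, fun v => rfl⟩, x, ?_⟩
    have : (⟨β x, copyMaps_mem hβ x⟩ : (S.K m : Set V)) = w := Subtype.ext hx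
    simp only [this]

/-- Distinct copies of `K n` meet only in images of the invariant frontier. -/
theorem copyMaps_overlap (hS : S.IsSelfSimilar) {f f'} (hf : f ∈ S.copyMaps n m)
    (hf' : f' ∈ S.copyMaps n m) (hne : f ≠ f') {v v' : (S.K n : Set V)} (h : f v = f' v') :
    (v : V) ∈ S.invariantFrontier n := by
  have hnm := copyMaps_le hf
  induction m, hnm using Nat.le_induction generalizing f f' with
  | base =>
    rw [copyMaps_self] at hf hf'
    exact absurd (hf.trans hf'.symm) hne
  | succ m hnm ih =>
    obtain ⟨β, hβ, γ, hγ, e⟩ := (copyMaps_succ hnm _).1 hf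
    obtain ⟨β', hβ', γ', hγ', e'⟩ := (copyMaps_succ hnm _).1 hf'
    by_cases hγγ : γ = γ'
    · subst hγγ
      have hb : β v = β' v' := by
        rw [e, e'] at h
        exact congrArg Subtype.val (γ.injective (Subtype.ext h))
      refine ih hβ hβ' (fun hbb => hne ?_) hb
      subst hbb
      funext x
      rw [e, e']
    -- Different last factors: the overlap axiom puts the point on the frontier of `γ (K m)`, and a
    -- neighbour outside `γ (K m)` is also outside the smaller copy `f (K n)`.
    · have hx : f v ∈ S.image γ ∩ S.image γ' :=
        ⟨⟨_, (e v).symm⟩, ⟨_, (e' v').symm.trans h.symm⟩⟩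
      rw [hS.overlap m γ hγ γ' hγ' hγγ] at hx
      obtain ⟨-, z, hz, hadj⟩ := hx.1
      refine mem_invariantFrontier hf ⟨⟨v, rfl⟩, z, ?_, hadj⟩
      rintro ⟨y, rfl⟩
      exact hz ⟨_, (e y).symm⟩

/-- If `K n` were empty, all later `K m`, being covered by copies of it, would be empty too. -/
theorem IsSelfSimilar.nonempty [Infinite V] (hS : S.IsSelfSimilar) (n : ℕ) :
    (S.K n).Nonempty := by
  by_contra hn
  rw [Finset.not_nonempty_iff_eq_empty] at hn
  have h : ∀ m, n ≤ m → S.K m = ∅ := by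
    intro m hm
    rw [Finset.eq_empty_iff_forall_notMem]
    intro v hv
    obtain ⟨f, -, x, -⟩ := copyMaps_cover hS hm hv
    have := x.2
    simp [hn] at this
  obtain ⟨v⟩ := (inferInstance : Nonempty V)
  obtain ⟨m, hm⟩ := hS.exhausts v
  have := hS.mono (le_max_left m n) hm
  rw [h _ (le_max_right m n)] at this
  simp at this

theorem IsSelfSimilar.exists_subset (hS : S.IsSelfSimilar) (s : Finset V) : ∃ n, s ⊆ S.K n := by
  classical
  induction s using Finset.induction_on with
  | empty => exact ⟨0, by simp⟩
  | insert v s _ ih =>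
    obtain ⟨n, hn⟩ := ih
    obtain ⟨m, hm⟩ := hS.exhausts v
    refine ⟨max m n, Finset.insert_subset (hS.mono (le_max_left _ _) hm)
      (hn.trans (hS.mono (le_max_right _ _)))⟩

theorem IsSelfSimilar.tendsto_card [Infinite V] (hS : S.IsSelfSimilar) :
    Tendsto (fun n => (S.K n).card) atTop atTop := by
  refine tendsto_atTop_atTop.2 fun b => ?_
  obtain ⟨s, hs⟩ := Infinite.exists_subset_card_eq V b
  obtain ⟨n, hn⟩ := hS.exists_subset s
  exact ⟨n, fun m hm => hs ▸ Finset.card_le_card (hn.trans (hS.mono hm))⟩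

end GraphTower

end

/-! ### Local families of sequences and the existence of their averages -/

noncomputable section

theorem Set.ncard_biUnion_le_sum {ι α : Type*} (t : Finset ι) (s : ι → Set α) :
    (⋃ i ∈ t, s i).ncard ≤ ∑ i ∈ t, (s i).ncard := by
  classical
  induction t using Finset.induction_on with
  | empty => simp
  | insert i t hi ih =>
    rw [Finset.set_biUnion_insert, Finset.sum_insert hi]
    exact (Set.ncard_union_le _ _).trans (by omega)

theorem Set.ncard_biUnion_eq_sum {ι α : Type*} (t : Finset ι) (s : ι → Set α)
    (hf : ∀ i ∈ t, (s i).Finite)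
    (hd : ∀ i ∈ t, ∀ j ∈ t, i ≠ j → Disjoint (s i) (s j)) :
    (⋃ i ∈ t, s i).ncard = ∑ i ∈ t, (s i).ncard := by
  classical
  induction t using Finset.induction_on with
  | empty => simp
  | insert i t hi ih =>
    rw [Finset.set_biUnion_insert, Finset.sum_insert hi, Set.ncard_union_eq ?_ ?_ ?_,
      ih (fun j hj => hf j (Finset.mem_insert_of_mem hj))
        (fun j hj k hk => hd j (Finset.mem_insert_of_mem hj) k (Finset.mem_insert_of_mem hk))]
    · refine Set.disjoint_iUnion₂_right.2 fun j hj => ?_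
      exact hd i (Finset.mem_insert_self _ _) j (Finset.mem_insert_of_mem hj)
        (by rintro rfl; exact hi hj)
    · exact hf i (Finset.mem_insert_self _ _)
    · exact t.finite_toSet.biUnion fun j hj => hf j (Finset.mem_insert_of_mem hj)

namespace GraphTower

variable {V : Type*} {X : SimpleGraph V}

/-- A family of bi-infinite sequences of vertices that is invariant under the local isomorphisms,
such that a sequence that leaves a set meets its frontier, and at most `c₀` sequences meet a
given vertex. -/
structure LocalFamily (S : GraphTower X) (c₀ : ℕ) (P : Set (ℤ → V)) : Prop where
  conn : ∀ c ∈ P, ∀ (A : Set V) (i j : ℤ), c i ∈ A → c j ∉ A → ∃ k, c k ∈ vertexFrontier X A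
  finite_meeting : ∀ F : Finset V, {c | c ∈ P ∧ ∃ i, c i ∈ F}.Finite
  card_meeting : ∀ F : Finset V, {c | c ∈ P ∧ ∃ i, c i ∈ F}.ncard ≤ c₀ * F.card
  inv : ∀ n m, ∀ f ∈ S.copyMaps n m, ∀ c : ℤ → ↥(S.K n : Set V),
    (fun i => f (c i)) ∈ P ↔ (fun i => (c i : V)) ∈ P

/-- The sequences of the family that lie in `K n`. -/
def inside (S : GraphTower X) (P : Set (ℤ → V)) (n : ℕ) : Set (ℤ → V) :=
  {c | c ∈ P ∧ ∀ i, c i ∈ S.K n}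

variable {S : GraphTower X} {c₀ : ℕ} {P : Set (ℤ → V)}

theorem LocalFamily.inside_finite (hP : S.LocalFamily c₀ P) (n : ℕ) : (S.inside P n).Finite :=
  (hP.finite_meeting (S.K n)).subset fun _ hc => ⟨hc.1, 0, hc.2 0⟩

theorem LocalFamily.inside_card_le (hP : S.LocalFamily c₀ P) (n : ℕ) :
    (S.inside P n).ncard ≤ c₀ * (S.K n).card :=
  (Set.ncard_le_ncard (t := {c | c ∈ P ∧ ∃ i, c i ∈ S.K n})
    (fun _ hc => ⟨hc.1, 0, hc.2 0⟩) (hP.finite_meeting (S.K n))).trans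
    (hP.card_meeting _)

theorem invariantFrontier_finite (S : GraphTower X) (n : ℕ) : (S.invariantFrontier n).Finite :=
  (S.K n).finite_toSet.subset invariantFrontier_subset

/-- The sequences in the image of a copy correspond to those in `K n`. -/
theorem LocalFamily.ncard_image (hP : S.LocalFamily c₀ P) {n m : ℕ} {f}
    (hf : f ∈ S.copyMaps n m) :
    {c | c ∈ P ∧ ∀ i, c i ∈ Set.range f}.ncard = (S.inside P n).ncard := by
  have h1 : {c | c ∈ P ∧ ∀ i, c i ∈ Set.range f} =
      (fun c : ℤ → ↥(S.K n : Set V) => fun i => f (c i)) ''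
        {c | (fun i => (c i : V)) ∈ P} := by
    ext c
    constructor
    · rintro ⟨hc, h⟩
      choose b hb using h
      obtain rfl : (fun i => f (b i)) = c := funext hb
      exact ⟨b, (hP.inv n m f hf b).1 hc, rfl⟩
    · rintro ⟨b, hb, rfl⟩
      exact ⟨(hP.inv n m f hf b).2 hb, fun i => ⟨_, rfl⟩⟩
  have h2 : S.inside P n =
      (fun c : ℤ → ↥(S.K n : Set V) => fun i => (c i : V)) ''
        {c | (fun i => (c i : V)) ∈ P} := by
    ext c
    constructor
    · rintro ⟨hc, h⟩
      exact ⟨fun i => ⟨c i, h i⟩, hc, rfl⟩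
    · rintro ⟨b, hb, rfl⟩
      exact ⟨hb, fun i => (b i).2⟩
  rw [h1, h2, Set.ncard_image_of_injective, Set.ncard_image_of_injective]
  · intro b b' h
    funext i
    exact Subtype.ext (congrFun h i)
  · intro b b' h
    funext i
    exact copyMaps_injective hf (congrFun h i)

open Classical in
/-- The image of the invariant frontier in a copy. -/
def frontierImage (S : GraphTower X) {n : ℕ} (f : ↥(S.K n : Set V) → V) : Finset V :=
  ((Finset.univ : Finset ↥(S.K n : Set V)).filter
    fun v : ↥(S.K n : Set V) => (v : V) ∈ S.invariantFrontier n).image f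

theorem mem_frontierImage {n : ℕ} {f : ↥(S.K n : Set V) → V} {v : ↥(S.K n : Set V)}
    (hv : (v : V) ∈ S.invariantFrontier n) : f v ∈ S.frontierImage f := by
  classical
  exact Finset.mem_image.2 ⟨v, Finset.mem_filter.2 ⟨Finset.mem_univ _, hv⟩, rfl⟩

theorem frontierImage_card_le (S : GraphTower X) {n : ℕ} (f : ↥(S.K n : Set V) → V) :
    (S.frontierImage f).card ≤ (S.invariantFrontier n).ncard := by
  classical
  refine Finset.card_image_le.trans ?_
  rw [← Set.ncard_coe_finset]
  refine Set.ncard_le_ncard_of_injOn (fun v => (v : V)) ?_ ?_ (S.invariantFrontier_finite n)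
  · intro v hv
    simpa using (Finset.mem_filter.1 hv).2
  · intro v _ w _ h
    exact Subtype.ext h

/-- Up to sequences that meet frontiers, the sequences in `K m` are those in the copies of
`K n`. -/
theorem LocalFamily.card_sub_le (hS : S.IsSelfSimilar) (hP : S.LocalFamily c₀ P) {n m : ℕ}
    (hnm : n ≤ m) :
    |((S.inside P m).ncard : ℝ) - (S.copyMaps n m).ncard * (S.inside P n).ncard| ≤
      c₀ * ((S.copyMaps n m).ncard * (S.invariantFrontier n).ncard) := by
  classical
  set G := (copyMaps_finite hS hnm).toFinset with hG
  have hGm : ∀ f, f ∈ G ↔ f ∈ S.copyMaps n m := fun f => (copyMaps_finite hS hnm).mem_toFinset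
  have hGc : (S.copyMaps n m).ncard = G.card := Set.ncard_eq_toFinset_card _ _
  let A : (↥(S.K n : Set V) → V) → Set (ℤ → V) := fun f => {c | c ∈ P ∧ ∀ i, c i ∈ Set.range f}
  let B : (↥(S.K n : Set V) → V) → Set (ℤ → V) :=
    fun f => {c | c ∈ P ∧ ∃ i, c i ∈ S.frontierImage f}
  have hBfin : ∀ f, (B f).Finite := fun f => hP.finite_meeting _
  have hB : ∀ f, (B f).ncard ≤ c₀ * (S.invariantFrontier n).ncard := fun f =>
    (hP.card_meeting _).trans (Nat.mul_le_mul_left _ (S.frontierImage_card_le f))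
  have hAin : ∀ f ∈ G, A f ⊆ S.inside P m := by
    rintro f hf c ⟨hc, h⟩
    refine ⟨hc, fun i => ?_⟩
    obtain ⟨v, hv⟩ := h i
    rw [← hv]
    exact copyMaps_mem ((hGm f).1 hf) v
  have hAfin : ∀ f ∈ G, (A f).Finite := fun f hf => (hP.inside_finite m).subset (hAin f hf)
  have hA : ∀ f ∈ G, (A f).ncard = (S.inside P n).ncard := fun f hf =>
    hP.ncard_image ((hGm f).1 hf)
  have hup : (S.inside P m).ncard ≤ G.card * (S.inside P n).ncard +
      G.card * (c₀ * (S.invariantFrontier n).ncard) := by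
    -- Take a copy that contains the starting point. Either the sequence stays in it, or it meets
    -- the frontier of the copy, which is contained in the image of the invariant frontier.
    have hsub : S.inside P m ⊆ (⋃ f ∈ G, A f) ∪ ⋃ f ∈ G, B f := by
      rintro c ⟨hc, h⟩
      obtain ⟨f, hf, hv⟩ := copyMaps_cover hS hnm (h 0)
      by_cases hall : ∀ i, c i ∈ Set.range f
      · exact Or.inl (Set.mem_biUnion ((hGm f).2 hf) ⟨hc, hall⟩)
      · push Not at hall
        obtain ⟨j, hj⟩ := hall
        obtain ⟨k, hk⟩ := hP.conn c hc _ 0 j hv hj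
        obtain ⟨w, hw⟩ := hk.1
        refine Or.inr (Set.mem_biUnion ((hGm f).2 hf) ⟨hc, k, ?_⟩)
        rw [← hw] at hk ⊢
        exact mem_frontierImage (mem_invariantFrontier hf hk)
    calc (S.inside P m).ncard ≤ ((⋃ f ∈ G, A f) ∪ ⋃ f ∈ G, B f).ncard :=
          Set.ncard_le_ncard hsub ((G.finite_toSet.biUnion hAfin).union
            (G.finite_toSet.biUnion fun f _ => hBfin f))
      _ ≤ ∑ f ∈ G, (A f).ncard + ∑ f ∈ G, (B f).ncard :=
          (Set.ncard_union_le _ _).trans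
            (add_le_add (Set.ncard_biUnion_le_sum _ _) (Set.ncard_biUnion_le_sum _ _))
      _ ≤ ∑ f ∈ G, (S.inside P n).ncard + ∑ f ∈ G, c₀ * (S.invariantFrontier n).ncard :=
          add_le_add (Finset.sum_le_sum fun f hf => (hA f hf).le)
            (Finset.sum_le_sum fun f _ => hB f)
      _ = _ := by simp
  have hlow : G.card * (S.inside P n).ncard ≤ (S.inside P m).ncard +
      G.card * (c₀ * (S.invariantFrontier n).ncard) := by
    -- Once the sequences that meet frontier images are discarded, those in different copies are
    -- distinct, because copies overlap only there.
    have hsum : ∑ f ∈ G, (A f \ B f).ncard ≤ (S.inside P m).ncard := by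
      rw [← Set.ncard_biUnion_eq_sum]
      · refine Set.ncard_le_ncard ?_ (hP.inside_finite m)
        exact Set.iUnion₂_subset fun f hf => Set.sdiff_subset.trans (hAin f hf)
      · exact fun f hf => (hAfin f hf).subset Set.sdiff_subset
      · intro f hf f' hf' hne
        rw [Set.disjoint_left]
        rintro c ⟨⟨hc, h⟩, hb⟩ ⟨⟨-, h'⟩, -⟩
        obtain ⟨v, hv⟩ := h 0
        obtain ⟨v', hv'⟩ := h' 0
        refine hb ⟨hc, 0, ?_⟩
        rw [← hv]
        exact mem_frontierImage (copyMaps_overlap hS ((hGm f).1 hf) ((hGm f').1 hf') hne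
          (hv.trans hv'.symm))
    have h1 : ∀ f ∈ G, (S.inside P n).ncard ≤
        (A f \ B f).ncard + c₀ * (S.invariantFrontier n).ncard := by
      intro f hf
      rw [← hA f hf]
      exact (Set.ncard_le_ncard_sdiff_add_ncard _ _ (hBfin f)).trans
        (Nat.add_le_add_left (hB f) _)
    calc G.card * (S.inside P n).ncard = ∑ f ∈ G, (S.inside P n).ncard := by simp
      _ ≤ ∑ f ∈ G, ((A f \ B f).ncard + c₀ * (S.invariantFrontier n).ncard) :=
          Finset.sum_le_sum h1
      _ ≤ _ := by
          rw [Finset.sum_add_distrib, Finset.sum_const, smul_eq_mul]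
          omega
  rw [hGc, abs_le]
  have hup' : ((S.inside P m).ncard : ℝ) ≤ G.card * (S.inside P n).ncard +
      G.card * (c₀ * (S.invariantFrontier n).ncard) := by exact_mod_cast hup
  have hlow' : (G.card : ℝ) * (S.inside P n).ncard ≤ (S.inside P m).ncard +
      G.card * (c₀ * (S.invariantFrontier n).ncard) := by exact_mod_cast hlow
  constructor <;> linarith

/-- The constant sequences. -/
theorem localFamily_const (S : GraphTower X) :
    S.LocalFamily 1 (Set.range fun (v : V) (_ : ℤ) => v) := by
  have hm : ∀ F : Finset V, {c | c ∈ (Set.range fun (v : V) (_ : ℤ) => v) ∧ ∃ i, c i ∈ F} =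
      (fun (v : V) (_ : ℤ) => v) '' F := by
    intro F
    ext c
    constructor
    · rintro ⟨⟨v, rfl⟩, _, h⟩
      exact ⟨v, h, rfl⟩
    · rintro ⟨v, h, rfl⟩
      exact ⟨⟨v, rfl⟩, 0, h⟩
  refine ⟨?_, fun F => ?_, fun F => ?_, ?_⟩
  · rintro _ ⟨v, rfl⟩ A i j hi hj
    exact absurd hi hj
  · rw [hm]
    exact F.finite_toSet.image _
  · rw [hm, one_mul]
    exact (Set.ncard_image_le F.finite_toSet).trans (Set.ncard_coe_finset F).le
  · intro n m f hf c
    constructor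
    · rintro ⟨v, hv⟩
      refine ⟨c 0, funext fun i => ?_⟩
      have h : f (c 0) = f (c i) := (congrFun hv 0).symm.trans (congrFun hv i)
      exact congrArg Subtype.val (copyMaps_injective hf h)
    · rintro ⟨v, hv⟩
      refine ⟨f (c 0), funext fun i => ?_⟩
      have h : (c 0 : V) = c i := (congrFun hv 0).symm.trans (congrFun hv i)
      exact congrArg f (Subtype.ext h)

theorem inside_const_ncard (S : GraphTower X) (n : ℕ) :
    (S.inside (Set.range fun (v : V) (_ : ℤ) => v) n).ncard = (S.K n).card := by
  have : S.inside (Set.range fun (v : V) (_ : ℤ) => v) n = (fun (v : V) (_ : ℤ) => v) '' S.K n := by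
    ext c
    constructor
    · rintro ⟨⟨v, rfl⟩, h⟩
      exact ⟨v, h 0, rfl⟩
    · rintro ⟨v, h, rfl⟩
      exact ⟨⟨v, rfl⟩, fun _ => h⟩
  rw [this, Set.ncard_image_of_injective, Set.ncard_coe_finset]
  intro v w h
  exact congrFun h 0

/-- The relative size of the invariant frontier. -/
def frontierRatio (S : GraphTower X) (n : ℕ) : ℝ :=
  (S.invariantFrontier n).ncard / (S.K n).card

/-- `card_sub_le` is used for `P` and for the constant sequences, with the same number of copies.
Cross-multiplying the two estimates eliminates this number. -/
theorem LocalFamily.ratio_sub_le [Infinite V] (hS : S.IsSelfSimilar) (hP : S.LocalFamily c₀ P)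
    {n m : ℕ} (hnm : n ≤ m) (hn : S.frontierRatio n ≤ 1 / 2) :
    |((S.inside P m).ncard : ℝ) / (S.K m).card - (S.inside P n).ncard / (S.K n).card| ≤
      4 * c₀ * S.frontierRatio n := by
  have h1 := hP.card_sub_le hS hnm
  have h2 := S.localFamily_const.card_sub_le hS hnm
  rw [inside_const_ncard, inside_const_ncard] at h2
  have hk : (0 : ℝ) < (S.K n).card := by exact_mod_cast (hS.nonempty n).card_pos
  have hK : (0 : ℝ) < (S.K m).card := by exact_mod_cast (hS.nonempty m).card_pos
  have hs : ((S.inside P n).ncard : ℝ) ≤ c₀ * (S.K n).card := by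
    exact_mod_cast hP.inside_card_le n
  rw [frontierRatio] at hn ⊢
  have hs0 : (0 : ℝ) ≤ (S.inside P n).ncard := by positivity
  generalize ((S.inside P n).ncard : ℝ) = s at *
  generalize ((S.inside P m).ncard : ℝ) = t at *
  have hg0 : (0 : ℝ) ≤ (S.copyMaps n m).ncard := by positivity
  have hf0 : (0 : ℝ) ≤ (S.invariantFrontier n).ncard := by positivity
  have hc0 : (0 : ℝ) ≤ c₀ := by positivity
  generalize ((S.copyMaps n m).ncard : ℝ) = g at *
  generalize ((S.invariantFrontier n).ncard : ℝ) = f at *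
  generalize ((S.K n).card : ℝ) = k at *
  generalize ((S.K m).card : ℝ) = K at *
  generalize (c₀ : ℝ) = c at *
  rw [Nat.cast_one, one_mul] at h2
  rw [div_le_iff₀ hk] at hn
  have h3 : |t * k - s * K| ≤ 4 * c * f * K := by
    have e : t * k - s * K = (t - g * s) * k + -(s * (K - g * k)) := by ring
    rw [e]
    refine (abs_add_le _ _).trans ?_
    rw [abs_neg, abs_mul, abs_mul, abs_of_pos hk, abs_of_nonneg hs0]
    have a1 := mul_le_mul_of_nonneg_right h1 hk.le
    have a2 := mul_le_mul hs h2 (abs_nonneg _) (by positivity)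
    -- The threshold `1 / 2` enters here: from `f ≤ k / 2` and `K ≥ g k - g f` one gets `g k ≤ 2 K`.
    -- The total error `2 c g f k` is then at most `4 c f K`.
    have a3 : g * k ≤ 2 * K := by
      have := (abs_le.1 h2).1
      have := mul_le_mul_of_nonneg_left hn hg0
      linarith
    have a4 := mul_le_mul_of_nonneg_left a3 (mul_nonneg hc0 hf0)
    linarith
  have e : t / K - s / k = (t * k - s * K) / (K * k) := by
    field_simp
  have e' : 4 * c * (f / k) = 4 * c * f * K / (K * k) := by
    field_simp
  rw [e, e', abs_div, abs_of_pos (mul_pos hK hk)]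
  gcongr

/-- Averages of local families exist, with a rate that only depends on `c₀`. -/
theorem LocalFamily.exists_limit [Infinite V] (hS : S.IsSelfSimilar) (hP : S.LocalFamily c₀ P) :
    ∃ L : ℝ, Tendsto (fun n => ((S.inside P n).ncard : ℝ) / (S.K n).card) atTop (𝓝 L) ∧
      ∀ n, S.frontierRatio n ≤ 1 / 2 →
        |L - (S.inside P n).ncard / (S.K n).card| ≤ 4 * c₀ * S.frontierRatio n := by
  have h0 : Tendsto S.frontierRatio atTop (𝓝 0) := hS.invariant_amenable
  have hev : ∀ᶠ n in atTop, S.frontierRatio n ≤ 1 / 2 :=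
    h0.eventually (ge_mem_nhds (by norm_num))
  have hc : CauchySeq fun n => ((S.inside P n).ncard : ℝ) / (S.K n).card := by
    rw [Metric.cauchySeq_iff']
    intro ε hε
    have h1 : Tendsto (fun n => 4 * c₀ * S.frontierRatio n) atTop (𝓝 0) := by
      simpa using h0.const_mul (4 * (c₀ : ℝ))
    obtain ⟨N, hN, hN'⟩ := (hev.and (h1.eventually (gt_mem_nhds hε))).exists
    exact ⟨N, fun n hn => (hP.ratio_sub_le hS hn hN).trans_lt hN'⟩
  obtain ⟨L, hL⟩ := cauchySeq_tendsto_of_complete hc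
  refine ⟨L, hL, fun n hn => ?_⟩
  refine le_of_tendsto ((hL.sub_const _).abs) ?_
  filter_upwards [eventually_ge_atTop n] with m hm
  exact hP.ratio_sub_le hS hm hn

end GraphTower

end

noncomputable section

/-! Closed walks of a locally finite relation -/

section Relation

variable {E : Type*} (N : E → Finset E)

/-- The transfer operator of a locally finite relation. -/
def stepOp : Module.End ℂ (E → ℂ) where
  toFun g e := ∑ f ∈ N e, g f
  map_add' _ _ := funext fun _ => Finset.sum_add_distrib
  map_smul' _ _ := funext fun _ => by simp [Finset.mul_sum]

theorem stepOp_apply (g : E → ℂ) (e : E) : stepOp N g e = ∑ f ∈ N e, g f := rfl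

/-- The walks of length `m` from `e` to `f`. -/
def walkSet (m : ℕ) (e f : E) : Set (Fin (m + 1) → E) :=
  {w | w 0 = e ∧ w (Fin.last m) = f ∧ ∀ i : Fin m, w i.succ ∈ N (w i.castSucc)}

theorem walkSet_succ (m : ℕ) (e f : E) :
    walkSet N (m + 1) e f = ⋃ g ∈ N e, Fin.cons (α := fun _ => E) e '' walkSet N m g f := by
  ext w
  simp only [Set.mem_iUnion, Set.mem_image, exists_prop]
  constructor
  · rintro ⟨h0, h1, h2⟩
    refine ⟨w 1, ?_, Fin.tail w, ⟨rfl, h1, fun i => h2 i.succ⟩, ?_⟩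
    · have := h2 0
      rwa [Fin.castSucc_zero, h0] at this
    · rw [← h0]
      exact Fin.cons_self_tail w
  · rintro ⟨g, hg, w, ⟨h0, h1, h2⟩, rfl⟩
    refine ⟨rfl, ?_, fun i => ?_⟩
    · rw [← h1, ← Fin.succ_last, Fin.cons_succ]
    · refine Fin.cases ?_ (fun i => ?_) i
      · simpa [h0] using hg
      · simpa using h2 i

/-- Matrix powers count walks. Finiteness is carried along in the induction since `ncard` is
additive over the disjoint union only for finite sets. -/
theorem walkSet_finite_and_ncard [DecidableEq E] (m : ℕ) (e f : E) :
    (walkSet N m e f).Finite ∧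
      (stepOp N ^ m) (Pi.single f 1) e = ((walkSet N m e f).ncard : ℂ) := by
  induction m generalizing e with
  | zero =>
    by_cases h : e = f
    · have : walkSet N 0 e f = {fun _ => e} := by
        ext w
        constructor
        · rintro ⟨h0, -⟩
          funext i
          rw [Fin.fin_one_eq_zero i]
          exact h0
        · rintro rfl
          exact ⟨rfl, h, fun i => i.elim0⟩
      rw [this]
      simp [h]
    · have : walkSet N 0 e f = ∅ := by
        rw [Set.eq_empty_iff_forall_notMem]
        rintro w ⟨h0, h1, -⟩
        exact h (h0.symm.trans h1)
      rw [this]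
      simp [h]
  | succ m ih =>
    have hinj : Function.Injective (Fin.cons (α := fun _ : Fin (m + 2) => E) e) :=
      Fin.cons_right_injective (α := fun _ : Fin (m + 2) => E) e
    rw [walkSet_succ]
    constructor
    · exact (N e).finite_toSet.biUnion fun g _ => (ih g).1.image _
    · rw [Set.ncard_biUnion_eq_sum, pow_succ', Module.End.mul_apply, stepOp_apply, Nat.cast_sum]
      · refine Finset.sum_congr rfl fun g _ => ?_
        rw [(ih g).2, Set.ncard_image_of_injective _ hinj]
      · exact fun g _ => (ih g).1.image _
      · intro g _ g' _ hne
        rw [Set.disjoint_left]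
        rintro _ ⟨w, hw, rfl⟩ ⟨w', hw', h⟩
        have := hinj h
        subst this
        exact hne (hw.1.symm.trans hw'.1)

theorem walkSet_ncard_le {D : ℕ} (hD : ∀ e, (N e).card ≤ D) (m : ℕ) (e f : E) :
    (walkSet N m e f).ncard ≤ D ^ m := by
  induction m generalizing e with
  | zero =>
    refine (Set.ncard_le_ncard (t := {fun _ => e}) fun w hw => funext fun i => ?_).trans (by simp)
    rw [Fin.fin_one_eq_zero i]
    exact hw.1
  | succ m ih =>
    rw [walkSet_succ]
    calc _ ≤ ∑ g ∈ N e, (Fin.cons (α := fun _ : Fin (m + 2) => E) e '' walkSet N m g f).ncard :=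
          Set.ncard_biUnion_le_sum _ _
      _ ≤ ∑ g ∈ N e, D ^ m := by
          refine Finset.sum_le_sum fun g _ => ?_
          rw [Set.ncard_image_of_injective _
            (Fin.cons_right_injective (α := fun _ : Fin (m + 2) => E) e)]
          exact ih g
      _ ≤ D ^ (m + 1) := by
          rw [Finset.sum_const, smul_eq_mul, pow_succ']
          exact Nat.mul_le_mul_right _ (hD e)

/-- The `m`-periodic sequences of steps with `c 0 = e`. -/
def closedSeq (m : ℕ) (e : E) : Set (ℤ → E) :=
  {c | (∀ i, c (i + m) = c i) ∧ (∀ i, c (i + 1) ∈ N (c i)) ∧ c 0 = e}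

theorem apply_emod_of_periodic {c : ℤ → E} {m : ℕ} (h : ∀ i, c (i + m) = c i) (i : ℤ) :
    c (i % m) = c i := by
  have hp : Function.Periodic c (m : ℤ) := h
  have := hp.int_mul (i / m) (i % m)
  rw [← this]
  congr 1
  rw [mul_comm, Int.cast_id, Int.emod_add_mul_ediv]

/-- A periodic sequence is determined by one period; conversely a closed walk extends by reading the
index modulo `m`. -/
theorem closedSeq_image {m : ℕ} (hm : 0 < m) (e : E) :
    (fun (c : ℤ → E) (i : Fin (m + 1)) => c (i : ℕ)) '' closedSeq N m e = walkSet N m e e := by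
  ext w
  constructor
  · rintro ⟨c, ⟨h1, h2, h3⟩, rfl⟩
    refine ⟨by simpa using h3, ?_, fun i => ?_⟩
    · have := h1 0
      rw [zero_add] at this
      simpa [this] using h3
    · simpa using h2 i
  · rintro ⟨h0, h1, h2⟩
    have hm' : (0 : ℤ) < m := by exact_mod_cast hm
    have hlt : ∀ i : ℤ, (i % m).toNat < m + 1 := fun i => by
      have := Int.emod_lt_of_pos i hm'
      omega
    refine ⟨fun i => w ⟨(i % m).toNat, hlt i⟩, ⟨fun i => ?_, fun i => ?_, ?_⟩, ?_⟩
    · simp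
    · have hr0 := Int.emod_nonneg i hm'.ne'
      have hr1 := Int.emod_lt_of_pos i hm'
      have hstep := h2 ⟨(i % m).toNat, by omega⟩
      have e1 : (Fin.castSucc ⟨(i % m).toNat, by omega⟩ : Fin (m + 1)) =
        ⟨(i % m).toNat, hlt i⟩ := rfl
      rw [e1] at hstep
      by_cases hc : i % m + 1 < m
      · have : (i + 1) % m = i % m + 1 := by
          rw [← Int.emod_add_emod, Int.emod_eq_of_lt (by omega) hc]
        have e2 : (⟨((i + 1) % m).toNat, hlt (i + 1)⟩ : Fin (m + 1)) =
            Fin.succ ⟨(i % m).toNat, by omega⟩ := by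
          ext
          simp only [Fin.val_succ]
          omega
        simp only [e2]
        exact hstep
      -- The step that closes the walk: the index wraps around to `0`, and `w` has the same value at
      -- `0` and at its last entry.
      · have hc' : i % m + 1 = m := by omega
        have : (i + 1) % m = 0 := by
          rw [← Int.emod_add_emod, hc', Int.emod_self]
        have e2 : (⟨((i + 1) % m).toNat, hlt (i + 1)⟩ : Fin (m + 1)) = 0 := by
          ext
          simp [this]
        have e3 : Fin.succ ⟨(i % m).toNat, by omega⟩ = Fin.last m := by
          ext
          simp only [Fin.val_succ, Fin.val_last]
          omega
        rw [e3, h1] at hstep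
        simp only [e2, h0]
        exact hstep
    · simpa using h0
    · funext i
      by_cases hi : (i : ℕ) < m
      · refine congrArg w (Fin.ext ?_)
        simp only
        rw [Int.emod_eq_of_lt (by omega) (by exact_mod_cast hi)]
        simp
      · have hi' : (i : ℕ) = m := by omega
        have : i = Fin.last m := Fin.ext hi'
        subst this
        simp only [Fin.val_last, Int.emod_self]
        rw [h1, ← h0]
        rfl

theorem closedSeq_injOn {m : ℕ} (hm : 0 < m) (e : E) :
    Set.InjOn (fun (c : ℤ → E) (i : Fin (m + 1)) => c (i : ℕ)) (closedSeq N m e) := by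
  rintro c ⟨h1, -, -⟩ c' ⟨h1', -, -⟩ h
  have hm' : (0 : ℤ) < m := by exact_mod_cast hm
  funext i
  rw [← apply_emod_of_periodic h1, ← apply_emod_of_periodic h1']
  have hr0 := Int.emod_nonneg i hm'.ne'
  have hr1 := Int.emod_lt_of_pos i hm'
  have := congrFun h ⟨(i % m).toNat, by omega⟩
  simpa [Int.toNat_of_nonneg hr0] using this

theorem closedSeq_finite {m : ℕ} (hm : 0 < m) (e : E) : (closedSeq N m e).Finite := by
  classical
  refine Set.Finite.of_finite_image ?_ (closedSeq_injOn N hm e)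
  rw [closedSeq_image N hm]
  exact (walkSet_finite_and_ncard N m e e).1

theorem closedSeq_ncard_eq [DecidableEq E] {m : ℕ} (hm : 0 < m) (e : E) :
    (stepOp N ^ m) (Pi.single e 1) e = ((closedSeq N m e).ncard : ℂ) := by
  rw [(walkSet_finite_and_ncard N m e e).2, ← closedSeq_image N hm,
    (closedSeq_injOn N hm e).ncard_image]

theorem closedSeq_ncard_le {D : ℕ} (hD : ∀ e, (N e).card ≤ D) {m : ℕ} (hm : 0 < m) (e : E) :
    (closedSeq N m e).ncard ≤ D ^ m := by
  rw [← (closedSeq_injOn N hm e).ncard_image, closedSeq_image N hm]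
  exact walkSet_ncard_le N hD m e e

end Relation

end

noncomputable section

/-! Periodic sequences of vertices -/

section Periodic

variable {V : Type*}

/-- `d` is a period of `c`. -/
def IsPeriod (c : ℤ → V) (d : ℕ) : Prop := ∀ i, c (i + d) = c i

/-- Bézout: the gcd is an integer combination of the two periods. -/
theorem IsPeriod.gcd {c : ℤ → V} {d e : ℕ} (hd : IsPeriod c d) (he : IsPeriod c e) :
    IsPeriod c (d.gcd e) := by
  have hd' : Function.Periodic c (d : ℤ) := hd
  have he' : Function.Periodic c (e : ℤ) := he
  intro i
  rw [Nat.gcd_eq_gcd_ab, ← add_assoc, mul_comm (d : ℤ), mul_comm (e : ℤ)]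
  have h1 := he'.int_mul (d.gcdB e) (i + d.gcdA e * d)
  have h2 := hd'.int_mul (d.gcdA e) i
  rw [Int.cast_id] at h1 h2
  rw [h1, h2]

theorem IsPeriod.of_dvd {c : ℤ → V} {d e : ℕ} (hd : IsPeriod c d) (h : d ∣ e) :
    IsPeriod c e := by
  obtain ⟨k, rfl⟩ := h
  have hd' : Function.Periodic c (d : ℤ) := hd
  intro i
  have := hd'.int_mul k i
  rw [Int.cast_id] at this
  rw [Nat.cast_mul, mul_comm]
  exact this

theorem IsPeriod.shift {c : ℤ → V} {d : ℕ} (hd : IsPeriod c d) (k : ℤ) :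
    IsPeriod (fun i => c (i + k)) d := fun i => by
  have := hd (i + k)
  rw [add_right_comm] at this
  exact this

/-- Forward steps from `i` reach every residue modulo the period, hence also `j`, although `j` may
precede `i`. A sequence that never steps out of `A` would stay there. -/
theorem exists_exit_of_isPeriod {c : ℤ → V} {l : ℕ} (hl : 0 < l) (hc : IsPeriod c l) {A : Set V}
    {i j : ℤ} (hi : c i ∈ A) (hj : c j ∉ A) : ∃ k, c k ∈ A ∧ c (k + 1) ∉ A := by
  by_contra! h
  have h1 : ∀ n : ℕ, c (i + n) ∈ A := by
    intro n
    induction n with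
    | zero => simpa using hi
    | succ n ih =>
      have := h _ ih
      push_cast
      rwa [← add_assoc]
  have h2 : ((j - i) % l) = ((j - i) % l).toNat :=
    (Int.toNat_of_nonneg (Int.emod_nonneg _ (by omega))).symm
  have h3 := apply_emod_of_periodic (c := fun t => c (t + i)) (m := l) (hc.shift i) (j - i)
  simp only [sub_add_cancel] at h3
  rw [← h3, add_comm, h2] at hj
  exact hj (h1 _)

end Periodic

/-! Closed paths as local families -/

section Paths

variable {V : Type*} (X : SimpleGraph V)

/-- The periodic sequences of the closed paths of length `l`. -/
def pathSeq (l : ℕ) : Set (ℤ → V) := {c | IsPeriod c l ∧ ∀ i, X.Adj (c i) (c (i + 1))}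

/-- The periodic sequences of the reduced closed paths of length `l`. -/
def reducedSeq (l : ℕ) : Set (ℤ → V) := {c | c ∈ pathSeq X l ∧ ∀ i, c (i - 1) ≠ c (i + 1)}

/-- The periodic sequences of the primitive reduced closed paths of length `l`. -/
def primeSeq (l : ℕ) : Set (ℤ → V) := {c | c ∈ reducedSeq X l ∧ ∀ d, IsPeriod c d → l ∣ d}

variable {X}

theorem pathSeq_shift {l : ℕ} {c : ℤ → V} (hc : c ∈ pathSeq X l) (k : ℤ) :
    (fun i => c (i + k)) ∈ pathSeq X l :=
  ⟨hc.1.shift k, fun i => by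
    have := hc.2 (i + k)
    rwa [add_right_comm] at this⟩

/-- By periodicity a meeting index can be taken in `{0, …, l - 1}`. This is the origin of the factor
`l` in the constant `l * d ^ l`. -/
theorem pathSeq_meeting_subset {l : ℕ} (hl : 0 < l) (F : Finset V) :
    {c | c ∈ pathSeq X l ∧ ∃ i, c i ∈ F} ⊆
      ⋃ p ∈ F ×ˢ Finset.range l, {c | c ∈ pathSeq X l ∧ c (p.2 : ℕ) = p.1} := by
  rintro c ⟨hc, i, hi⟩
  have h0 := Int.emod_nonneg i (b := l) (by omega)
  have h1 := Int.emod_lt_of_pos i (b := l) (by omega)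
  refine Set.mem_biUnion (x := (c i, (i % l).toNat)) ?_ ⟨hc, ?_⟩
  · simp only [Finset.coe_product, Set.mem_prod, Finset.mem_coe, Finset.mem_range]
    exact ⟨hi, by omega⟩
  · simp only
    rw [Int.toNat_of_nonneg h0, apply_emod_of_periodic hc.1]

section LocallyFinite

variable [X.LocallyFinite]

theorem pathSeq_through_finite {l : ℕ} (hl : 0 < l) (v : V) (k : ℤ) :
    {c | c ∈ pathSeq X l ∧ c k = v}.Finite := by
  refine Set.Finite.of_finite_image (f := fun c i => c (i + k)) ?_ ?_
  · refine (closedSeq_finite (fun v => X.neighborFinset v) hl v).subset ?_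
    rintro _ ⟨c, ⟨hc, hv⟩, rfl⟩
    exact ⟨(pathSeq_shift hc k).1, fun i => by simpa using (pathSeq_shift hc k).2 i,
      by simpa using hv⟩
  · intro c _ c' _ h
    funext i
    simpa using congrFun h (i - k)

theorem pathSeq_through_ncard_le {d : ℕ} (hd : ∀ v, X.degree v ≤ d) {l : ℕ} (hl : 0 < l) (v : V)
    (k : ℤ) : {c | c ∈ pathSeq X l ∧ c k = v}.ncard ≤ d ^ l := by
  refine le_trans ?_ (closedSeq_ncard_le (fun v => X.neighborFinset v) (D := d) hd hl v)
  refine Set.ncard_le_ncard_of_injOn (fun c i => c (i + k)) ?_ ?_ (closedSeq_finite _ hl v)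
  · rintro c ⟨hc, hv⟩
    exact ⟨(pathSeq_shift hc k).1, fun i => by simpa using (pathSeq_shift hc k).2 i,
      by simpa using hv⟩
  · intro c _ c' _ h
    funext i
    simpa using congrFun h (i - k)

theorem pathSeq_meeting_finite {l : ℕ} (hl : 0 < l) (F : Finset V) :
    {c | c ∈ pathSeq X l ∧ ∃ i, c i ∈ F}.Finite :=
  ((F ×ˢ Finset.range l).finite_toSet.biUnion fun p _ =>
    pathSeq_through_finite hl p.1 p.2).subset (pathSeq_meeting_subset hl F)

theorem pathSeq_meeting_ncard_le {d : ℕ} (hd : ∀ v, X.degree v ≤ d) {l : ℕ} (hl : 0 < l)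
    (F : Finset V) : {c | c ∈ pathSeq X l ∧ ∃ i, c i ∈ F}.ncard ≤ l * d ^ l * F.card := by
  calc _ ≤ _ := Set.ncard_le_ncard (pathSeq_meeting_subset hl F)
        ((F ×ˢ Finset.range l).finite_toSet.biUnion fun p _ => pathSeq_through_finite hl p.1 p.2)
    _ ≤ _ := Set.ncard_biUnion_le_sum _ _
    _ ≤ ∑ p ∈ F ×ˢ Finset.range l, d ^ l :=
        Finset.sum_le_sum fun p _ => pathSeq_through_ncard_le hd hl p.1 p.2
    _ = l * d ^ l * F.card := by
        rw [Finset.sum_const, Finset.card_product, Finset.card_range, smul_eq_mul]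
        ring

namespace GraphTower

variable {S : GraphTower X}

/-- A set of closed paths of length `l` that is invariant under the local isomorphisms. -/
theorem localFamily_of_subset {d : ℕ} (hd : ∀ v, X.degree v ≤ d) {l : ℕ} (hl : 0 < l)
    {P : Set (ℤ → V)} (hP : P ⊆ pathSeq X l)
    (inv : ∀ n m, ∀ f ∈ S.copyMaps n m, ∀ c : ℤ → ↥(S.K n : Set V),
      (fun i => f (c i)) ∈ P ↔ (fun i => (c i : V)) ∈ P) :
    S.LocalFamily (l * d ^ l) P where
  conn := by
    intro c hc A i j hi hj
    obtain ⟨k, hk, hk'⟩ := exists_exit_of_isPeriod hl (hP hc).1 hi hj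
    exact ⟨k, hk, _, hk', (hP hc).2 k⟩
  finite_meeting F := (pathSeq_meeting_finite hl F).subset fun _ hc => ⟨hP hc.1, hc.2⟩
  card_meeting F :=
    (Set.ncard_le_ncard (t := {c | c ∈ pathSeq X l ∧ ∃ i, c i ∈ F})
      (fun _ hc => ⟨hP hc.1, hc.2⟩) (pathSeq_meeting_finite hl F)).trans
      (pathSeq_meeting_ncard_le hd hl F)
  inv := inv

end GraphTower

end LocallyFinite

namespace GraphTower

variable {S : GraphTower X} {n m : ℕ} {f : ↥(S.K n : Set V) → V}

theorem isPeriod_copy_iff (hf : f ∈ S.copyMaps n m) (c : ℤ → ↥(S.K n : Set V)) (l : ℕ) :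
    IsPeriod (fun i => f (c i)) l ↔ IsPeriod (fun i => (c i : V)) l :=
  forall_congr' fun _ => (copyMaps_injective hf).eq_iff.trans Subtype.ext_iff

theorem pathSeq_copy_iff (hf : f ∈ S.copyMaps n m) (c : ℤ → ↥(S.K n : Set V)) (l : ℕ) :
    (fun i => f (c i)) ∈ pathSeq X l ↔ (fun i => (c i : V)) ∈ pathSeq X l :=
  and_congr (isPeriod_copy_iff hf c l) (forall_congr' fun _ => copyMaps_adj hf _ _)

theorem reducedSeq_copy_iff (hf : f ∈ S.copyMaps n m) (c : ℤ → ↥(S.K n : Set V)) (l : ℕ) :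
    (fun i => f (c i)) ∈ reducedSeq X l ↔ (fun i => (c i : V)) ∈ reducedSeq X l :=
  and_congr (pathSeq_copy_iff hf c l) (forall_congr' fun _ =>
    not_congr ((copyMaps_injective hf).eq_iff.trans Subtype.ext_iff))

theorem primeSeq_copy_iff (hf : f ∈ S.copyMaps n m) (c : ℤ → ↥(S.K n : Set V)) (l : ℕ) :
    (fun i => f (c i)) ∈ primeSeq X l ↔ (fun i => (c i : V)) ∈ primeSeq X l :=
  and_congr (reducedSeq_copy_iff hf c l) (forall_congr' fun _ =>
    imp_congr (isPeriod_copy_iff hf c _) Iff.rfl)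

end GraphTower

/-! Prime paths and their sequences -/

/-- With any period `d` the number `gcd d len` is a period as well; if it were a proper divisor of
`len`, the path would be a proper multiple of a shorter one. -/
theorem PrimePath.mem_primeSeq (C : PrimePath X) : C.1.vert ∈ primeSeq X C.1.len := by
  refine ⟨⟨⟨C.1.periodic, C.1.adj⟩, C.2.1⟩, fun d hd => ?_⟩
  have hg := IsPeriod.gcd hd C.1.periodic
  have hpos : 0 < d.gcd C.1.len := Nat.gcd_pos_of_pos_right _ C.1.len_pos
  obtain ⟨k, hk⟩ := Nat.gcd_dvd_right d C.1.len
  by_cases hk2 : 2 ≤ k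
  · exact absurd ⟨⟨_, C.1.vert, hpos, hg, C.1.adj⟩, k, hk2, by rw [mul_comm]; exact hk, rfl⟩ C.2.2
  · have h1 : k = 1 := by
      have := C.1.len_pos
      have : k ≠ 0 := by
        rintro rfl
        omega
      omega
    rw [h1, mul_one] at hk
    rw [hk]
    exact Nat.gcd_dvd_left _ _

/-- The prime path with a given sequence. -/
def primePathOfSeq {l : ℕ} (hl : 0 < l) {c : ℤ → V} (hc : c ∈ primeSeq X l) : PrimePath X :=
  ⟨⟨l, c, hl, hc.1.1.1, hc.1.1.2⟩, hc.1.2, by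
    rintro ⟨D, n, hn, h1, h2⟩
    simp only at h1 h2
    have := hc.2 D.len (by rw [h2]; exact D.periodic)
    have h3 := Nat.le_of_dvd D.len_pos this
    rw [h1] at h3
    have := D.len_pos
    nlinarith⟩

theorem PrimePath.ext' {C D : PrimePath X} (h1 : C.1.len = D.1.len) (h2 : C.1.vert = D.1.vert) :
    C = D := by
  obtain ⟨⟨l, c, _, _, _⟩, _⟩ := C
  obtain ⟨⟨l', c', _, _, _⟩, _⟩ := D
  simp only at h1 h2
  subst h1 h2
  rfl

/-- The reduced closed paths of length `m` are the powers of the prime ones. -/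
theorem reducedSeq_eq_biUnion {m : ℕ} (hm : 0 < m) :
    reducedSeq X m = ⋃ l ∈ m.divisors, primeSeq X l := by
  classical
  ext c
  simp only [Set.mem_iUnion, Nat.mem_divisors, exists_prop]
  constructor
  · intro hc
    -- The least positive period divides every period, by taking gcds; going around once for this
    -- period is the prime path of which `c` is a power.
    have hex : ∃ d, 0 < d ∧ IsPeriod c d := ⟨m, hm, hc.1.1⟩
    obtain ⟨hpos, hper⟩ := Nat.find_spec hex
    have hdvd : ∀ d, IsPeriod c d → Nat.find hex ∣ d := by
      intro d hd
      have h1 := hper.gcd hd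
      have h2 : 0 < (Nat.find hex).gcd d := Nat.gcd_pos_of_pos_left _ hpos
      have h3 := Nat.find_min' hex ⟨h2, h1⟩
      have h4 := Nat.le_of_dvd hpos (Nat.gcd_dvd_left (Nat.find hex) d)
      have h5 := Nat.gcd_dvd_right (Nat.find hex) d
      rwa [le_antisymm h4 h3] at h5
    exact ⟨_, ⟨hdvd m hc.1.1, hm.ne'⟩, ⟨⟨hper, hc.1.2⟩, hc.2⟩, hdvd⟩
  · rintro ⟨l, ⟨hl, -⟩, hc⟩
    exact ⟨⟨hc.1.1.1.of_dvd hl, hc.1.1.2⟩, hc.1.2⟩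

theorem primeSeq_disjoint {l l' : ℕ} (h : l ≠ l') :
    Disjoint (primeSeq X l) (primeSeq X l') := by
  rw [Set.disjoint_left]
  intro c hc hc'
  exact h (Nat.dvd_antisymm (hc.2 _ hc'.1.1.1) (hc'.2 _ hc.1.1.1))

end Paths

end

noncomputable section

/-! Counting prime cycles -/

section Cycles

variable {V : Type*} {X : SimpleGraph V}

/-- The sequences of the prime paths in a cycle. -/
def PrimeCycle.seqs (c : PrimeCycle X) : Set (ℤ → V) :=
  {s | ∃ C : PrimePath X, c = Quotient.mk _ C ∧ C.1.vert = s}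

theorem PrimeCycle.length_pos (c : PrimeCycle X) : 0 < c.length := by
  obtain ⟨C, rfl⟩ := Quotient.exists_rep c
  exact C.1.len_pos

theorem primeSeq_shift {l : ℕ} {c : ℤ → V} (hc : c ∈ primeSeq X l) (k : ℤ) :
    (fun i => c (i + k)) ∈ primeSeq X l := by
  refine ⟨⟨pathSeq_shift hc.1.1 k, fun i => ?_⟩, fun d hd => hc.2 d ?_⟩
  · have := hc.1.2 (i + k)
    rwa [add_right_comm, add_sub_right_comm] at this
  · have := hd.shift (-k)
    simpa using this

theorem PrimeCycle.seqs_mk (C : PrimePath X) :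
    PrimeCycle.seqs (Quotient.mk _ C : PrimeCycle X) =
      (fun (k : ℕ) (i : ℤ) => C.1.vert (i + k)) '' Finset.range C.1.len := by
  ext s
  constructor
  · rintro ⟨D, hD, rfl⟩
    obtain ⟨-, k, hk⟩ := Quotient.exact hD
    have h0 := Int.emod_nonneg k (b := C.1.len) (by have := C.1.len_pos; omega)
    have h1 := Int.emod_lt_of_pos k (b := C.1.len) (by have := C.1.len_pos; omega)
    refine ⟨(k % C.1.len).toNat, ?_, ?_⟩
    · simp only [Finset.coe_range, Set.mem_Iio]
      omega
    · funext i
      rw [hk]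
      simp only
      rw [Int.toNat_of_nonneg h0, ← apply_emod_of_periodic C.1.periodic (i + k % _),
        Int.add_emod_emod, apply_emod_of_periodic C.1.periodic]
  · rintro ⟨k, -, rfl⟩
    exact ⟨primePathOfSeq C.1.len_pos (primeSeq_shift C.mem_primeSeq k),
      Quotient.sound ⟨rfl, k, fun i => rfl⟩, rfl⟩

theorem PrimeCycle.seqs_finite (c : PrimeCycle X) : c.seqs.Finite := by
  obtain ⟨C, rfl⟩ := Quotient.exists_rep c
  rw [seqs_mk]
  exact (Finset.finite_toSet _).image _

/-- If the shifts by `k < k' < len` agreed, `k' - k` would be a period, which must be a multiple of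
`len`. -/
theorem PrimeCycle.seqs_ncard (c : PrimeCycle X) : c.seqs.ncard = c.length := by
  obtain ⟨C, rfl⟩ := Quotient.exists_rep c
  rw [seqs_mk, Set.InjOn.ncard_image, Set.ncard_coe_finset, Finset.card_range]
  · rfl
  · have key : ∀ k k' : ℕ, k < k' → k' < C.1.len →
        (fun i : ℤ => C.1.vert (i + k)) ≠ fun i : ℤ => C.1.vert (i + k') := by
      intro k k' h1 h2 h
      have hp : IsPeriod C.1.vert (k' - k) := by
        intro i
        have := congrFun h (i - k)
        simp only [sub_add_cancel] at this
        rw [this, Nat.cast_sub h1.le]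
        congr 1
        ring
      have := Nat.le_of_dvd (by omega) (C.mem_primeSeq.2 _ hp)
      omega
    intro k hk k' hk' h
    simp only [Finset.coe_range, Set.mem_Iio] at hk hk'
    rcases lt_trichotomy k k' with hlt | rfl | hlt
    · exact absurd h (key _ _ hlt hk')
    · rfl
    · exact absurd h.symm (key _ _ hlt hk)

theorem PrimeCycle.seqs_disjoint {c d : PrimeCycle X} (hl : c.length = d.length) (h : c ≠ d) :
    Disjoint c.seqs d.seqs := by
  rw [Set.disjoint_left]
  rintro _ ⟨C, rfl, rfl⟩ ⟨D, rfl, hD⟩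
  exact h (congrArg _ (PrimePath.ext' hl hD.symm))

namespace GraphTower

/-- The class of a prime cycle. -/
def cycleClass (S : GraphTower X) (c : PrimeCycle X) : S.PrimeClass := Quot.mk S.Maps c

/-- The sequences of the prime paths of length `l` whose class is in `T`. -/
def classSeq (S : GraphTower X) (T : Set S.PrimeClass) (l : ℕ) : Set (ℤ → V) :=
  {s | ∃ C : PrimePath X, C.1.len = l ∧ C.1.vert = s ∧
    S.cycleClass (Quotient.mk _ C) ∈ T}

/-- The prime cycles of length `l` in `K n` whose class is in `T`. -/
def classCycles (S : GraphTower X) (T : Set S.PrimeClass) (l n : ℕ) : Set (PrimeCycle X) :=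
  {c | c.length = l ∧ S.cycleClass c ∈ T ∧ c.support ⊆ (S.K n : Set V)}

variable {S : GraphTower X} {T : Set S.PrimeClass} {l : ℕ}

theorem classSeq_subset (S : GraphTower X) (T : Set S.PrimeClass) (l : ℕ) :
    S.classSeq T l ⊆ primeSeq X l := by
  rintro _ ⟨C, rfl, rfl, -⟩
  exact C.mem_primeSeq

theorem classSeq_univ (S : GraphTower X) (hl : 0 < l) :
    S.classSeq Set.univ l = primeSeq X l :=
  (S.classSeq_subset _ l).antisymm fun _ hc => ⟨primePathOfSeq hl hc, rfl, rfl, trivial⟩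

theorem cycleClass_eq_of_copyMaps {n m : ℕ} {f} (hf : f ∈ S.copyMaps n m) {C D : PrimePath X}
    (hlen : D.1.len = C.1.len) (h : ∀ i, C.1.vert i ∈ (S.K n : Set V))
    (hv : ∀ i, D.1.vert i = f ⟨C.1.vert i, h i⟩) :
    S.cycleClass (Quotient.mk _ C) = S.cycleClass (Quotient.mk _ D) := by
  obtain ⟨k, rfl, γ, hγ, hfγ⟩ := hf
  exact Quot.sound ⟨C, D, rfl, rfl, n, k, γ, hγ, h, hlen, fun i => by rw [hv, hfγ]⟩

/-- A prime path and its copy are `𝒢`-equivalent by definition, so membership of their class in `T`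
is the same condition. This makes the paths of any set of classes a local family. -/
theorem classSeq_copy_iff (hl : 0 < l) {n m : ℕ} {f} (hf : f ∈ S.copyMaps n m)
    (c : ℤ → ↥(S.K n : Set V)) :
    (fun i => f (c i)) ∈ S.classSeq T l ↔ (fun i => (c i : V)) ∈ S.classSeq T l := by
  constructor
  · rintro ⟨D, rfl, hD, hT⟩
    have hc : (fun i => (c i : V)) ∈ primeSeq X D.1.len := by
      rw [← primeSeq_copy_iff hf, ← hD]
      exact D.mem_primeSeq
    refine ⟨primePathOfSeq hl hc, rfl, rfl, ?_⟩
    rwa [cycleClass_eq_of_copyMaps hf (C := primePathOfSeq hl hc) (D := D) rfl (fun i => (c i).2)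
      (fun i => congrFun hD i)]
  · rintro ⟨C, rfl, hC, hT⟩
    have hc : (fun i => f (c i)) ∈ primeSeq X C.1.len := by
      rw [primeSeq_copy_iff hf, ← hC]
      exact C.mem_primeSeq
    refine ⟨primePathOfSeq hl hc, rfl, rfl, ?_⟩
    have hmem : ∀ i, C.1.vert i ∈ (S.K n : Set V) := fun i => by
      rw [hC]
      exact (c i).2
    rwa [← cycleClass_eq_of_copyMaps hf (C := C) (D := primePathOfSeq hl hc) rfl hmem
      (fun i => by
        have h2 : (⟨C.1.vert i, hmem i⟩ : (S.K n : Set V)) = c i :=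
          Subtype.ext (congrFun hC i)
        rw [h2]
        rfl)]

theorem inside_classSeq (S : GraphTower X) (T : Set S.PrimeClass) (l n : ℕ) :
    S.inside (S.classSeq T l) n = ⋃ c ∈ S.classCycles T l n, c.seqs := by
  ext s
  simp only [Set.mem_iUnion, exists_prop]
  constructor
  · rintro ⟨⟨C, rfl, rfl, hT⟩, h⟩
    refine ⟨_, ⟨rfl, hT, ?_⟩, C, rfl, rfl⟩
    rintro _ ⟨i, rfl⟩
    exact h i
  · rintro ⟨_, ⟨rfl, hT, hs⟩, C, rfl, rfl⟩
    exact ⟨⟨C, rfl, rfl, hT⟩, fun i => hs ⟨i, rfl⟩⟩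

variable [X.LocallyFinite]

theorem localFamily_classSeq {d : ℕ} (hd : ∀ v, X.degree v ≤ d) (hl : 0 < l)
    (T : Set S.PrimeClass) : S.LocalFamily (l * d ^ l) (S.classSeq T l) :=
  localFamily_of_subset hd hl ((S.classSeq_subset T l).trans fun _ h => h.1.1)
    fun _ _ _ hf c => classSeq_copy_iff hl hf c

theorem classCycles_finite {d : ℕ} (hd : ∀ v, X.degree v ≤ d) (hl : 0 < l)
    (T : Set S.PrimeClass) (n : ℕ) : (S.classCycles T l n).Finite := by
  have hfin := (localFamily_classSeq hd hl T).inside_finite n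
  rw [inside_classSeq] at hfin
  refine Set.Finite.of_finite_image (f := PrimeCycle.seqs)
    (hfin.finite_subsets.subset ?_) ?_
  · rintro _ ⟨c, hc, rfl⟩
    exact Set.subset_biUnion_of_mem (u := fun c : PrimeCycle X => c.seqs) hc
  · intro c hc c' hc' h
    by_contra hne
    have h1 := PrimeCycle.seqs_disjoint (hc.1.trans hc'.1.symm) hne
    rw [h, disjoint_self] at h1
    have h2 := c'.seqs_ncard
    rw [h1] at h2
    have := c'.length_pos
    simp at h2
    omega

/-- Each cycle of length `l` has exactly `l` origins, and paths of different cycles differ. -/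
theorem inside_classSeq_ncard {d : ℕ} (hd : ∀ v, X.degree v ≤ d) (hl : 0 < l)
    (T : Set S.PrimeClass) (n : ℕ) :
    (S.inside (S.classSeq T l) n).ncard = l * (S.classCycles T l n).ncard := by
  have hfin := classCycles_finite hd hl T n
  have h1 : S.inside (S.classSeq T l) n = ⋃ c ∈ hfin.toFinset, c.seqs := by
    rw [inside_classSeq]
    simp
  rw [h1, Set.ncard_biUnion_eq_sum, Set.ncard_eq_toFinset_card _ hfin, mul_comm, ← smul_eq_mul,
    ← Finset.sum_const]
  · refine Finset.sum_congr rfl fun c hc => ?_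
    rw [PrimeCycle.seqs_ncard]
    exact (hfin.mem_toFinset.1 hc).1
  · exact fun c _ => c.seqs_finite
  · intro c hc c' hc' hne
    exact PrimeCycle.seqs_disjoint
      ((hfin.mem_toFinset.1 hc).1.trans (hfin.mem_toFinset.1 hc').1.symm) hne

end GraphTower

end Cycles

end

noncomputable section

/-! Average multiplicities -/

namespace GraphTower

variable {V : Type*} {X : SimpleGraph V} {S : GraphTower X}

theorem classLength_pos (ξ : S.PrimeClass) : 0 < S.classLength ξ := by
  obtain ⟨c, rfl⟩ := Quot.exists_rep ξ
  exact c.length_pos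

theorem multiplicity_eq (ξ : S.PrimeClass) (n : ℕ) :
    S.multiplicity ξ n = (S.classCycles {ξ} (S.classLength ξ) n).ncard := by
  unfold multiplicity classCycles
  congr 1
  ext c
  constructor
  · rintro ⟨rfl, h⟩
    exact ⟨rfl, rfl, h⟩
  · rintro ⟨-, h, h'⟩
    exact ⟨h, h'⟩

/-- The average number of prime cycles of length `l` per vertex. -/
def primeDensity (S : GraphTower X) (l : ℕ) : ℝ :=
  limUnder atTop fun n => ((S.classCycles Set.univ l n).ncard : ℝ) / (S.K n).card

theorem classCycles_ncard_eq_sum [X.LocallyFinite] {d l : ℕ} (hd : ∀ v, X.degree v ≤ d) (hl : 0 < l)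
    (t : Finset S.PrimeClass) (n : ℕ) :
    (S.classCycles (t : Set S.PrimeClass) l n).ncard =
      ∑ ξ ∈ t, (S.classCycles {ξ} l n).ncard := by
  rw [← Set.ncard_biUnion_eq_sum]
  · congr 1
    ext c
    simp only [classCycles, Set.mem_iUnion, Set.mem_ofPred_eq, exists_prop, Set.mem_singleton_iff,
      Finset.mem_coe]
    constructor
    · rintro ⟨h1, h2, h3⟩
      exact ⟨_, h2, h1, rfl, h3⟩
    · rintro ⟨_, h2, h1, rfl, h3⟩
      exact ⟨h1, h2, h3⟩
  · exact fun ξ _ => classCycles_finite hd hl {ξ} n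
  · intro ξ _ ξ' _ hne
    rw [Set.disjoint_left]
    rintro c ⟨-, h1, -⟩ ⟨-, h2, -⟩
    exact hne (h1.symm.trans h2)

variable [Infinite V] [X.LocallyFinite] {d l : ℕ}

/-- The factor `l` of the local family constant cancels against the number of origins. The point is
that the error bound is the same for all sets `T` of classes. -/
theorem classCycles_exists_limit (hS : S.IsSelfSimilar) (hd : ∀ v, X.degree v ≤ d) (hl : 0 < l)
    (T : Set S.PrimeClass) :
    ∃ L : ℝ, Tendsto (fun n => ((S.classCycles T l n).ncard : ℝ) / (S.K n).card) atTop (𝓝 L) ∧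
      ∀ n, S.frontierRatio n ≤ 1 / 2 →
        |L - (S.classCycles T l n).ncard / (S.K n).card| ≤ 4 * d ^ l * S.frontierRatio n := by
  obtain ⟨L, hL, hL'⟩ := (localFamily_classSeq hd hl T).exists_limit hS
  have hl' : (0 : ℝ) < l := by exact_mod_cast hl
  have e : ∀ n, ((S.classCycles T l n).ncard : ℝ) / (S.K n).card =
      ((S.inside (S.classSeq T l) n).ncard : ℝ) / (S.K n).card / l := fun n => by
    rw [inside_classSeq_ncard hd hl]
    push_cast
    field_simp
  simp only [e]
  refine ⟨L / l, hL.div_const _, fun n hn => ?_⟩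
  rw [← sub_div, abs_div, abs_of_pos hl', div_le_iff₀ hl']
  refine (hL' n hn).trans (le_of_eq ?_)
  push_cast
  ring

theorem tendsto_multiplicity (hS : S.IsSelfSimilar) (hd : ∀ v, X.degree v ≤ d)
    (ξ : S.PrimeClass) :
    Tendsto (fun n => (S.multiplicity ξ n : ℝ) / (S.K n).card) atTop
      (𝓝 (S.avgMultiplicity ξ)) := by
  obtain ⟨L, hL, -⟩ := classCycles_exists_limit hS hd (classLength_pos ξ) {ξ}
  simp only [← multiplicity_eq] at hL
  rw [avgMultiplicity, hL.limUnder_eq]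
  exact hL

theorem avgMultiplicity_nonneg (hS : S.IsSelfSimilar) (hd : ∀ v, X.degree v ≤ d)
    (ξ : S.PrimeClass) : 0 ≤ S.avgMultiplicity ξ :=
  ge_of_tendsto' (tendsto_multiplicity hS hd ξ) fun n => by positivity

theorem tendsto_primeDensity (hS : S.IsSelfSimilar) (hd : ∀ v, X.degree v ≤ d) (hl : 0 < l) :
    Tendsto (fun n => ((S.classCycles Set.univ l n).ncard : ℝ) / (S.K n).card) atTop
      (𝓝 (S.primeDensity l)) := by
  obtain ⟨L, hL, -⟩ := classCycles_exists_limit hS hd hl Set.univ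
  rw [primeDensity, hL.limUnder_eq]
  exact hL

/-- The average multiplicities of the classes of length `l` add up to the density of all prime
cycles of length `l`. -/
theorem hasSum_avgMultiplicity (hS : S.IsSelfSimilar) (hd : ∀ v, X.degree v ≤ d) (hl : 0 < l) :
    HasSum (fun ξ : {ξ : S.PrimeClass // S.classLength ξ = l} => S.avgMultiplicity ξ)
      (S.primeDensity l) := by
  classical
  have h0 : Tendsto S.frontierRatio atTop (𝓝 0) := hS.invariant_amenable
  have hev : ∀ᶠ n in atTop, S.frontierRatio n ≤ 1 / 2 :=
    h0.eventually (ge_mem_nhds (by norm_num))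
  have h1 : Tendsto (fun n => 4 * (d : ℝ) ^ l * S.frontierRatio n) atTop (𝓝 0) := by
    simpa using h0.const_mul (4 * (d : ℝ) ^ l)
  rw [HasSum, SummationFilter.unconditional_filter, Metric.tendsto_nhds]
  intro ε hε
  obtain ⟨n, hn, hn'⟩ := (hev.and (h1.eventually (gt_mem_nhds (half_pos hε)))).exists
  have hfin := classCycles_finite (S := S) hd hl Set.univ n
  -- The finitely many classes that occur in this `K n`. Any finite set of classes containing `s`
  -- has the same cycles in `K n` as all classes together, so both limits lie within `ε / 2` of one
  -- number.
  let s : Finset {ξ : S.PrimeClass // S.classLength ξ = l} :=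
    hfin.toFinset.attach.image fun c =>
      ⟨S.cycleClass c.1, (hfin.mem_toFinset.1 c.2).1⟩
  filter_upwards [eventually_ge_atTop s] with t ht
  let T : Finset S.PrimeClass := t.map (Function.Embedding.subtype _)
  have hT : S.classCycles (T : Set S.PrimeClass) l n = S.classCycles Set.univ l n := by
    ext c
    refine ⟨fun h => ⟨h.1, trivial, h.2.2⟩, fun h => ⟨h.1, ?_, h.2.2⟩⟩
    have hc : (⟨S.cycleClass c, h.1⟩ : {ξ : S.PrimeClass // S.classLength ξ = l}) ∈ s :=
      Finset.mem_image.2 ⟨⟨c, hfin.mem_toFinset.2 h⟩, Finset.mem_attach _ _, rfl⟩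
    simpa [T] using ⟨h.1, ht hc⟩
  obtain ⟨L, hL, hL'⟩ := classCycles_exists_limit hS hd hl (T : Set S.PrimeClass)
  have hLsum : L = ∑ ξ ∈ t, S.avgMultiplicity ξ := by
    refine tendsto_nhds_unique hL ?_
    have : ∀ m, ((S.classCycles (T : Set S.PrimeClass) l m).ncard : ℝ) / (S.K m).card =
        ∑ ξ ∈ t, (S.multiplicity ξ m : ℝ) / (S.K m).card := by
      intro m
      rw [classCycles_ncard_eq_sum hd hl, Finset.sum_map, Nat.cast_sum, Finset.sum_div]
      refine Finset.sum_congr rfl fun ξ _ => ?_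
      rw [multiplicity_eq, ξ.2]
      rfl
    simp only [this]
    exact tendsto_finsetSum _ fun ξ _ => tendsto_multiplicity hS hd ξ.1
  obtain ⟨M, hM, hM'⟩ := classCycles_exists_limit hS hd hl (Set.univ : Set S.PrimeClass)
  have hMp : M = S.primeDensity l := tendsto_nhds_unique hM (tendsto_primeDensity hS hd hl)
  have a1 := hL' n hn
  have a2 := hM' n hn
  rw [hT] at a1
  rw [← hLsum, ← hMp, Real.dist_eq]
  rw [abs_le] at a1 a2
  rw [abs_lt]
  constructor <;> linarith

theorem primeDensity_nonneg (hS : S.IsSelfSimilar) (hd : ∀ v, X.degree v ≤ d) (hl : 0 < l) :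
    0 ≤ S.primeDensity l :=
  ge_of_tendsto' (tendsto_primeDensity hS hd hl) fun n => by positivity

/-- The average number of reduced closed paths of length `m`. -/
theorem tendsto_reducedSeq (hS : S.IsSelfSimilar) (hd : ∀ v, X.degree v ≤ d) {m : ℕ}
    (hm : 0 < m) :
    Tendsto (fun n => ((S.inside (reducedSeq X m) n).ncard : ℝ) / (S.K n).card) atTop
      (𝓝 (∑ l ∈ m.divisors, l * S.primeDensity l)) := by
  have e : ∀ n, ((S.inside (reducedSeq X m) n).ncard : ℝ) / (S.K n).card =
      ∑ l ∈ m.divisors, l * (((S.classCycles Set.univ l n).ncard : ℝ) / (S.K n).card) := by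
    intro n
    have h1 : S.inside (reducedSeq X m) n =
        ⋃ l ∈ m.divisors, S.inside (S.classSeq Set.univ l) n := by
      ext c
      simp only [inside, Set.mem_ofPred_eq, Set.mem_iUnion, exists_prop]
      rw [reducedSeq_eq_biUnion hm]
      simp only [Set.mem_iUnion, exists_prop]
      constructor
      · rintro ⟨⟨l, hl, hc⟩, h⟩
        rw [← S.classSeq_univ (Nat.pos_of_mem_divisors hl)] at hc
        exact ⟨l, hl, hc, h⟩
      · rintro ⟨l, hl, hc, h⟩
        exact ⟨⟨l, hl, S.classSeq_subset _ _ hc⟩, h⟩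
    rw [h1, Set.ncard_biUnion_eq_sum, Nat.cast_sum, Finset.sum_div]
    · refine Finset.sum_congr rfl fun l hl => ?_
      rw [inside_classSeq_ncard hd (Nat.pos_of_mem_divisors hl)]
      push_cast
      ring
    · intro l hl
      exact (localFamily_classSeq hd (Nat.pos_of_mem_divisors hl) _).inside_finite n
    · intro l _ l' _ hne
      refine (primeSeq_disjoint (X := X) hne).mono ?_ ?_
      · exact fun c hc => S.classSeq_subset _ _ hc.1
      · exact fun c hc => S.classSeq_subset _ _ hc.1
  simp only [e]
  exact tendsto_finsetSum _ fun l hl =>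
    (tendsto_primeDensity hS hd (Nat.pos_of_mem_divisors hl)).const_mul _

end GraphTower

end

noncomputable section

namespace GraphTower

variable {V : Type*} {X : SimpleGraph V} {S : GraphTower X}

/-! The degrees -/

/-- A vertex of maximal degree of a self-similar graph has infinitely many copies, so the maximal
degree of an essentially regular one is the generic degree. -/
theorem degree_le_of_essentiallyRegular [Infinite V] [X.LocallyFinite] (hS : S.IsSelfSimilar)
    (hd : ∃ d : ℕ, ∀ v, X.degree v ≤ d) {k : ℕ} (hreg : {v | X.degree v ≠ k}.Finite) (w : V) :
    X.degree w ≤ k := by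
  classical
  by_contra! hw
  obtain ⟨d, hd⟩ := hd
  obtain ⟨v, hv⟩ : ∃ v, ∀ w, X.degree w ≤ X.degree v := by
    have hne : (Set.range fun v => X.degree v).Nonempty := ⟨_, w, rfl⟩
    have hb : BddAbove (Set.range fun v => X.degree v) := ⟨d, by rintro _ ⟨v, rfl⟩; exact hd v⟩
    obtain ⟨v, hv⟩ := Nat.sSup_mem hne hb
    exact ⟨v, fun w => (le_csSup hb ⟨w, rfl⟩).trans hv.symm.le⟩
  obtain ⟨n, hn⟩ := hS.exists_subset (insert v (X.neighborFinset v))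
  have hvn : v ∈ (S.K n : Set V) := hn (Finset.mem_insert_self _ _)
  have hNn : ∀ x ∈ X.neighborFinset v, x ∈ (S.K n : Set V) := fun x hx =>
    hn (Finset.mem_insert_of_mem hx)
  -- `K n` contains `v` and its neighbours. The image of `v` again has maximal degree, so all its
  -- neighbours are images of neighbours of `v`, and it is not on the frontier of the copy.
  have key : ∀ m, ∀ f ∈ S.copyMaps n m, X.degree v ≤ X.degree (f ⟨v, hvn⟩) ∧
      f ⟨v, hvn⟩ ∉ vertexFrontier X (Set.range f) := by
    intro m f hf
    let T : Finset V := (X.neighborFinset v).attach.image fun x => f ⟨x.1, hNn x.1 x.2⟩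
    have hT : T ⊆ X.neighborFinset (f ⟨v, hvn⟩) := by
      intro y hy
      obtain ⟨x, -, rfl⟩ := Finset.mem_image.1 hy
      rw [SimpleGraph.mem_neighborFinset, copyMaps_adj hf]
      exact (SimpleGraph.mem_neighborFinset _ _ _).1 x.2
    have hTc : T.card = X.degree v := by
      rw [Finset.card_image_of_injective, Finset.card_attach, SimpleGraph.card_neighborFinset_eq_degree]
      intro x y hxy
      have := copyMaps_injective hf hxy
      exact Subtype.ext (congrArg (fun z : ↥(S.K n : Set V) => (z : V)) this)
    have hle : X.degree v ≤ X.degree (f ⟨v, hvn⟩) := by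
      rw [← hTc, ← SimpleGraph.card_neighborFinset_eq_degree]
      exact Finset.card_le_card hT
    refine ⟨hle, ?_⟩
    rintro ⟨-, z, hz, hadj⟩
    have heq : T = X.neighborFinset (f ⟨v, hvn⟩) := by
      refine Finset.eq_of_subset_of_card_le hT ?_
      rw [hTc, SimpleGraph.card_neighborFinset_eq_degree]
      exact hv _
    have hz' : z ∈ T := by
      rw [heq]
      simpa using hadj
    obtain ⟨x, -, rfl⟩ := Finset.mem_image.1 hz'
    exact hz ⟨_, rfl⟩
  have hnot : v ∉ S.invariantFrontier n := by
    rintro ⟨h, j, γ, hγ, hfr⟩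
    exact (key _ _ (mem_copyMaps_of_copies hγ)).2 hfr
  -- As `v` is outside the invariant frontier, different copies send it to different vertices, all
  -- of degree greater than `k`. The number of copies is then bounded, which would bound the size of
  -- `K m`.
  have hg : ∀ m, (S.copyMaps n m).ncard ≤ {v | X.degree v ≠ k}.ncard := by
    intro m
    refine Set.ncard_le_ncard_of_injOn (fun f => f ⟨v, hvn⟩) ?_ ?_ hreg
    · intro f hf
      have h1 := (key m f hf).1
      have h2 := hv w
      simp only [Set.mem_ofPred_eq]
      omega
    · intro f hf f' hf' h
      by_contra hne
      exact hnot (copyMaps_overlap hS hf hf' hne h)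
  have hK : ∀ m, n ≤ m → (S.K m).card ≤ {v | X.degree v ≠ k}.ncard * (S.K n).card := by
    intro m hm
    have hfin := copyMaps_finite hS hm
    have hsub : S.K m ⊆ hfin.toFinset.biUnion fun f => Finset.univ.image f := by
      intro x hx
      obtain ⟨f, hf, y, rfl⟩ := copyMaps_cover hS hm hx
      exact Finset.mem_biUnion.2 ⟨f, hfin.mem_toFinset.2 hf, Finset.mem_image_of_mem _ (Finset.mem_univ _)⟩
    calc (S.K m).card ≤ _ := Finset.card_le_card hsub
      _ ≤ ∑ f ∈ hfin.toFinset, (Finset.univ.image f).card := Finset.card_biUnion_le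
      _ ≤ ∑ f ∈ hfin.toFinset, (S.K n).card := by
          refine Finset.sum_le_sum fun f _ => Finset.card_image_le.trans ?_
          simp
      _ = (S.copyMaps n m).ncard * (S.K n).card := by
          rw [Finset.sum_const, smul_eq_mul, Set.ncard_eq_toFinset_card _ hfin]
      _ ≤ _ := Nat.mul_le_mul_right _ (hg m)
  obtain ⟨m, hm, hm'⟩ := ((hS.tendsto_card.eventually_gt_atTop
    ({v | X.degree v ≠ k}.ncard * (S.K n).card)).and (eventually_ge_atTop n)).exists
  exact absurd (hK m hm') (not_le.2 hm)

/-! The numbers of copies -/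

theorem _root_.PrimeCycle.exists_shift_of_mem_seqs {c : PrimeCycle X} {t t' : ℤ → V}
    (h : t ∈ c.seqs) (h' : t' ∈ c.seqs) : ∃ k : ℤ, ∀ i, t' i = t (i + k) := by
  obtain ⟨C, rfl, rfl⟩ := h
  obtain ⟨D, hD, rfl⟩ := h'
  exact (Quotient.exact hD).2

theorem _root_.PrimeCycle.shift_mem_seqs {c : PrimeCycle X} {t : ℤ → V} (h : t ∈ c.seqs)
    (k : ℤ) : (fun i => t (i + k)) ∈ c.seqs := by
  obtain ⟨C, rfl, rfl⟩ := h
  exact ⟨primePathOfSeq C.1.len_pos (primeSeq_shift C.mem_primeSeq k),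
    Quotient.sound ⟨rfl, k, fun _ => rfl⟩, rfl⟩

theorem _root_.PrimeCycle.seqs_subset (c : PrimeCycle X) : c.seqs ⊆ primeSeq X c.length := by
  rintro _ ⟨C, rfl, rfl⟩
  exact C.mem_primeSeq

theorem _root_.PrimeCycle.support_eq {c : PrimeCycle X} {t : ℤ → V} (h : t ∈ c.seqs) :
    c.support = Set.range t := by
  obtain ⟨C, rfl, rfl⟩ := h
  rfl

theorem _root_.PrimeCycle.ext_of_mem_seqs {c d : PrimeCycle X} {t : ℤ → V}
    (hl : c.length = d.length) (h : t ∈ c.seqs) (h' : t ∈ d.seqs) : c = d := by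
  by_contra hne
  exact Set.disjoint_left.1 (PrimeCycle.seqs_disjoint hl hne) h h'

theorem Maps.length_eq {c d : PrimeCycle X} (h : S.Maps c d) : d.length = c.length := by
  obtain ⟨C, D, rfl, rfl, n, k, γ, -, -, h, -⟩ := h
  exact h

theorem Maps.exists_copyMap {c d : PrimeCycle X} (h : S.Maps c d) :
    ∃ n m, ∃ f ∈ S.copyMaps n m, ∃ e : ℤ → ↥(S.K n : Set V),
      (fun i => (e i : V)) ∈ c.seqs ∧ (fun i => f (e i)) ∈ d.seqs := by
  obtain ⟨C, D, rfl, rfl, n, k, γ, hγ, hm, -, hv⟩ := h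
  exact ⟨n, n + k, _, mem_copyMaps_of_copies hγ, fun i => ⟨C.1.vert i, hm i⟩, ⟨C, rfl, rfl⟩,
    D, rfl, funext hv⟩

/-- The relation provides some choice of origins; shifting both paths by the same amount gives any
prescribed one. -/
theorem Maps.of_mem_left {c d : PrimeCycle X} (h : S.Maps c d) {t : ℤ → V} (ht : t ∈ c.seqs) :
    ∃ n m, ∃ f ∈ S.copyMaps n m, ∃ e : ℤ → ↥(S.K n : Set V),
      (∀ i, t i = e i) ∧ (fun i => f (e i)) ∈ d.seqs := by
  obtain ⟨n, m, f, hf, e, hc, hd⟩ := h.exists_copyMap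
  obtain ⟨k, hk⟩ := PrimeCycle.exists_shift_of_mem_seqs hc ht
  exact ⟨n, m, f, hf, fun i => e (i + k), hk, PrimeCycle.shift_mem_seqs hd k⟩

theorem Maps.of_mem_right {c d : PrimeCycle X} (h : S.Maps c d) {t : ℤ → V} (ht : t ∈ d.seqs) :
    ∃ n m, ∃ f ∈ S.copyMaps n m, ∃ e : ℤ → ↥(S.K n : Set V),
      (∀ i, t i = f (e i)) ∧ (fun i => (e i : V)) ∈ c.seqs := by
  obtain ⟨n, m, f, hf, e, hc, hd⟩ := h.exists_copyMap
  obtain ⟨k, hk⟩ := PrimeCycle.exists_shift_of_mem_seqs hd ht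
  exact ⟨n, m, f, hf, fun i => e (i + k), hk, PrimeCycle.shift_mem_seqs hc k⟩

theorem copies_ncard (n k : ℕ) : (S.copies n k).ncard = (S.copyMaps n (n + k)).ncard := by
  have h : S.copyMaps n (n + k) = (fun γ v => ((γ v : (S.K (n + k) : Set V)) : V)) ''
      S.copies n k := by
    ext f
    constructor
    · rintro ⟨j, hj, γ, hγ, h⟩
      obtain rfl : j = k := by omega
      exact ⟨γ, hγ, (funext h).symm⟩
    · rintro ⟨γ, hγ, rfl⟩
      exact mem_copyMaps_of_copies hγ
  rw [h, Set.ncard_image_of_injective]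
  intro γ γ' h
  exact DFunLike.ext _ _ fun v => Subtype.ext (congrFun h v)

theorem val_mem_copyMaps (hid : ∀ n, ∃ γ ∈ S.G n, ∀ v, (γ v : V) = v)
    {n m : ℕ} (hnm : n ≤ m) :
    (Subtype.val : ↥(S.K n : Set V) → V) ∈ S.copyMaps n m := by
  induction m, hnm using Nat.le_induction with
  | base => rw [copyMaps_self]; rfl
  | succ m hnm ih =>
    obtain ⟨γ, hγ, h⟩ := hid m
    exact (copyMaps_succ hnm _).2 ⟨_, ih, γ, hγ, fun v => (h ⟨v, _⟩).symm⟩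

theorem copyMaps_mono (hid : ∀ n, ∃ γ ∈ S.G n, ∀ v, (γ v : V) = v)
    {n m m' : ℕ} (h : m ≤ m') : S.copyMaps n m ⊆ S.copyMaps n m' :=
  fun _ hf => copyMaps_comp hf (val_mem_copyMaps hid h)

theorem copyMaps_unique
    (hun : ∀ p k, ∀ γ ∈ S.copies p k, ∀ γ' ∈ S.copies p k, γ ≠ γ' →
      ∀ c : PrimeCycle X, ¬ c.support ⊆ S.image γ ∩ S.image γ')
    {n m : ℕ} {f f'} (hf : f ∈ S.copyMaps n m) (hf' : f' ∈ S.copyMaps n m)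
    {c : PrimeCycle X} {t : ℤ → V} (ht : t ∈ c.seqs) (h : ∀ i, t i ∈ Set.range f)
    (h' : ∀ i, t i ∈ Set.range f') : f = f' := by
  obtain ⟨k, rfl, γ, hγ, e⟩ := hf
  obtain ⟨k', hk', γ', hγ', e'⟩ := hf'
  obtain rfl : k' = k := by omega
  have hff : γ = γ' := by
    by_contra hne
    refine hun _ _ γ hγ γ' hγ' hne c ?_
    rw [PrimeCycle.support_eq ht]
    rintro _ ⟨i, rfl⟩
    obtain ⟨v, hv⟩ := h i
    obtain ⟨v', hv'⟩ := h' i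
    exact ⟨⟨v, (e v).symm.trans hv⟩, ⟨v', (e' v').symm.trans hv'⟩⟩
  subst hff
  funext v
  rw [e, e']

/-- The copies of a cycle `b` of minimal size that lie in a copy of `K n` are the copies in
that copy. -/
theorem exists_copyMap_of_copyMap_eq {s m₀ : ℕ} {f₀} (hf₀ : f₀ ∈ S.copyMaps s m₀)
    {b : ℤ → ↥(S.K s : Set V)}
    (hmin : ∀ p m, ∀ f ∈ S.copyMaps p m, (∀ i, f₀ (b i) ∈ Set.range f) → s ≤ p)
    (hid : ∀ n, ∃ γ ∈ S.G n, ∀ v, (γ v : V) = v)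
    (hun : ∀ p k, ∀ γ ∈ S.copies p k, ∀ γ' ∈ S.copies p k, γ ≠ γ' →
      ∀ c : PrimeCycle X, ¬ c.support ⊆ S.image γ ∩ S.image γ')
    {m : ℕ} {f} (hf : f ∈ S.copyMaps s m) {n M : ℕ} {g} (hg : g ∈ S.copyMaps n M)
    {e : ℤ → ↥(S.K n : Set V)} (heq : ∀ i, f (b i) = g (e i)) {d : PrimeCycle X}
    (hd : (fun i => f (b i)) ∈ d.seqs) :
    ∃ f₁ ∈ S.copyMaps s n, ∀ i, (e i : V) = f₁ (b i) := by
  -- Inclusions are local isomorphisms, so both copies may be regarded as copies in the larger of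
  -- the two targets.
  replace hf := copyMaps_mono hid (le_max_left m M) hf
  replace hg := copyMaps_mono hid (le_max_right m M) hg
  rcases le_or_gt s n with h | h
  -- For `s ≤ n` the map `f` factors through a copy of `K n` that contains the cycle; by uniqueness
  -- this copy is `g`.
  · obtain ⟨β, hβ, γ, hγ, hfγ⟩ := copyMaps_decomp h (copyMaps_le hg) hf
    have : γ = g := copyMaps_unique hun hγ hg hd (fun i => ⟨_, (hfγ (b i)).symm⟩)
      (fun i => ⟨_, (heq i).symm⟩)
    subst this
    refine ⟨β, hβ, fun i => ?_⟩
    have h1 := (heq i).symm.trans (hfγ (b i))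
    exact congrArg Subtype.val (copyMaps_injective hγ h1)
  -- For `n < s` the map `g` factors through a copy of `K s`, which must be `f`. Then `b` lies in a
  -- copy of `K n`, against the minimality of `s`.
  · obtain ⟨β, hβ, γ, hγ, hgγ⟩ := copyMaps_decomp h.le (copyMaps_le hf) hg
    have : γ = f := copyMaps_unique hun hγ hf hd
      (fun i => ⟨_, ((heq i).trans (hgγ (e i))).symm⟩) (fun i => ⟨_, rfl⟩)
    subst this
    have h1 : ∀ i, b i = ⟨β (e i), copyMaps_mem hβ _⟩ := fun i =>
      copyMaps_injective hγ ((heq i).trans (hgγ (e i)))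
    exact absurd (hmin n m₀ _ (copyMaps_comp hβ hf₀) fun i => ⟨e i, by rw [h1 i]⟩) (not_le.2 h)

/-- The class of a prime cycle consists of the copies of its representative of minimal size. -/
theorem tendsto_copies_ncard [Infinite V] [X.LocallyFinite] (hS : S.IsSelfSimilar)
    (hd : ∃ d : ℕ, ∀ v, X.degree v ≤ d)
    (hid : ∀ n, ∃ γ ∈ S.G n, ∀ v, (γ v : V) = v)
    (hun : ∀ p k, ∀ γ ∈ S.copies p k, ∀ γ' ∈ S.copies p k, γ ≠ γ' →
      ∀ c : PrimeCycle X, ¬ c.support ⊆ S.image γ ∩ S.image γ') (c : PrimeCycle X) :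
    Tendsto (fun k => ((S.copies (S.size c) k).ncard : ℝ) / ((S.K (S.size c + k)).card : ℝ))
      atTop (𝓝 (S.avgMultiplicity (S.cycleClass c))) := by
  obtain ⟨d, hd⟩ := hd
  set s := S.size c with hs
  obtain ⟨t, ht⟩ : c.seqs.Nonempty := by
    rw [Set.nonempty_iff_ne_empty]
    intro h
    have h1 := c.seqs_ncard
    have := c.length_pos
    rw [h, Set.ncard_empty] at h1
    omega
  have hsup := PrimeCycle.support_eq ht
  have hprime := c.seqs_subset ht
  -- The infimum defining the size has to be attained, and `sInf ∅ = 0` would be meaningless; some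
  -- `K n` contains the finitely many vertices of the cycle.
  have hne : {p | ∃ k, ∃ γ ∈ S.copies p k, c.support ⊆ S.image γ}.Nonempty := by
    have hfin : (Set.range t).Finite := by
      refine ((Finset.range c.length).finite_toSet.image fun k : ℕ => t k).subset ?_
      rintro _ ⟨i, rfl⟩
      have hl := c.length_pos
      have h0 := Int.emod_nonneg i (b := c.length) (by omega)
      have h1 := Int.emod_lt_of_pos i (b := c.length) (by omega)
      refine ⟨(i % c.length).toNat, ?_, ?_⟩
      · simp only [Finset.coe_range, Set.mem_Iio]
        omega
      · simp only
        rw [Int.toNat_of_nonneg h0, apply_emod_of_periodic hprime.1.1.1]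
    obtain ⟨n, hn⟩ := hS.exists_subset hfin.toFinset
    refine ⟨n, 0, SimpleGraph.Embedding.refl, rfl, ?_⟩
    rw [hsup]
    rintro _ ⟨i, rfl⟩
    exact ⟨⟨t i, hn (hfin.mem_toFinset.2 ⟨i, rfl⟩)⟩, rfl⟩
  have hmem : ∃ k, ∃ γ ∈ S.copies s k, c.support ⊆ S.image γ := Nat.sInf_mem hne
  obtain ⟨k₀, γ₀, hγ₀, hsub⟩ := hmem
  have hf₀ := mem_copyMaps_of_copies hγ₀
  set f₀ : ↥(S.K s : Set V) → V := fun v => (γ₀ v : V) with hf₀d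
  rw [hsup] at hsub
  choose b hb using fun i => hsub ⟨i, rfl⟩
  have hb' : (fun i => f₀ (b i)) = t := funext hb
  have hmin : ∀ p m, ∀ f ∈ S.copyMaps p m, (∀ i, f₀ (b i) ∈ Set.range f) → s ≤ p := by
    rintro p m f ⟨k, rfl, γ, hγ, e⟩ h
    refine Nat.sInf_le ⟨k, γ, hγ, ?_⟩
    rw [hsup, ← hb']
    rintro _ ⟨i, rfl⟩
    obtain ⟨v, hv⟩ := h i
    exact ⟨v, (e v).symm.trans hv⟩
  have hbp : (fun i => (b i : V)) ∈ primeSeq X c.length := by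
    rw [← primeSeq_copy_iff hf₀, hb']
    exact hprime
  let B : PrimePath X := primePathOfSeq c.length_pos hbp
  have hcop : ∀ m, ∀ f ∈ S.copyMaps s m, (fun i => f (b i)) ∈ primeSeq X c.length :=
    fun m f hf => (primeSeq_copy_iff hf b _).2 hbp
  have hcls : ∀ m, ∀ f ∈ S.copyMaps s m, ∀ D : PrimeCycle X, D.length = c.length →
      (fun i => f (b i)) ∈ D.seqs → S.cycleClass D = S.cycleClass (Quotient.mk _ B) := by
    rintro m f hf _ hl ⟨D, rfl, hD⟩
    exact (cycleClass_eq_of_copyMaps hf (C := B) (D := D) hl (fun i => (b i).2)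
      (fun i => congrFun hD i)).symm
  have hcB : S.cycleClass c = S.cycleClass (Quotient.mk _ B) :=
    hcls _ f₀ hf₀ c rfl (by rw [hb']; exact ht)
  -- `E D` says that `D` is a copy of `b`. It is preserved by `Maps` in both directions, hence by
  -- the generated equivalence, and so it describes the whole class.
  let E : PrimeCycle X → Prop := fun D => D.length = c.length ∧
    ∃ m, ∃ f ∈ S.copyMaps s m, (fun i => f (b i)) ∈ D.seqs
  have hstep : ∀ D D', S.Maps D D' → (E D ↔ E D') := by
    intro D D' hDD
    constructor
    · rintro ⟨hl, m, f, hf, hfD⟩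
      obtain ⟨n, M, g, hg, e, he, hgD⟩ := hDD.of_mem_left hfD
      have hn : (Subtype.val : ↥(S.K n : Set V) → V) ∈ S.copyMaps n n :=
        val_mem_copyMaps hid le_rfl
      obtain ⟨f₁, hf₁, h₁⟩ := exists_copyMap_of_copyMap_eq hf₀ hmin hid hun hf hn he hfD
      refine ⟨hDD.length_eq.trans hl, M, _, copyMaps_comp hf₁ hg, ?_⟩
      have : (fun i => g ⟨f₁ (b i), copyMaps_mem hf₁ _⟩) = fun i => g (e i) := by
        funext i
        congr 1
        exact Subtype.ext (h₁ i).symm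
      rw [this]
      exact hgD
    · rintro ⟨hl, m, f, hf, hfD⟩
      obtain ⟨n, M, g, hg, e, he, heD⟩ := hDD.of_mem_right hfD
      obtain ⟨f₁, hf₁, h₁⟩ := exists_copyMap_of_copyMap_eq hf₀ hmin hid hun hf hg he hfD
      refine ⟨hDD.length_eq.symm.trans hl, n, f₁, hf₁, ?_⟩
      rw [← funext h₁]
      exact heD
  have hE : ∀ D, S.cycleClass D = S.cycleClass c ↔ E D := by
    have hEc : E c := ⟨rfl, _, f₀, hf₀, by rw [hb']; exact ht⟩
    intro D
    constructor
    · intro h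
      have h' := Quot.eqvGen_exact h
      have : ∀ x y, Relation.EqvGen S.Maps x y → (E x ↔ E y) := by
        intro x y hxy
        induction hxy with
        | rel x y h => exact hstep x y h
        | refl x => exact Iff.rfl
        | symm x y _ ih => exact ih.symm
        | trans x y z _ _ ih1 ih2 => exact ih1.trans ih2
      exact (this _ _ h').2 hEc
    · rintro ⟨hl, m, f, hf, h⟩
      rw [hcB]
      exact hcls m f hf D hl h
  have hcount : ∀ k, S.multiplicity (S.cycleClass c) (s + k) = (S.copies s k).ncard := by
    intro k
    rw [copies_ncard]
    -- The cycles of the class in `K (s + k)` correspond to the copies of `K s`: each arises from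
    -- some copy, and from only one because no cycle lies in two copies.
    let F : S.copyMaps s (s + k) → PrimeCycle X := fun f =>
      Quotient.mk _ (primePathOfSeq c.length_pos (hcop _ f.1 f.2))
    have hF : ∀ f, (fun i => f.1 (b i)) ∈ (F f).seqs := fun f => ⟨_, rfl, rfl⟩
    have himg : {D : PrimeCycle X | Quot.mk S.Maps D = S.cycleClass c ∧
        D.support ⊆ (S.K (s + k) : Set V)} = F '' Set.univ := by
      ext D
      constructor
      · rintro ⟨h1, h2⟩
        obtain ⟨hl, m, f, hf, hfD⟩ := (hE D).1 h1
        rw [PrimeCycle.support_eq hfD] at h2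
        have hn : (Subtype.val : ↥(S.K (s + k) : Set V) → V) ∈ S.copyMaps (s + k) (s + k) :=
          val_mem_copyMaps hid le_rfl
        obtain ⟨f₁, hf₁, h₁⟩ := exists_copyMap_of_copyMap_eq hf₀ hmin hid hun hf hn
          (e := fun i => ⟨f (b i), h2 ⟨i, rfl⟩⟩) (fun i => rfl) hfD
        refine ⟨⟨f₁, hf₁⟩, trivial, ?_⟩
        refine PrimeCycle.ext_of_mem_seqs hl.symm (hF ⟨f₁, hf₁⟩) ?_
        rw [← funext h₁]
        exact hfD
      · rintro ⟨f, -, rfl⟩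
        refine ⟨(hE _).2 ⟨rfl, _, f.1, f.2, hF f⟩, ?_⟩
        rw [PrimeCycle.support_eq (hF f)]
        rintro _ ⟨i, rfl⟩
        exact copyMaps_mem f.2 _
    unfold multiplicity
    rw [himg, Set.ncard_image_of_injective, Set.ncard_univ]
    · rfl
    · intro f f' h
      have hf := hF f
      obtain ⟨j, hj⟩ := PrimeCycle.exists_shift_of_mem_seqs (h ▸ hF f') hf
      exact Subtype.ext (copyMaps_unique hun f.2 f'.2 hf (fun i => ⟨_, rfl⟩)
        (fun i => ⟨_, (hj i).symm⟩))
  simp only [← hcount]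
  have := (tendsto_multiplicity hS hd (S.cycleClass c)).comp (tendsto_add_atTop_nat s)
  refine this.congr fun k => ?_
  simp only [Function.comp, add_comm k s]

end GraphTower

end

noncomputable section

/-! Averages of functions on the vertices -/

namespace GraphTower

variable {V : Type*} {X : SimpleGraph V} {S : GraphTower X}

/-- The average of `F` over `K n` tends to `L`. -/
def HasAverage (S : GraphTower X) (F : V → ℂ) (L : ℂ) : Prop :=
  Tendsto (fun n => (∑ v ∈ S.K n, F v) / ((S.K n).card : ℂ)) atTop (𝓝 L)

theorem HasAverage.add {F G : V → ℂ} {L M : ℂ} (hF : S.HasAverage F L) (hG : S.HasAverage G M) :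
    S.HasAverage (fun v => F v + G v) (L + M) := by
  unfold HasAverage
  simp only [Finset.sum_add_distrib, add_div]
  exact Tendsto.add hF hG

theorem HasAverage.const_mul {F : V → ℂ} {L : ℂ} (hF : S.HasAverage F L) (c : ℂ) :
    S.HasAverage (fun v => c * F v) (c * L) := by
  unfold HasAverage
  simp only [← Finset.mul_sum, mul_div_assoc]
  exact Tendsto.const_mul c hF

theorem HasAverage.sub {F G : V → ℂ} {L M : ℂ} (hF : S.HasAverage F L) (hG : S.HasAverage G M) :
    S.HasAverage (fun v => F v - G v) (L - M) := by
  simpa [sub_eq_add_neg] using hF.add (hG.const_mul (-1))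

theorem HasAverage.unique {F : V → ℂ} {L M : ℂ} (hF : S.HasAverage F L)
    (hG : S.HasAverage F M) : L = M :=
  tendsto_nhds_unique hF hG

/-- A sequence of sums that differ from the sums over `K n` by a negligible amount. -/
theorem HasAverage.of_sub_le {F : V → ℂ} {L : ℂ} {a : ℕ → ℂ} {b : ℕ → ℝ}
    (ha : Tendsto (fun n => a n / ((S.K n).card : ℂ)) atTop (𝓝 L))
    (hb : Tendsto (fun n => b n / ((S.K n).card : ℝ)) atTop (𝓝 0))
    (h : ∀ n, ‖∑ v ∈ S.K n, F v - a n‖ ≤ b n) : S.HasAverage F L := by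
  have h1 : Tendsto (fun n => (∑ v ∈ S.K n, F v - a n) / ((S.K n).card : ℂ)) atTop (𝓝 0) := by
    refine squeeze_zero_norm (fun n => ?_) hb
    rw [norm_div, Complex.norm_natCast]
    gcongr
    exact h n
  have h2 := ha.add h1
  rw [add_zero] at h2
  refine h2.congr fun n => ?_
  rw [← add_div]
  congr 1
  ring

theorem tendsto_const_div_card [Infinite V] (hS : S.IsSelfSimilar) (C : ℝ) :
    Tendsto (fun n => C / ((S.K n).card : ℝ)) atTop (𝓝 0) :=
  tendsto_const_nhds.div_atTop (tendsto_natCast_atTop_atTop.comp hS.tendsto_card)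

theorem tendsto_frontier_div_card (hS : S.IsSelfSimilar) (C : ℝ) :
    Tendsto (fun n => C * (vertexFrontier X (S.K n)).ncard / ((S.K n).card : ℝ)) atTop (𝓝 0) := by
  simpa [mul_div_assoc] using hS.amenable.const_mul C

/-- Changing a function at finitely many vertices does not change its average. -/
theorem HasAverage.congr_cofinite [Infinite V] (hS : S.IsSelfSimilar) {F G : V → ℂ} {L : ℂ}
    (hF : S.HasAverage F L) (h : {v | G v ≠ F v}.Finite) : S.HasAverage G L := by
  classical
  refine HasAverage.of_sub_le hF (tendsto_const_div_card hS (∑ v ∈ h.toFinset, ‖G v - F v‖))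
    fun n => ?_
  rw [← Finset.sum_sub_distrib]
  refine (norm_sum_le _ _).trans ?_
  rw [← Finset.sum_filter_add_sum_filter_not (S.K n) (fun v => G v ≠ F v)]
  have h2 : ∑ v ∈ (S.K n).filter (fun v => ¬ G v ≠ F v), ‖G v - F v‖ = 0 := by
    refine Finset.sum_eq_zero fun v hv => ?_
    have := (Finset.mem_filter.1 hv).2
    push Not at this
    rw [this, sub_self, norm_zero]
  rw [h2, add_zero]
  refine Finset.sum_le_sum_of_subset_of_nonneg ?_ fun _ _ _ => norm_nonneg _
  intro v hv
  exact h.mem_toFinset.2 (Finset.mem_filter.1 hv).2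

theorem hasAverage_const [Infinite V] (hS : S.IsSelfSimilar) (c : ℂ) :
    S.HasAverage (fun _ => c) c := by
  refine tendsto_const_nhds.congr fun n => ?_
  have : ((S.K n).card : ℂ) ≠ 0 := by exact_mod_cast (hS.nonempty n).card_pos.ne'
  rw [Finset.sum_const, nsmul_eq_mul]
  field_simp

theorem vertexFrontier_finite (S : GraphTower X) (n : ℕ) : (vertexFrontier X (S.K n)).Finite :=
  (S.K n).finite_toSet.subset fun _ h => h.1

/-- The averages of a local family can be computed with the sequences that start in `K n`. -/
theorem LocalFamily.hasAverage {c₀ : ℕ} {P : Set (ℤ → V)} (hS : S.IsSelfSimilar)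
    (hP : S.LocalFamily c₀ P) {L : ℝ}
    (hL : Tendsto (fun n => ((S.inside P n).ncard : ℝ) / (S.K n).card) atTop (𝓝 L)) :
    S.HasAverage (fun v => ({c | c ∈ P ∧ c 0 = v}.ncard : ℂ)) L := by
  classical
  have hfin : ∀ v, {c | c ∈ P ∧ c 0 = v}.Finite := fun v =>
    (hP.finite_meeting {v}).subset fun c hc => ⟨hc.1, 0, by simp [hc.2]⟩
  refine HasAverage.of_sub_le (a := fun n => ((S.inside P n).ncard : ℂ)) ?_
    (tendsto_frontier_div_card hS c₀) fun n => ?_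
  · have := (Complex.continuous_ofReal.tendsto L).comp hL
    refine this.congr fun n => ?_
    simp
  · have h1 : ∑ v ∈ S.K n, {c | c ∈ P ∧ c 0 = v}.ncard = {c | c ∈ P ∧ c 0 ∈ S.K n}.ncard := by
      rw [← Set.ncard_biUnion_eq_sum]
      · congr 1
        ext c
        simp
      · exact fun v _ => hfin v
      · intro v _ w _ hne
        rw [Set.disjoint_left]
        rintro c ⟨-, h⟩ ⟨-, h'⟩
        exact hne (h.symm.trans h')
    have hfin' : {c | c ∈ P ∧ c 0 ∈ S.K n}.Finite :=
      (hP.finite_meeting (S.K n)).subset fun c hc => ⟨hc.1, 0, hc.2⟩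
    have h2 : (S.inside P n).ncard ≤ {c | c ∈ P ∧ c 0 ∈ S.K n}.ncard :=
      Set.ncard_le_ncard (fun c hc => ⟨hc.1, hc.2 0⟩) hfin'
    have hFf := S.vertexFrontier_finite n
    have h3 : {c | c ∈ P ∧ c 0 ∈ S.K n}.ncard ≤
        (S.inside P n).ncard + c₀ * (vertexFrontier X (S.K n)).ncard := by
      calc _ ≤ (S.inside P n ∪ {c | c ∈ P ∧ ∃ i, c i ∈ hFf.toFinset}).ncard := by
            refine Set.ncard_le_ncard ?_
              ((hP.inside_finite n).union (hP.finite_meeting _))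
            rintro c ⟨hc, h0⟩
            by_cases hall : ∀ i, c i ∈ S.K n
            · exact Or.inl ⟨hc, hall⟩
            · push Not at hall
              obtain ⟨j, hj⟩ := hall
              obtain ⟨k, hk⟩ := hP.conn c hc (S.K n) 0 j h0 hj
              exact Or.inr ⟨hc, k, hFf.mem_toFinset.2 hk⟩
        _ ≤ _ := Set.ncard_union_le _ _
        _ ≤ _ := by
            rw [Set.ncard_eq_toFinset_card _ hFf]
            exact Nat.add_le_add_left (hP.card_meeting _) _
    rw [← Nat.cast_sum, h1, ← Complex.ofReal_natCast, ← Complex.ofReal_natCast,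
      ← Complex.ofReal_sub, Complex.norm_real, Real.norm_eq_abs]
    have h2' : ((S.inside P n).ncard : ℝ) ≤ {c | c ∈ P ∧ c 0 ∈ S.K n}.ncard := by
      exact_mod_cast h2
    have h3' : ({c | c ∈ P ∧ c 0 ∈ S.K n}.ncard : ℝ) ≤
        (S.inside P n).ncard + c₀ * (vertexFrontier X (S.K n)).ncard := by exact_mod_cast h3
    rw [abs_of_nonneg (by linarith)]
    linarith

/-- The number of closed paths through a vertex has an average. -/
theorem exists_hasAverage_stepOp_pow [Infinite V] [X.LocallyFinite] [DecidableEq V]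
    (hS : S.IsSelfSimilar) (hd : ∃ d : ℕ, ∀ v, X.degree v ≤ d) (k : ℕ) :
    ∃ L, S.HasAverage
      (fun v => (stepOp (fun v => X.neighborFinset v) ^ k) (Pi.single v 1) v) L := by
  rcases Nat.eq_zero_or_pos k with rfl | hk
  · refine ⟨1, ?_⟩
    simpa using hasAverage_const hS 1
  · obtain ⟨d, hd⟩ := hd
    have hP : S.LocalFamily (k * d ^ k) (pathSeq X k) :=
      localFamily_of_subset hd hk subset_rfl fun _ _ _ hf c => pathSeq_copy_iff hf c k
    obtain ⟨L, hL, -⟩ := hP.exists_limit hS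
    refine ⟨L, ?_⟩
    convert hP.hasAverage hS hL using 2 with v
    rw [closedSeq_ncard_eq _ hk]
    congr 2
    ext c
    simp [closedSeq, pathSeq, IsPeriod, and_assoc]

end GraphTower

/-! The adjacency operator -/

section Adjacency

variable {V : Type*} {X : SimpleGraph V} [X.LocallyFinite]
  {hd : ∃ d : ℕ, ∀ v, X.degree v ≤ d}

theorem adjacencyOp_coe (f : EllTwo V) :
    (adjacencyOp X hd f : V → ℂ) = stepOp (fun v => X.neighborFinset v) f := rfl

/-- Walk counts and dart identities are proved for arbitrary functions on `V`; this transfers them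
to `ℓ²`. -/
theorem aeval_adjacencyOp_coe (p : Polynomial ℂ) (f : EllTwo V) :
    (Polynomial.aeval (adjacencyOp X hd) p f : V → ℂ) =
      Polynomial.aeval (stepOp (fun v => X.neighborFinset v)) p (f : V → ℂ) := by
  induction p using Polynomial.induction_on' with
  | add p q hp hq =>
    rw [map_add, map_add, add_apply, LinearMap.add_apply, lp.coeFn_add, hp, hq]
  | monomial n a =>
    rw [Polynomial.aeval_monomial, Polynomial.aeval_monomial]
    have h : ((adjacencyOp X hd ^ n) f : V → ℂ) =
        (stepOp (fun v => X.neighborFinset v) ^ n) (f : V → ℂ) := by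
      induction n with
      | zero => rfl
      | succ n ih =>
        rw [pow_succ', pow_succ', mul_apply_eq_comp, Module.End.mul_apply,
          adjacencyOp_coe, ih]
    rw [Algebra.algebraMap_eq_smul_one, Algebra.algebraMap_eq_smul_one, smul_mul_assoc,
      smul_mul_assoc, one_mul, one_mul, smul_apply, LinearMap.smul_apply,
      lp.coeFn_smul, h]

theorem adjacencyOp_norm_le {d : ℕ} (h : ∀ v, X.degree v ≤ d) : ‖adjacencyOp X hd‖ ≤ d := by
  refine ContinuousLinearMap.opNorm_le_bound _ (by positivity) fun f => ?_
  refine lp.norm_le_of_forall_sum_le (p := 2) (by norm_num) (by positivity) ?_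
  simpa [adjacencyOp_apply] using adjacency_sq_bound X d h f

theorem adjacencyOp_single [DecidableEq V] (v : V) (a : ℂ) :
    adjacencyOp X hd (lp.single 2 v a) = ∑ w ∈ X.neighborFinset v, lp.single 2 w a := by
  ext x
  rw [adjacencyOp_apply, lp.coeFn_sum, Finset.sum_apply]
  have h : v ∈ X.neighborFinset x ↔ x ∈ X.neighborFinset v := by
    rw [SimpleGraph.mem_neighborFinset, SimpleGraph.mem_neighborFinset, SimpleGraph.adj_comm]
  simp only [lp.single_apply, Pi.single_apply, Finset.sum_ite_eq, Finset.sum_ite_eq', h]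

theorem adjacencyOp_isSelfAdjoint : IsSelfAdjoint (adjacencyOp X hd) := by
  classical
  rw [ContinuousLinearMap.isSelfAdjoint_iff']
  ext f v
  have h1 : (ContinuousLinearMap.adjoint (adjacencyOp X hd) f) v =
      inner ℂ (lp.single 2 v (1 : ℂ)) (ContinuousLinearMap.adjoint (adjacencyOp X hd) f) := by
    rw [lp.inner_single_left]
    simp
  rw [h1, ContinuousLinearMap.adjoint_inner_right, adjacencyOp_single, sum_inner,
    adjacencyOp_apply]
  refine Finset.sum_congr rfl fun w _ => ?_
  rw [lp.inner_single_left]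
  simp

theorem mem_spectrum_adjacencyOp {d : ℕ} (h : ∀ v, X.degree v ≤ d) {z : ℂ}
    (hz : z ∈ spectrum ℂ (adjacencyOp X hd)) : z = (z.re : ℂ) ∧ z.re ∈ Set.Icc (-(d : ℝ)) d := by
  have hre : z = (z.re : ℂ) := adjacencyOp_isSelfAdjoint.mem_spectrum_eq_re hz
  refine ⟨hre, ?_⟩
  have h1 : ‖z‖ ≤ ‖adjacencyOp X hd‖ := by
    have := spectrum.norm_le_norm_mul_of_mem hz
    refine this.trans ?_
    exact mul_le_of_le_one_right (norm_nonneg _) ContinuousLinearMap.norm_id_le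
  rw [hre, Complex.norm_real, Real.norm_eq_abs] at h1
  exact abs_le.1 (h1.trans (adjacencyOp_norm_le h))

end Adjacency

end

noncomputable section

/-! The analytic logarithm and the continuous functional calculus -/

/-- The branch of the logarithm that is used in `analyticLog`. -/
def logBranch (c z : ℂ) : ℂ := Complex.log c + Complex.log (z / c)

theorem exp_logBranch {c z : ℂ} (hc : c ≠ 0) (hz : z ≠ 0) : Complex.exp (logBranch c z) = z := by
  rw [logBranch, Complex.exp_add, Complex.exp_log hc, Complex.exp_log (div_ne_zero hz hc)]
  field_simp

/-- `|z / c - 1| < 1`, so `z / c` has positive real part. This is why `log c + log (z / c)` is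
holomorphic on the closed disc, wherever the disc lies relative to the cut. -/
theorem div_mem_slitPlane {c z : ℂ} {r : ℝ} (hr : r < ‖c‖) (hz : z ∈ Metric.closedBall c r) :
    z / c ∈ Complex.slitPlane := by
  have hz' := mem_closedBall_iff_norm.1 hz
  have hr0 : 0 ≤ r := (norm_nonneg _).trans hz'
  have hc : 0 < ‖c‖ := hr0.trans_lt hr
  have h1 : ‖z / c - 1‖ < 1 := by
    have : z / c - 1 = (z - c) / c := by
      have := norm_pos_iff.1 hc
      field_simp
    rw [this, norm_div, div_lt_one hc]
    exact hz'.trans_lt hr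
  refine Or.inl ?_
  have h2 := (Complex.abs_re_le_norm (z / c - 1)).trans_lt h1
  rw [abs_lt, Complex.sub_re, Complex.one_re] at h2
  linarith

theorem ne_zero_of_mem_closedBall {c z : ℂ} {r : ℝ} (hr : r < ‖c‖)
    (hz : z ∈ Metric.closedBall c r) : z ≠ 0 := by
  rintro rfl
  have := mem_closedBall_iff_norm.1 hz
  rw [zero_sub, norm_neg] at this
  linarith

theorem differentiableOn_logBranch {c : ℂ} {r : ℝ} (hr : r < ‖c‖) :
    DifferentiableOn ℂ (logBranch c) (Metric.closedBall c r) := fun _ hz =>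
  ((differentiableAt_const _).add ((differentiableAt_id.div_const c).clog
    (div_mem_slitPlane hr hz))).differentiableWithinAt

/-- The analytic logarithm of a normal element is a function of it. -/
theorem exists_analyticLog_eq_cfc {𝔸 : Type*} [CStarAlgebra 𝔸] (a : 𝔸) [IsStarNormal a]
    (h : (0 : ℂ) ∉ convexHull ℝ (spectrum ℂ a)) :
    ∃ (c : ℂ) (r : ℝ), r < ‖c‖ ∧ spectrum ℂ a ⊆ Metric.ball c r ∧
      analyticLog a = cfc (logBranch c) a := by
  classical
  obtain ⟨hr0, hr, hsub⟩ := Classical.choose_spec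
    (exists_disc (spectrum.isCompact (𝕜 := ℂ) a) h)
  set p := Classical.choose (exists_disc (spectrum.isCompact (𝕜 := ℂ) a) h) with hp
  have hsp : spectrum ℂ a ⊆ Metric.ball p.1 p.2 := (subset_convexHull ℝ _).trans hsub
  refine ⟨p.1, p.2, hr, hsp, ?_⟩
  have hlog : analyticLog a = (2 * Real.pi * Complex.I : ℂ)⁻¹ •
      ∮ z in C(p.1, p.2), logBranch p.1 z • resolvent a z := by
    rw [analyticLog, dif_pos h]
    rfl
  have hon : ∀ θ, circleMap p.1 p.2 θ ∈ Metric.closedBall p.1 p.2 := fun θ =>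
    circleMap_mem_closedBall _ hr0.le θ
  have hne : ∀ θ, ∀ x ∈ spectrum ℂ a, circleMap p.1 p.2 θ - x ≠ 0 := by
    intro θ x hx h0
    rw [sub_eq_zero] at h0
    have h1 := hsp hx
    rw [← h0, Metric.mem_ball, dist_comm] at h1
    have h2 := circleMap_mem_sphere p.1 hr0.le θ
    rw [Metric.mem_sphere, dist_comm] at h2
    exact h1.ne h2
  -- The contour integral as an integral over the angle of functions of `a`. The continuous
  -- functional calculus commutes with it, so the claim reduces to the scalar integral at each
  -- spectral point `x`.
  let F : ℝ → ℂ → ℂ := fun θ x => deriv (circleMap p.1 p.2) θ *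
    (logBranch p.1 (circleMap p.1 p.2 θ) * (circleMap p.1 p.2 θ - x)⁻¹)
  have hFc : ContinuousOn (Function.uncurry F) (Set.univ ×ˢ spectrum ℂ a) := by
    have h1 : Continuous fun θ => logBranch p.1 (circleMap p.1 p.2 θ) :=
      (differentiableOn_logBranch hr).continuousOn.comp_continuous (continuous_circleMap _ _) hon
    have h2 : Continuous (deriv (circleMap p.1 p.2)) := by
      have : deriv (circleMap p.1 p.2) = fun θ => circleMap 0 p.2 θ * Complex.I :=
        funext fun θ => deriv_circleMap _ _ _
      rw [this]
      exact (continuous_circleMap _ _).mul continuous_const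
    refine ContinuousOn.mul (h2.comp continuous_fst).continuousOn
      (ContinuousOn.mul (h1.comp continuous_fst).continuousOn (ContinuousOn.inv₀ ?_ ?_))
    · exact (((continuous_circleMap _ _).comp continuous_fst).sub continuous_snd).continuousOn
    · rintro ⟨θ, x⟩ ⟨-, hx⟩
      exact hne θ x hx
  obtain ⟨M, hM⟩ : ∃ M, ∀ q ∈ Set.Icc 0 (2 * Real.pi) ×ˢ spectrum ℂ a,
      ‖Function.uncurry F q‖ ≤ M :=
    (isCompact_Icc.prod (spectrum.isCompact (𝕜 := ℂ) a)).exists_bound_of_continuousOn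
      (hFc.mono (Set.prod_mono (Set.subset_univ _) subset_rfl))
  have hcfc : ∀ θ, cfc (F θ) a = deriv (circleMap p.1 p.2) θ •
      (logBranch p.1 (circleMap p.1 p.2 θ) • resolvent a (circleMap p.1 p.2 θ)) := by
    intro θ
    have h1 : ContinuousOn (fun x => circleMap p.1 p.2 θ - x) (spectrum ℂ a) :=
      continuousOn_const.sub continuousOn_id
    have h2 : ContinuousOn (fun x => (circleMap p.1 p.2 θ - x)⁻¹) (spectrum ℂ a) :=
      h1.inv₀ (hne θ)
    have h3 : cfc (fun x => (circleMap p.1 p.2 θ - x)⁻¹) a =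
        resolvent a (circleMap p.1 p.2 θ) := by
      rw [cfc_inv _ a (hne θ) h1, cfc_sub _ _ a, cfc_const _ a, cfc_id' ℂ a]
      rfl
    change cfc (fun x => deriv (circleMap p.1 p.2) θ *
      (logBranch p.1 (circleMap p.1 p.2 θ) * (circleMap p.1 p.2 θ - x)⁻¹)) a = _
    have h4 : ContinuousOn (fun x => logBranch p.1 (circleMap p.1 p.2 θ) *
        (circleMap p.1 p.2 θ - x)⁻¹) (spectrum ℂ a) := continuousOn_const.mul h2
    rw [cfc_const_mul _ _ a h4, cfc_const_mul _ _ a h2, h3]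
  have hint := cfc_setIntegral (μ := MeasureTheory.volume) (s := Set.Ioc 0 (2 * Real.pi))
    measurableSet_Ioc F (fun _ => M) a
    (hFc.mono (Set.prod_mono (Set.subset_univ _) subset_rfl))
    ((MeasureTheory.ae_restrict_iff' measurableSet_Ioc).2
      (.of_forall fun θ hθ x hx => hM (θ, x) ⟨Set.Ioc_subset_Icc_self hθ, hx⟩))
    (MeasureTheory.hasFiniteIntegral_const _)
  have hpi : (0 : ℝ) ≤ 2 * Real.pi := Real.two_pi_pos.le
  have hE : ∮ z in C(p.1, p.2), logBranch p.1 z • resolvent a z =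
      cfc (fun x => ∮ z in C(p.1, p.2), (logBranch p.1 z * (z - x)⁻¹)) a := by
    simp only [circleIntegral, intervalIntegral.integral_of_le hpi, smul_eq_mul]
    simp only [hcfc] at hint
    exact hint.symm
  -- Cauchy's integral formula, since the spectrum is inside the circle.
  have hval : ∀ x ∈ spectrum ℂ a, ∮ z in C(p.1, p.2), (logBranch p.1 z * (z - x)⁻¹) =
      (2 * Real.pi * Complex.I : ℂ) * logBranch p.1 x := by
    intro x hx
    have hdc : DiffContOnCl ℂ (logBranch p.1) (Metric.ball p.1 p.2) := by
      refine DifferentiableOn.diffContOnCl ?_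
      rw [closure_ball _ hr0.ne']
      exact differentiableOn_logBranch hr
    have := hdc.two_pi_i_inv_smul_circleIntegral_sub_inv_smul (hsp hx)
    rw [← this, smul_eq_mul, ← mul_assoc, mul_inv_cancel₀ Complex.two_pi_I_ne_zero, one_mul]
    simp only [smul_eq_mul, mul_comm]
  have hLc : ContinuousOn (logBranch p.1) (spectrum ℂ a) :=
    (differentiableOn_logBranch hr).continuousOn.mono (hsp.trans Metric.ball_subset_closedBall)
  rw [hlog, hE, cfc_congr (g := fun x => (2 * Real.pi * Complex.I : ℂ) * logBranch p.1 x) hval,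
    cfc_const_mul _ _ a hLc, smul_smul, inv_mul_cancel₀ Complex.two_pi_I_ne_zero, one_smul]

end

noncomputable section

/-! ### Continuous functions of the adjacency operator -/

section Calculus

variable {V : Type*} {X : SimpleGraph V} [X.LocallyFinite]

instance adjacencyOp_isStarNormal (hd : ∃ d : ℕ, ∀ v, X.degree v ≤ d) :
    IsStarNormal (adjacencyOp X hd) := adjacencyOp_isSelfAdjoint.isStarNormal

/-- The continuous functions of the adjacency operator, with functions defined on the interval
`[-d, d]`. -/
def adjacencyCalculus (hd : ∃ d : ℕ, ∀ v, X.degree v ≤ d) {d : ℕ} (h : ∀ v, X.degree v ≤ d) :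
    C(Set.Icc (-(d : ℝ)) d, ℂ) →⋆ₐ[ℂ] (EllTwo V →L[ℂ] EllTwo V) :=
  (cfcHom (R := ℂ) (p := IsStarNormal) (adjacencyOp_isStarNormal hd)).comp
    (ContinuousMap.compStarAlgHom' ℂ ℂ
      ⟨fun z => ⟨(z : ℂ).re, (mem_spectrum_adjacencyOp h z.2).2⟩,
        (Complex.continuous_re.comp continuous_subtype_val).subtype_mk _⟩)

variable {hd : ∃ d : ℕ, ∀ v, X.degree v ≤ d} {d : ℕ} (h : ∀ v, X.degree v ≤ d)

/-- Only values on the spectrum matter, so functions on a fixed interval represent all continuous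
functions of the operator without knowledge of its spectrum. -/
theorem cfc_adjacencyOp {f : ℂ → ℂ} (hf : ContinuousOn f (spectrum ℂ (adjacencyOp X hd)))
    {g : C(Set.Icc (-(d : ℝ)) d, ℂ)}
    (hfg : ∀ z ∈ spectrum ℂ (adjacencyOp X hd), ∀ hz : z.re ∈ Set.Icc (-(d : ℝ)) d,
      f z = g ⟨z.re, hz⟩) :
    cfc f (adjacencyOp X hd) = adjacencyCalculus hd h g := by
  rw [cfc_apply f _ (adjacencyOp_isStarNormal hd) hf]
  simp only [adjacencyCalculus, StarAlgHom.comp_apply]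
  congr 1
  ext z
  exact hfg z z.2 _

/-- The inclusion of `[-d, d]` into the complex numbers. -/
def ofRealMap (d : ℕ) : C(Set.Icc (-(d : ℝ)) d, ℂ) :=
  ⟨fun x => ((x : ℝ) : ℂ), Complex.continuous_ofReal.comp continuous_subtype_val⟩

theorem adjacencyCalculus_ofRealMap :
    adjacencyCalculus hd h (ofRealMap d) = adjacencyOp X hd := by
  rw [← cfc_adjacencyOp h (f := id) continuousOn_id, cfc_id ℂ (adjacencyOp X hd)]
  intro z hz _
  exact (mem_spectrum_adjacencyOp h hz).1

theorem adjacencyCalculus_aeval (p : Polynomial ℂ) :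
    adjacencyCalculus hd h (Polynomial.aeval (ofRealMap d) p) =
      Polynomial.aeval (adjacencyOp X hd) p := by
  rw [← adjacencyCalculus_ofRealMap h, Polynomial.aeval_algHom_apply]

theorem aeval_ofRealMap_apply (p : Polynomial ℂ) (x : Set.Icc (-(d : ℝ)) d) :
    Polynomial.aeval (ofRealMap d) p x = p.eval ((x : ℝ) : ℂ) := by
  have := Polynomial.aeval_algHom_apply (ContinuousMap.evalAlgHom ℂ ℂ x) (ofRealMap d) p
  rw [ContinuousMap.evalAlgHom_apply, ContinuousMap.evalAlgHom_apply] at this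
  rw [← this, Polynomial.coe_aeval_eq_eval]
  rfl

/-- Real Weierstrass approximation, applied to the real and imaginary parts with error `ε / 2` each.
-/
theorem exists_polynomial_near_complex (d : ℕ) (g : C(Set.Icc (-(d : ℝ)) d, ℂ)) {ε : ℝ}
    (hε : 0 < ε) : ∃ p : Polynomial ℂ, ‖Polynomial.aeval (ofRealMap d) p - g‖ < ε := by
  obtain ⟨p, hp⟩ := exists_polynomial_near_continuousMap (-(d : ℝ)) d
    ⟨fun x => (g x).re, Complex.continuous_re.comp g.continuous⟩ (ε / 2) (half_pos hε)
  obtain ⟨r, hr⟩ := exists_polynomial_near_continuousMap (-(d : ℝ)) d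
    ⟨fun x => (g x).im, Complex.continuous_im.comp g.continuous⟩ (ε / 2) (half_pos hε)
  refine ⟨p.map (algebraMap ℝ ℂ) + Polynomial.C Complex.I * r.map (algebraMap ℝ ℂ), ?_⟩
  rw [ContinuousMap.norm_lt_iff _ hε]
  intro x
  have h1 := (ContinuousMap.norm_coe_le_norm _ x).trans_lt hp
  have h2 := (ContinuousMap.norm_coe_le_norm _ x).trans_lt hr
  rw [ContinuousMap.sub_apply] at h1 h2 ⊢
  rw [aeval_ofRealMap_apply]
  have e : Polynomial.eval ((x : ℝ) : ℂ) (p.map (algebraMap ℝ ℂ) +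
      Polynomial.C Complex.I * r.map (algebraMap ℝ ℂ)) - g x =
      ((p.eval (x : ℝ) - (g x).re : ℝ) : ℂ) + Complex.I * ((r.eval (x : ℝ) - (g x).im : ℝ) : ℂ) := by
    have hp' := Polynomial.eval_map_apply (algebraMap ℝ ℂ) (p := p) (x : ℝ)
    have hr' := Polynomial.eval_map_apply (algebraMap ℝ ℂ) (p := r) (x : ℝ)
    rw [Complex.coe_algebraMap] at hp' hr'
    rw [Polynomial.eval_add, Polynomial.eval_mul, Polynomial.eval_C, hp', hr']
    conv_lhs => rw [← Complex.re_add_im (g x)]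
    push_cast
    ring
  rw [e]
  refine (norm_add_le _ _).trans_lt ?_
  rw [norm_mul, Complex.norm_I, one_mul, Complex.norm_real, Complex.norm_real]
  have h1' : ‖p.eval (x : ℝ) - (g x).re‖ < ε / 2 := h1
  have h2' : ‖r.eval (x : ℝ) - (g x).im‖ < ε / 2 := h2
  linarith

end Calculus

/-! ### The trace on continuous functions of the adjacency operator -/

namespace GraphTower

variable {V : Type*} {X : SimpleGraph V}

/-- The normalized trace as a functional. -/
def normalizedTraceL (S : GraphTower X) (n : ℕ) : (EllTwo V →L[ℂ] EllTwo V) →L[ℂ] ℂ :=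
  LinearMap.mkContinuous
    { toFun := fun T => S.normalizedTrace T n
      map_add' := fun T U => by
        simp [normalizedTrace, Finset.sum_add_distrib, add_div]
      map_smul' := fun c T => by
        simp [normalizedTrace, Finset.mul_sum, mul_div_assoc, Finset.sum_div] } 1 (by
    intro T
    classical
    simp only [LinearMap.coe_mk, AddHom.coe_mk, normalizedTrace]
    rw [norm_div, one_mul, Complex.norm_natCast]
    refine div_le_of_le_mul₀ (by positivity) (norm_nonneg _) ?_
    refine (norm_sum_le _ _).trans ?_
    rw [mul_comm, ← nsmul_eq_mul]
    refine Finset.sum_le_card_nsmul _ _ _ fun v _ => ?_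
    refine (lp.norm_apply_le_norm (by norm_num) _ _).trans ((T.le_opNorm _).trans ?_)
    rw [lp.norm_single (by norm_num)]
    simp)

theorem normalizedTraceL_apply (S : GraphTower X) (n : ℕ) (T : EllTwo V →L[ℂ] EllTwo V) :
    S.normalizedTraceL n T = S.normalizedTrace T n := rfl

theorem normalizedTraceL_norm_le (S : GraphTower X) (n : ℕ) : ‖S.normalizedTraceL n‖ ≤ 1 :=
  LinearMap.mkContinuous_norm_le _ zero_le_one _

variable {S : GraphTower X}

theorem tendsto_normalizedTrace_iff [inst : DecidableEq V] (T : EllTwo V →L[ℂ] EllTwo V) (L : ℂ) :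
    Tendsto (S.normalizedTrace T) atTop (𝓝 L) ↔
      S.HasAverage (fun v => T (lp.single 2 v 1) v) L := by
  obtain rfl : inst = fun a b => Classical.propDecidable (a = b) := Subsingleton.elim _ _
  rfl

variable [X.LocallyFinite] {hd : ∃ d : ℕ, ∀ v, X.degree v ≤ d}

/-- By linearity this concerns powers of the operator, whose diagonal entries count the closed paths
through a vertex. -/
theorem exists_tendsto_normalizedTrace_aeval [Infinite V] (hS : S.IsSelfSimilar)
    (p : Polynomial ℂ) :
    ∃ L, Tendsto (S.normalizedTrace (Polynomial.aeval (adjacencyOp X hd) p)) atTop (𝓝 L) := by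
  classical
  induction p using Polynomial.induction_on' with
  | add p q hp hq =>
    obtain ⟨L, hL⟩ := hp
    obtain ⟨M, hM⟩ := hq
    refine ⟨L + M, (hL.add hM).congr fun n => ?_⟩
    simp only [← normalizedTraceL_apply, map_add]
  | monomial n a =>
    obtain ⟨L, hL⟩ := exists_hasAverage_stepOp_pow hS hd n
    refine ⟨a * L, (tendsto_normalizedTrace_iff _ _).2 ?_⟩
    convert hL.const_mul a using 2 with v
    rw [aeval_adjacencyOp_coe, Polynomial.aeval_monomial, Algebra.algebraMap_eq_smul_one,
      smul_mul_assoc, one_mul, LinearMap.smul_apply, Pi.smul_apply, smul_eq_mul, lp.coeFn_single]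

/-- The trace on the algebra generated by the adjacency operator. -/
theorem exists_spectralTrace [Infinite V] (hS : S.IsSelfSimilar) {d : ℕ}
    (h : ∀ v, X.degree v ≤ d) :
    ∃ τ : C(Set.Icc (-(d : ℝ)) d, ℂ) →L[ℂ] ℂ, ∀ g,
      Tendsto (S.normalizedTrace (adjacencyCalculus hd h g)) atTop (𝓝 (τ g)) := by
  have hΦ : ∀ g, ‖adjacencyCalculus hd h g‖ ≤ ‖g‖ := fun g =>
    NonUnitalStarAlgHom.norm_apply_le (adjacencyCalculus hd h) g
  have hle : ∀ n T, ‖S.normalizedTraceL n T‖ ≤ ‖T‖ := fun n T => by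
    simpa using (S.normalizedTraceL n).le_of_opNorm_le (S.normalizedTraceL_norm_le n) T
  have key : ∀ g, ∃ L, Tendsto (S.normalizedTrace (adjacencyCalculus hd h g)) atTop (𝓝 L) := by
    intro g
    refine cauchySeq_tendsto_of_complete (Metric.cauchySeq_iff'.2 fun ε hε => ?_)
    -- The normalized traces have norm at most `1` for every `n`, so replacing `g` by a polynomial
    -- costs at most `ε / 3` uniformly in `n`.
    obtain ⟨p, hp⟩ := exists_polynomial_near_complex d g (ε := ε / 3) (by positivity)
    obtain ⟨L, hL⟩ := exists_tendsto_normalizedTrace_aeval (hd := hd) hS p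
    obtain ⟨N, hN⟩ := Metric.cauchySeq_iff'.1 hL.cauchySeq (ε / 3) (by positivity)
    refine ⟨N, fun n hn => ?_⟩
    have hclose : ∀ n, dist (S.normalizedTrace (adjacencyCalculus hd h g) n)
        (S.normalizedTrace (Polynomial.aeval (adjacencyOp X hd) p) n) < ε / 3 := by
      intro n
      rw [dist_comm, dist_eq_norm, ← normalizedTraceL_apply, ← normalizedTraceL_apply, ← map_sub,
        ← adjacencyCalculus_aeval h, ← map_sub]
      exact ((hle _ _).trans (hΦ _)).trans_lt hp
    have h1 := hclose n
    have h2 := hclose N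
    have h3 := hN n hn
    rw [dist_comm] at h2
    have h4 := dist_triangle4 (S.normalizedTrace (adjacencyCalculus hd h g) n)
      (S.normalizedTrace (Polynomial.aeval (adjacencyOp X hd) p) n)
      (S.normalizedTrace (Polynomial.aeval (adjacencyOp X hd) p) N)
      (S.normalizedTrace (adjacencyCalculus hd h g) N)
    linarith
  choose τ hτ using key
  refine ⟨LinearMap.mkContinuous
    { toFun := τ
      map_add' := fun f g => ?_
      map_smul' := fun c g => ?_ } 1 ?_, hτ⟩
  · refine tendsto_nhds_unique (hτ (f + g)) (((hτ f).add (hτ g)).congr fun n => ?_)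
    simp only [← normalizedTraceL_apply, map_add]
  · refine tendsto_nhds_unique (hτ (c • g)) (((hτ g).const_smul c).congr fun n => ?_)
    simp only [← normalizedTraceL_apply, map_smul]
  · intro g
    rw [one_mul]
    exact le_of_tendsto' (hτ g).norm fun n => (hle n _).trans (hΦ g)

end GraphTower

end

noncomputable section

/-! The determinant of the deformed Laplacian -/

/-- The spectral parameter `1 + q u² - u x` of the deformed Laplacian. -/
def spectralFactor (q : ℕ) (u x : ℂ) : ℂ := 1 + q * u ^ 2 - u * x

/-- The sets removed in `Ω` are dictated by this. For a zero `u` that is not real, the imaginary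
part gives `x = 2 q Re u` and the real part then `|u|² = 1 / q`. For a real zero, `|x| ≤ q + 1`
gives `(q|u| - 1)(|u| - 1) ≤ 0`, that is, `1 / q ≤ |u| ≤ 1`. -/
theorem spectralFactor_ne_zero {q : ℕ} (hq : 0 < q) {u : ℂ} (hu : u ∈ domainΩ q) {x : ℝ}
    (hx : x ∈ Set.Icc (-((q + 1 : ℕ) : ℝ)) ((q + 1 : ℕ) : ℝ)) : spectralFactor q u x ≠ 0 := by
  intro h0
  have hq' : (0 : ℝ) < q := by exact_mod_cast hq
  rw [domainΩ, Set.mem_compl_iff, Set.mem_union, not_or] at hu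
  obtain ⟨hu1, hu2⟩ := hu
  simp only [Set.mem_ofPred_eq] at hu1 hu2
  have hre := congrArg Complex.re h0
  have him := congrArg Complex.im h0
  simp only [spectralFactor, sq, Complex.sub_re, Complex.add_re, Complex.one_re, Complex.mul_re,
    Complex.natCast_re, Complex.natCast_im, Complex.ofReal_re, Complex.ofReal_im, Complex.zero_re,
    Complex.sub_im, Complex.add_im, Complex.one_im, Complex.mul_im, Complex.zero_im] at hre him
  push_cast at hx
  rw [Complex.sq_norm, Complex.normSq_apply] at hu1
  obtain ⟨a, b⟩ := u
  simp only at *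
  have hb : b = 0 := by
    by_contra hb
    have h1 : x = 2 * q * a := by
      have : b * (2 * q * a - x) = 0 := by linarith
      rcases mul_eq_zero.1 this with h | h
      · exact absurd h hb
      · linarith
    apply hu1
    rw [eq_div_iff hq'.ne']
    rw [h1] at hre
    linarith
  subst hb
  apply hu2
  refine ⟨rfl, ?_⟩
  have h2 : 1 + q * a ^ 2 = a * x := by linarith
  have h3 : 1 + q * |a| ^ 2 ≤ |a| * (q + 1) := by
    rw [sq_abs, h2]
    refine (le_abs_self _).trans ?_
    rw [abs_mul]
    exact mul_le_mul_of_nonneg_left (abs_le.2 ⟨by linarith [hx.1], hx.2⟩) (abs_nonneg _)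
  have hq1 : (1 : ℝ) ≤ q := by exact_mod_cast hq
  have h4 : (q * |a| - 1) * (|a| - 1) ≤ 0 := by nlinarith
  have ha := abs_nonneg a
  constructor
  · rw [div_le_iff₀ hq']
    by_contra! hc
    have : |a| < 1 := by nlinarith
    nlinarith
  · by_contra! hc
    have : 1 < q * |a| := by nlinarith
    nlinarith

section Det

variable {V : Type*} {X : SimpleGraph V} [X.LocallyFinite]
  {hd : ∃ d : ℕ, ∀ v, X.degree v ≤ d} {q : ℕ}

theorem deformedLaplacian_eq_cfc (u : ℂ) :
    deformedLaplacian X hd q u = cfc (spectralFactor q u) (adjacencyOp X hd) := by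
  have : spectralFactor q u = fun x => (1 + q * u ^ 2) - u * x := rfl
  rw [this, cfc_sub _ _ (adjacencyOp X hd), cfc_const _ (adjacencyOp X hd),
    cfc_const_mul_id _ (adjacencyOp X hd), deformedLaplacian, Algebra.algebraMap_eq_smul_one]

theorem continuous_spectralFactor (u : ℂ) : Continuous (spectralFactor q u) := by
  unfold spectralFactor
  fun_prop

theorem spectrum_deformedLaplacian (u : ℂ) :
    spectrum ℂ (deformedLaplacian X hd q u) =
      spectralFactor q u '' spectrum ℂ (adjacencyOp X hd) := by
  rw [deformedLaplacian_eq_cfc]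
  exact cfc_map_spectrum _ _ (adjacencyOp_isStarNormal hd)
    (continuous_spectralFactor u).continuousOn

/-- The spectral parameter is affine in `x`, so the image is a segment. It then contains the convex
hull of the spectrum, not just the spectrum. -/
theorem convex_spectralFactor_image (u : ℂ) (a b : ℝ) :
    Convex ℝ ((fun x : ℝ => spectralFactor q u x) '' Set.Icc a b) := by
  rintro _ ⟨x, hx, rfl⟩ _ ⟨y, hy, rfl⟩ s t hs ht hst
  refine ⟨s * x + t * y, convex_Icc a b hx hy hs ht hst, ?_⟩
  have hst' : (s : ℂ) + t = 1 := by exact_mod_cast hst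
  simp only [spectralFactor, Complex.real_smul]
  push_cast
  linear_combination (-(1 + (q : ℂ) * u ^ 2)) * hst'

theorem zero_notMem_convexHull (h : ∀ v, X.degree v ≤ q + 1) (hq : 0 < q) {u : ℂ}
    (hu : u ∈ domainΩ q) :
    (0 : ℂ) ∉ convexHull ℝ (spectrum ℂ (deformedLaplacian X hd q u)) := by
  intro h0
  have hsub : convexHull ℝ (spectrum ℂ (deformedLaplacian X hd q u)) ⊆
      (fun x : ℝ => spectralFactor q u x) ''
        Set.Icc (-((q + 1 : ℕ) : ℝ)) ((q + 1 : ℕ) : ℝ) := by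
    refine convexHull_min ?_ (convex_spectralFactor_image u _ _)
    rw [spectrum_deformedLaplacian]
    rintro _ ⟨z, hz, rfl⟩
    obtain ⟨h1, h2⟩ := mem_spectrum_adjacencyOp h hz
    exact ⟨z.re, h2, by rw [h1]; rfl⟩
  obtain ⟨x, hx, hx0⟩ := hsub h0
  exact spectralFactor_ne_zero hq hu hx hx0

/-- A continuous logarithm of `1 + q u² - u x` for `|x| ≤ q + 1`. -/
def IsSpectralLog (q : ℕ) (u : ℂ)
    (g : C(Set.Icc (-((q + 1 : ℕ) : ℝ)) ((q + 1 : ℕ) : ℝ), ℂ)) : Prop :=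
  ∀ x, Complex.exp (g x) = spectralFactor q u (x : ℝ)

/-- The compact segment of values misses `0`, hence lies in a disc on which a branch of the
logarithm exists. -/
theorem exists_isSpectralLog (hq : 0 < q) {u : ℂ} (hu : u ∈ domainΩ q) :
    ∃ g, IsSpectralLog q u g := by
  have hcont : Continuous fun x : ℝ => spectralFactor q u x :=
    (continuous_spectralFactor u).comp Complex.continuous_ofReal
  obtain ⟨⟨c, r⟩, hr0, hr, hsub⟩ := exists_disc
    ((isCompact_Icc (a := -((q + 1 : ℕ) : ℝ)) (b := ((q + 1 : ℕ) : ℝ))).image hcont) (by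
      rw [(convex_spectralFactor_image u _ _).convexHull_eq]
      rintro ⟨x, hx, hx0⟩
      exact spectralFactor_ne_zero hq hu hx hx0)
  rw [(convex_spectralFactor_image u _ _).convexHull_eq] at hsub
  have hmem : ∀ x : Set.Icc (-((q + 1 : ℕ) : ℝ)) ((q + 1 : ℕ) : ℝ),
      spectralFactor q u (x : ℝ) ∈ Metric.closedBall c r := fun x =>
    Metric.ball_subset_closedBall (hsub ⟨x, x.2, rfl⟩)
  refine ⟨⟨fun x => logBranch c (spectralFactor q u (x : ℝ)), ?_⟩, fun x => ?_⟩
  · exact (differentiableOn_logBranch hr).continuousOn.comp_continuous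
      (hcont.comp continuous_subtype_val) hmem
  · refine exp_logBranch ?_ (ne_zero_of_mem_closedBall hr (hmem x))
    exact norm_pos_iff.1 (hr0.trans hr)

/-- Continuous logarithms on an interval differ by a multiple of `2πi`. -/
theorem exists_int_of_exp_eq {s : Set ℝ} (hs : IsPreconnected s) {f g : ℝ → ℂ}
    (hf : ContinuousOn f s) (hg : ContinuousOn g s)
    (h : ∀ x ∈ s, Complex.exp (f x) = Complex.exp (g x)) :
    ∃ k : ℤ, ∀ x ∈ s, f x = g x + k * (2 * Real.pi * Complex.I) := by
  rcases s.eq_empty_or_nonempty with rfl | ⟨x₀, hx₀⟩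
  · exact ⟨0, by simp⟩
  have h' : ∀ x, ∃ k : ℤ, x ∈ s → f x = g x + k * (2 * Real.pi * Complex.I) := by
    intro x
    by_cases hx : x ∈ s
    · obtain ⟨k, hk⟩ := Complex.exp_eq_exp_iff_exists_int.1 (h x hx)
      exact ⟨k, fun _ => hk⟩
    · exact ⟨0, fun hx' => absurd hx' hx⟩
  choose k hk using h'
  have hkc : ContinuousOn (fun x => (k x : ℝ)) s := by
    have : ContinuousOn (fun x => ((f x - g x) / (2 * Real.pi * Complex.I)).re) s :=
      Complex.continuous_re.comp_continuousOn ((hf.sub hg).div_const _)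
    refine this.congr fun x hx => ?_
    beta_reduce
    rw [hk x hx, add_sub_cancel_left, mul_div_cancel_right₀ _ Complex.two_pi_I_ne_zero]
    simp
  -- Being continuous and integer-valued, `k` is constant on the preconnected set.
  have hkc' : ContinuousOn k s :=
    (Int.isClosedEmbedding_coe_real.isInducing.continuousOn_iff).2 hkc
  exact ⟨k x₀, fun x hx => by rw [hk x hx, hs.constant hkc' hx hx₀]⟩

/-- Both sides exponentiate to the spectral parameter on the spectrum; what has to be excluded is
that the multiple of `2πi` varies from one spectral point to another. -/
theorem exists_analyticLog_eq (h : ∀ v, X.degree v ≤ q + 1) {u : ℂ}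
    (h0 : (0 : ℂ) ∉ convexHull ℝ (spectrum ℂ (deformedLaplacian X hd q u)))
    {g : C(Set.Icc (-((q + 1 : ℕ) : ℝ)) ((q + 1 : ℕ) : ℝ), ℂ)} (hg : IsSpectralLog q u g) :
    ∃ k : ℤ, analyticLog (deformedLaplacian X hd q u) =
      adjacencyCalculus hd h (g + (k * (2 * Real.pi * Complex.I) : ℂ) • 1) := by
  have hN : IsStarNormal (deformedLaplacian X hd q u) := by
    rw [deformedLaplacian_eq_cfc]
    exact cfc_predicate _ _
  obtain ⟨c, r, hr, hsp, hlog⟩ := exists_analyticLog_eq_cfc (deformedLaplacian X hd q u) h0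
  have hab : -((q + 1 : ℕ) : ℝ) ≤ ((q + 1 : ℕ) : ℝ) := by
    have : (0 : ℝ) ≤ ((q + 1 : ℕ) : ℝ) := by positivity
    linarith
  have hcont : Continuous fun x : ℝ => spectralFactor q u x :=
    (continuous_spectralFactor u).comp Complex.continuous_ofReal
  -- The disc behind `analyticLog` contains the convex hull of the spectrum but perhaps not the
  -- whole segment. The logarithms are compared on the part of the interval mapped into the disc; it
  -- is convex and contains the spectrum.
  let s : Set ℝ := Set.Icc (-((q + 1 : ℕ) : ℝ)) ((q + 1 : ℕ) : ℝ) ∩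
    (fun x : ℝ => spectralFactor q u x) ⁻¹' Metric.ball c r
  have hs : Convex ℝ s := by
    intro x hx y hy a b ha hb hab
    refine ⟨convex_Icc _ _ hx.1 hy.1 ha hb hab, ?_⟩
    have hab' : (a : ℂ) + b = 1 := by exact_mod_cast hab
    have e : spectralFactor q u ((a • x + b • y : ℝ) : ℂ) =
        a • spectralFactor q u x + b • spectralFactor q u y := by
      simp only [spectralFactor, Complex.real_smul, smul_eq_mul]
      push_cast
      linear_combination (-(1 + (q : ℂ) * u ^ 2)) * hab'
    simp only [Set.mem_preimage]
    rw [e]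
    exact convex_ball c r hx.2 hy.2 ha hb hab
  have hcs : ContinuousOn (fun x : ℝ => logBranch c (spectralFactor q u x)) s :=
    (differentiableOn_logBranch hr).continuousOn.comp hcont.continuousOn
      fun x hx => Metric.ball_subset_closedBall hx.2
  have hgs : Continuous (Set.IccExtend hab g) := g.continuous.Icc_extend'
  obtain ⟨k, hk⟩ := exists_int_of_exp_eq hs.isPreconnected hcs hgs.continuousOn (by
    intro x hx
    rw [Set.IccExtend_of_mem hab g hx.1, hg]
    refine exp_logBranch ?_ (ne_zero_of_mem_closedBall hr (Metric.ball_subset_closedBall hx.2))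
    refine norm_pos_iff.1 (lt_of_le_of_lt ?_ hr)
    exact (dist_nonneg.trans_lt hx.2).le)
  refine ⟨k, ?_⟩
  have hspA : ∀ z ∈ spectrum ℂ (adjacencyOp X hd), spectralFactor q u z ∈ Metric.ball c r := by
    intro z hz
    refine hsp ?_
    rw [spectrum_deformedLaplacian]
    exact ⟨z, hz, rfl⟩
  have hLc : ContinuousOn (logBranch c) (spectralFactor q u '' spectrum ℂ (adjacencyOp X hd)) := by
    refine (differentiableOn_logBranch hr).continuousOn.mono ?_
    rintro _ ⟨z, hz, rfl⟩
    exact Metric.ball_subset_closedBall (hspA z hz)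
  rw [hlog, deformedLaplacian_eq_cfc, ← cfc_comp (logBranch c) (spectralFactor q u)
    (adjacencyOp X hd) (adjacencyOp_isStarNormal hd) hLc (continuous_spectralFactor u).continuousOn]
  refine cfc_adjacencyOp h (hLc.comp (continuous_spectralFactor u).continuousOn
    (Set.mapsTo_image _ _)) fun z hz hzm => ?_
  have hzre := (mem_spectrum_adjacencyOp h hz).1
  have hzs : z.re ∈ s := ⟨hzm, by
    simp only [Set.mem_preimage]
    rw [← hzre]
    exact hspA z hz⟩
  have := hk z.re hzs
  rw [Set.IccExtend_of_mem hab g hzm, ← hzre] at this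
  simp only [Function.comp, ContinuousMap.add_apply, ContinuousMap.smul_apply,
    ContinuousMap.one_apply, smul_eq_mul, mul_one]
  exact this

end Det

/-- The trace functional on continuous functions of the adjacency operator. -/
def GraphTower.IsSpectralTrace {V : Type*} {X : SimpleGraph V} [X.LocallyFinite]
    (S : GraphTower X) (hd : ∃ d : ℕ, ∀ v, X.degree v ≤ d) {d : ℕ} (h : ∀ v, X.degree v ≤ d)
    (τ : C(Set.Icc (-(d : ℝ)) d, ℂ) →L[ℂ] ℂ) : Prop :=
  ∀ g, Tendsto (S.normalizedTrace (adjacencyCalculus hd h g)) atTop (𝓝 (τ g))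

namespace GraphTower.IsSpectralTrace

variable {V : Type*} {X : SimpleGraph V} [X.LocallyFinite] {S : GraphTower X}
  {hd : ∃ d : ℕ, ∀ v, X.degree v ≤ d}

theorem map_one [Infinite V] (hS : S.IsSelfSimilar) {d : ℕ} {h : ∀ v, X.degree v ≤ d}
    {τ : C(Set.Icc (-(d : ℝ)) d, ℂ) →L[ℂ] ℂ} (hτ : S.IsSpectralTrace hd h τ) : τ 1 = 1 := by
  classical
  have h1 := hτ 1
  rw [_root_.map_one, tendsto_normalizedTrace_iff] at h1
  refine h1.unique ?_
  convert hasAverage_const hS 1 using 2 with v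
  simp

variable {q : ℕ} {h : ∀ v, X.degree v ≤ q + 1}
  {τ : C(Set.Icc (-((q + 1 : ℕ) : ℝ)) ((q + 1 : ℕ) : ℝ), ℂ) →L[ℂ] ℂ} {u : ℂ}
  {g : C(Set.Icc (-((q + 1 : ℕ) : ℝ)) ((q + 1 : ℕ) : ℝ), ℂ)}

theorem tendsto_analyticLog (hτ : S.IsSpectralTrace hd h τ) (hq : 0 < q) (hu : u ∈ domainΩ q) :
    Tendsto (S.normalizedTrace (analyticLog (deformedLaplacian X hd q u))) atTop
      (𝓝 (S.trace (analyticLog (deformedLaplacian X hd q u)))) := by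
  obtain ⟨g, hg⟩ := exists_isSpectralLog hq hu
  obtain ⟨k, hk⟩ := exists_analyticLog_eq (hd := hd) h (zero_notMem_convexHull h hq hu) hg
  rw [trace, hk, (hτ _).limUnder_eq]
  exact hτ _

/-- Since `τ 1 = 1`, the multiple of `2πi` disappears in the exponential. The determinant can thus
be computed with any convenient continuous logarithm. -/
theorem det_eq [Infinite V] (hS : S.IsSelfSimilar) (hτ : S.IsSpectralTrace hd h τ) (hq : 0 < q)
    (hu : u ∈ domainΩ q) (hg : IsSpectralLog q u g) :
    S.det (deformedLaplacian X hd q u) = Complex.exp (τ g) := by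
  obtain ⟨k, hk⟩ := exists_analyticLog_eq (hd := hd) h (zero_notMem_convexHull h hq hu) hg
  rw [det, trace, hk, (hτ _).limUnder_eq, map_add, map_smul, hτ.map_one hS, smul_eq_mul, mul_one,
    Complex.exp_add, Complex.exp_int_mul_two_pi_mul_I, mul_one]

end GraphTower.IsSpectralTrace

theorem inv_mem_domainΩ {q : ℕ} (hq : 0 < q) {u : ℂ} (hu : u ∈ domainΩ q) (h0 : u ≠ 0) :
    1 / (q * u) ∈ domainΩ q := by
  have hq' : (0 : ℝ) < q := by exact_mod_cast hq
  rw [domainΩ, Set.mem_compl_iff, Set.mem_union, not_or] at hu ⊢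
  obtain ⟨hu1, hu2⟩ := hu
  simp only [Set.mem_ofPred_eq] at hu1 hu2 ⊢
  have hn : 0 < ‖u‖ := norm_pos_iff.2 h0
  constructor
  · intro hh
    apply hu1
    rw [norm_div, norm_one, norm_mul, Complex.norm_natCast] at hh
    field_simp at hh ⊢
    linarith
  · rintro ⟨h1, h2, h3⟩
    apply hu2
    have e : u = 1 / (q * (1 / (q * u))) := by
      have : (q : ℂ) ≠ 0 := by exact_mod_cast hq.ne'
      field_simp
    set w := 1 / (q * u) with hw
    have hwre : w = (w.re : ℂ) := Complex.ext rfl (by simpa using h1)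
    have hur : u = ((1 / (q * w.re) : ℝ) : ℂ) := by
      rw [e, hwre]
      push_cast
      simp
    have hpos : 0 < |w.re| := lt_of_lt_of_le (by positivity) h2
    rw [hur, Complex.ofReal_im, Complex.ofReal_re, abs_div, abs_one, abs_mul, Nat.abs_cast]
    refine ⟨rfl, ?_, ?_⟩
    · exact one_div_le_one_div_of_le (by positivity) (by nlinarith)
    · rw [div_le_one (by positivity)]
      rwa [div_le_iff₀' hq'] at h2

theorem isOpen_domainΩ (q : ℕ) : IsOpen (domainΩ q) := by
  refine IsClosed.isOpen_compl (self := IsClosed.union ?_ ?_)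
  · exact isClosed_eq (continuous_norm.pow 2) continuous_const
  · refine (isClosed_eq Complex.continuous_im continuous_const).inter
      ((isClosed_le continuous_const Complex.continuous_re.abs).inter
        (isClosed_le Complex.continuous_re.abs continuous_const))

namespace GraphTower.IsSpectralTrace

variable {V : Type*} {X : SimpleGraph V} [X.LocallyFinite] {S : GraphTower X}
  {hd : ∃ d : ℕ, ∀ v, X.degree v ≤ d}
variable {q : ℕ} {h : ∀ v, X.degree v ≤ q + 1}
  {τ : C(Set.Icc (-((q + 1 : ℕ) : ℝ)) ((q + 1 : ℕ) : ℝ), ℂ) →L[ℂ] ℂ} {u : ℂ}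

/-- For `v = 1 / (q u)` the spectral parameter at `v` is `(q u²)⁻¹` times that at `u`, for every
`x`. A logarithm at `u` plus a constant is therefore one at `v`, and `τ 1 = 1`; the branch chosen
for the constant does not matter. -/
theorem det_inv [Infinite V] (hS : S.IsSelfSimilar) (hτ : S.IsSpectralTrace hd h τ) (hq : 0 < q)
    (hu : u ∈ domainΩ q) (h0 : u ≠ 0) :
    S.det (deformedLaplacian X hd q (1 / (q * u))) =
      (q * u ^ 2)⁻¹ * S.det (deformedLaplacian X hd q u) := by
  obtain ⟨g, hg⟩ := exists_isSpectralLog hq hu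
  have hq0 : (q : ℂ) ≠ 0 := by exact_mod_cast hq.ne'
  have hc : (q * u ^ 2 : ℂ)⁻¹ ≠ 0 := inv_ne_zero (mul_ne_zero hq0 (pow_ne_zero 2 h0))
  have hg' : IsSpectralLog q (1 / (q * u)) (g + Complex.log (q * u ^ 2 : ℂ)⁻¹ • 1) := by
    intro x
    simp only [ContinuousMap.add_apply, ContinuousMap.smul_apply, ContinuousMap.one_apply,
      smul_eq_mul, mul_one]
    rw [Complex.exp_add, hg, Complex.exp_log hc, spectralFactor, spectralFactor]
    field_simp
    ring
  rw [hτ.det_eq hS hq hu hg, hτ.det_eq hS hq (inv_mem_domainΩ hq hu h0) hg', map_add, map_smul,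
    hτ.map_one hS, smul_eq_mul, mul_one, Complex.exp_add, Complex.exp_log hc, mul_comm]

/-- Near `u₀` the spectral parameter is multiplied by `1 + E u` with `E u` small in the sup norm, so
`g + log (1 + E u)` is a logarithm at `u`. Its image under `τ` is `τ g + (u - u₀) τ a + O(|u -
u₀|²)`. -/
theorem differentiableOn_det [Infinite V] (hS : S.IsSelfSimilar) (hτ : S.IsSpectralTrace hd h τ)
    (hq : 0 < q) :
    DifferentiableOn ℂ (fun u => S.det (deformedLaplacian X hd q u)) (domainΩ q) := by
  intro u₀ hu₀
  refine DifferentiableAt.differentiableWithinAt ?_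
  obtain ⟨g, hg⟩ := exists_isSpectralLog hq hu₀
  -- `w` is the reciprocal of the spectral parameter at `u₀`. The functions `a` and `b` are `w`
  -- times the coefficients of `u - u₀` and `(u - u₀)²` in the Taylor expansion of the spectral
  -- parameter at `u₀`.
  let w : C(Set.Icc (-((q + 1 : ℕ) : ℝ)) ((q + 1 : ℕ) : ℝ), ℂ) :=
    ⟨fun x => Complex.exp (-g x), Complex.continuous_exp.comp g.continuous.neg⟩
  let a := ((2 * q * u₀ : ℂ) • 1 - ofRealMap (q + 1)) * w
  let b := (q : ℂ) • w
  let E : ℂ → C(Set.Icc (-((q + 1 : ℕ) : ℝ)) ((q + 1 : ℕ) : ℝ), ℂ) := fun u =>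
    (u - u₀) • a + (u - u₀) ^ 2 • b
  have hE : ∀ (u : ℂ) (x : Set.Icc (-((q + 1 : ℕ) : ℝ)) ((q + 1 : ℕ) : ℝ)),
      spectralFactor q u₀ (x : ℝ) * (1 + E u x) = spectralFactor q u (x : ℝ) := by
    intro u x
    have h1 : spectralFactor q u₀ (x : ℝ) * Complex.exp (-g x) = 1 := by
      rw [← hg, ← Complex.exp_add, add_neg_cancel, Complex.exp_zero]
    have h2 : E u x = ((u - u₀) * (2 * q * u₀ - (x : ℝ)) + (u - u₀) ^ 2 * q) *
        Complex.exp (-g x) := by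
      simp only [E, a, b, w, ofRealMap, ContinuousMap.add_apply, ContinuousMap.smul_apply,
        ContinuousMap.mul_apply, ContinuousMap.sub_apply, ContinuousMap.one_apply,
        ContinuousMap.coe_mk, smul_eq_mul]
      ring
    rw [h2]
    calc _ = spectralFactor q u₀ (x : ℝ) + ((u - u₀) * (2 * q * u₀ - (x : ℝ)) +
          (u - u₀) ^ 2 * q) * (spectralFactor q u₀ (x : ℝ) * Complex.exp (-g x)) := by ring
      _ = _ := by
          rw [h1]
          simp only [spectralFactor]
          ring
  have hE0 : Tendsto E (𝓝 u₀) (𝓝 0) := by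
    have : Continuous E := by
      simp only [E]
      fun_prop
    have h1 := this.tendsto u₀
    have h2 : E u₀ = 0 := by
      have h3 : (u₀ - u₀) • a + (u₀ - u₀) ^ 2 • b = 0 := by
        ext x
        simp only [ContinuousMap.add_apply, ContinuousMap.smul_apply, sub_self, smul_eq_mul,
          zero_mul, zero_pow two_ne_zero, add_zero, ContinuousMap.zero_apply]
      exact h3
    rwa [h2] at h1
  have hsmall : ∀ᶠ u in 𝓝 u₀, ‖E u‖ ≤ 1 / 2 := by
    have := hE0.norm
    rw [norm_zero] at this
    exact this.eventually (ge_mem_nhds (by norm_num))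
  have key : ∀ u, ∃ l : ℂ, u ∈ domainΩ q → ‖E u‖ ≤ 1 / 2 →
      S.det (deformedLaplacian X hd q u) = Complex.exp (τ g) * Complex.exp l ∧
      ‖l - (u - u₀) * τ a‖ ≤ ‖τ‖ * (‖E u‖ ^ 2 + ‖u - u₀‖ ^ 2 * ‖b‖) := by
    intro u
    by_cases hu : u ∈ domainΩ q ∧ ‖E u‖ ≤ 1 / 2
    swap
    · exact ⟨0, fun h1 h2 => absurd ⟨h1, h2⟩ hu⟩
    obtain ⟨hu, hs⟩ := hu
    have hx : ∀ x, ‖E u x‖ ≤ 1 / 2 := fun x => ((E u).norm_coe_le_norm x).trans hs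
    have hslit : ∀ x, 1 + E u x ∈ Complex.slitPlane := fun x =>
      Complex.mem_slitPlane_of_norm_lt_one ((hx x).trans_lt (by norm_num))
    let l : C(Set.Icc (-((q + 1 : ℕ) : ℝ)) ((q + 1 : ℕ) : ℝ), ℂ) :=
      ⟨fun x => Complex.log (1 + E u x), by
        rw [continuous_iff_continuousAt]
        intro x
        exact (continuousAt_const.add (E u).continuous.continuousAt).clog (hslit x)⟩
    have hl : IsSpectralLog q u (g + l) := by
      intro x
      rw [ContinuousMap.add_apply, Complex.exp_add, hg]
      simp only [l, ContinuousMap.coe_mk]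
      rw [Complex.exp_log (Complex.slitPlane_ne_zero (hslit x)), hE]
    refine ⟨τ l, fun _ _ => ⟨?_, ?_⟩⟩
    · rw [hτ.det_eq hS hq hu hl, map_add, Complex.exp_add]
    · rw [← smul_eq_mul, ← map_smul, ← map_sub]
      refine (τ.le_opNorm _).trans ?_
      gcongr
      rw [ContinuousMap.norm_le _ (by positivity)]
      intro x
      have h1 := Complex.norm_log_one_add_sub_self_le (z := E u x)
        ((hx x).trans_lt (by norm_num))
      have h2 : ‖Complex.log (1 + E u x) - E u x‖ ≤ ‖E u x‖ ^ 2 := by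
        refine h1.trans ?_
        have h3 : (1 - ‖E u x‖)⁻¹ ≤ 2 := by
          rw [inv_le_comm₀ (by linarith [hx x]) (by norm_num)]
          linarith [hx x]
        have h4 : 0 ≤ ‖E u x‖ ^ 2 := by positivity
        nlinarith
      have h3 : l x - ((u - u₀) • a) x =
          (Complex.log (1 + E u x) - E u x) + (u - u₀) ^ 2 * b x := by
        simp only [l, E, ContinuousMap.coe_mk, ContinuousMap.add_apply, ContinuousMap.smul_apply,
          smul_eq_mul]
        ring
      rw [ContinuousMap.sub_apply, h3]
      refine (norm_add_le _ _).trans (add_le_add ?_ ?_)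
      · exact h2.trans (pow_le_pow_left₀ (norm_nonneg _) ((E u).norm_coe_le_norm x) 2)
      · rw [norm_mul, norm_pow]
        gcongr
        exact b.norm_coe_le_norm x
  choose l hl using key
  have hEle : ∀ u, ‖E u‖ ≤ ‖u - u₀‖ * (‖a‖ + ‖u - u₀‖ * ‖b‖) := by
    intro u
    refine (norm_add_le _ _).trans (le_of_eq ?_)
    rw [norm_smul, norm_smul, norm_pow]
    ring
  have hbound : ∀ᶠ u in 𝓝 u₀, ‖l u - (u - u₀) * τ a‖ ≤
      ‖τ‖ * ((‖a‖ + ‖b‖) ^ 2 + ‖b‖) * ‖u - u₀‖ ^ 2 := by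
    filter_upwards [hsmall, (isOpen_domainΩ q).mem_nhds hu₀, Metric.ball_mem_nhds u₀ one_pos]
      with u hu1 hu2 hu3
    rw [mem_ball_iff_norm] at hu3
    refine (hl u hu2 hu1).2.trans ?_
    have h1 : ‖E u‖ ≤ ‖u - u₀‖ * (‖a‖ + ‖b‖) := by
      refine (hEle u).trans ?_
      gcongr
      exact mul_le_of_le_one_left (norm_nonneg _) hu3.le
    calc ‖τ‖ * (‖E u‖ ^ 2 + ‖u - u₀‖ ^ 2 * ‖b‖)
        ≤ ‖τ‖ * ((‖u - u₀‖ * (‖a‖ + ‖b‖)) ^ 2 + ‖u - u₀‖ ^ 2 * ‖b‖) := by gcongr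
      _ = _ := by ring
  have hl0 : l u₀ = 0 := by
    have := hbound.self_of_nhds
    simpa using this
  have hderiv : HasDerivAt l (τ a) u₀ := by
    rw [hasDerivAt_iff_isLittleO, hl0]
    have h1 : (fun u => l u - 0 - (u - u₀) • τ a) =O[𝓝 u₀] fun u => ‖u - u₀‖ ^ 2 := by
      refine Asymptotics.IsBigO.of_bound (‖τ‖ * ((‖a‖ + ‖b‖) ^ 2 + ‖b‖)) ?_
      filter_upwards [hbound] with u hu
      rw [sub_zero, smul_eq_mul, norm_pow, norm_norm]
      exact hu
    refine h1.trans_isLittleO ?_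
    have h2 : (fun u : ℂ => ‖u - u₀‖ ^ 2) =o[𝓝 u₀] fun u => ‖u - u₀‖ ^ 1 :=
      (Asymptotics.isLittleO_pow_pow one_lt_two).comp_tendsto
        (by
          have h3 := (continuous_norm.comp (continuous_sub_right u₀)).tendsto u₀
          simp only [Function.comp_def, sub_self, norm_zero] at h3
          exact h3)
    simp only [pow_one] at h2
    exact h2.of_norm_right
  have hfin : (fun u => S.det (deformedLaplacian X hd q u)) =ᶠ[𝓝 u₀]
      fun u => Complex.exp (τ g) * Complex.exp (l u) := by
    filter_upwards [hsmall, (isOpen_domainΩ q).mem_nhds hu₀] with u hu1 hu2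
    exact (hl u hu2 hu1).1
  exact ((hderiv.cexp.const_mul _).differentiableAt).congr_of_eventuallyEq hfin

end GraphTower.IsSpectralTrace

end

/-! ### Chebyshev type polynomials -/

noncomputable section

open Polynomial in
/-- The polynomials `(α ^ m - β ^ m) / (α - β)` in `λ`, where `α + β = λ` and `α β = q`. -/
def secondKind (q : ℕ) : ℕ → ℂ[X]
  | 0 => 0
  | 1 => 1
  | m + 2 => X * secondKind q (m + 1) - (q : ℂ[X]) * secondKind q m

open Polynomial in
/-- The polynomials `α ^ m + β ^ m` in `λ`, where `α + β = λ` and `α β = q`. -/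
def firstKind (q : ℕ) : ℕ → ℂ[X]
  | 0 => 2
  | 1 => X
  | m + 2 => X * firstKind q (m + 1) - (q : ℂ[X]) * firstKind q m

open Polynomial in
-- With `T` and `U` for the two kinds, this is the difference of `T_{m+2} = X U_{m+2} - 2q U_{m+1}`
-- and `T_m = 2 U_{m+1} - X U_m`. The combination is the one that averaging `eventually_reducedDiag`
-- produces.
theorem firstKind_sub (q : ℕ) (m : ℕ) :
    firstKind q (m + 2) = X * secondKind q (m + 2) - 2 * (q + 1 : ℂ[X]) * secondKind q (m + 1) +
      X * secondKind q m + firstKind q m := by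
  induction m using Nat.twoStepInduction with
  | zero =>
    simp only [firstKind, secondKind]
    ring
  | one =>
    simp only [firstKind, secondKind]
    ring
  | more m h1 h2 =>
    have e1 : firstKind q (m + 2 + 2) =
      X * firstKind q (m + 1 + 2) - (q : ℂ[X]) * firstKind q (m + 2) := rfl
    have e2 : firstKind q (m + 2) = X * firstKind q (m + 1) - (q : ℂ[X]) * firstKind q m := rfl
    have e3 (k : ℕ) : secondKind q (k + 2) =
      X * secondKind q (k + 1) - (q : ℂ[X]) * secondKind q k := rfl
    linear_combination e1 + X * h2 - q * h1 - e2 - X * e3 (m + 2) + 2 * (q + 1) * e3 (m + 1) -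
      X * e3 m

/-! The operator of nonbacktracking steps on the darts -/

section Hashimoto

variable {V : Type*} (X : SimpleGraph V) [X.LocallyFinite]

/-- The darts with a given origin. -/
def outDarts (v : V) : Finset X.Dart :=
  Finset.univ.map ⟨X.dartOfNeighborSet v, X.dartOfNeighborSet_injective v⟩

variable {X}

theorem mem_outDarts {v : V} {e : X.Dart} : e ∈ outDarts X v ↔ e.fst = v := by
  simp only [outDarts, Finset.mem_map, Finset.mem_univ, true_and, Function.Embedding.coeFn_mk]
  constructor
  · rintro ⟨w, rfl⟩
    rfl
  · rintro rfl
    exact ⟨⟨e.snd, e.adj⟩, rfl⟩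

theorem sum_outDarts {M : Type*} [AddCommMonoid M] (v : V) (g : V → M) :
    ∑ e ∈ outDarts X v, g e.snd = ∑ w ∈ X.neighborFinset v, g w := by
  rw [outDarts, Finset.sum_map]
  simp only [Function.Embedding.coeFn_mk, SimpleGraph.dartOfNeighborSet]
  exact (Finset.sum_subtype (X.neighborFinset v) (fun w => X.mem_neighborFinset v w) g).symm

theorem card_outDarts (v : V) : (outDarts X v).card = X.degree v := by
  rw [outDarts, Finset.card_map, Finset.card_univ, X.card_neighborSet_eq_degree]

variable (X)

open Classical in
/-- The steps without backtracking. -/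
def nonbacktracking (e : X.Dart) : Finset X.Dart := (outDarts X e.snd).erase e.symm

/-- `f ↦ f ∘ snd`. -/
def pullSnd : (V → ℂ) →ₗ[ℂ] (X.Dart → ℂ) := LinearMap.funLeft ℂ ℂ fun e => e.snd

/-- `f ↦ f ∘ fst`. -/
def pullFst : (V → ℂ) →ₗ[ℂ] (X.Dart → ℂ) := LinearMap.funLeft ℂ ℂ fun e => e.fst

variable {X}

theorem mem_nonbacktracking {e f : X.Dart} :
    f ∈ nonbacktracking X e ↔ f.fst = e.snd ∧ f.snd ≠ e.fst := by
  classical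
  rw [nonbacktracking, Finset.mem_erase, mem_outDarts, and_comm]
  refine and_congr_right fun h => not_congr ?_
  constructor
  · rintro rfl
    rfl
  · intro h'
    ext
    · exact h
    · exact h'

theorem card_nonbacktracking (e : X.Dart) :
    (nonbacktracking X e).card = X.degree e.snd - 1 := by
  classical
  rw [nonbacktracking, Finset.card_erase_of_mem
    (show e.symm ∈ outDarts X e.snd from mem_outDarts.2 rfl), card_outDarts]

theorem stepOp_nonbacktracking (g : X.Dart → ℂ) (e : X.Dart) :
    stepOp (nonbacktracking X) g e = ∑ f ∈ outDarts X e.snd, g f - g e.symm := by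
  classical
  rw [stepOp_apply, nonbacktracking,
    ← Finset.add_sum_erase (outDarts X e.snd) g (mem_outDarts.2 (rfl : e.symm.fst = e.snd))]
  ring

/-- Together with `stepOp_nonbacktracking_pullFst`: functions of the form `f ∘ snd + g ∘ fst` are
preserved, and on them the operator is a two by two block matrix with entries `A`, `-1`, `deg - 1`
and `0`. This links walks on darts to the adjacency operator. -/
theorem stepOp_nonbacktracking_pullSnd (f : V → ℂ) :
    stepOp (nonbacktracking X) (pullSnd X f) =
      pullSnd X (stepOp (fun v => X.neighborFinset v) f) - pullFst X f := by
  funext e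
  rw [stepOp_nonbacktracking]
  exact congrArg₂ _ (sum_outDarts e.snd f) rfl

theorem stepOp_nonbacktracking_pullFst (f : V → ℂ) :
    stepOp (nonbacktracking X) (pullFst X f) =
      pullSnd X (fun v => ((X.degree v : ℂ) - 1) * f v) := by
  funext e
  rw [stepOp_nonbacktracking]
  have h : ∑ d ∈ outDarts X e.snd, pullFst X f d = ∑ d ∈ outDarts X e.snd, f e.snd :=
    Finset.sum_congr rfl fun d hd => congrArg f (mem_outDarts.1 hd)
  rw [h, Finset.sum_const, card_outDarts, nsmul_eq_mul]
  change (X.degree e.snd : ℂ) * f e.snd - f e.snd = (X.degree e.snd - 1) * f e.snd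
  ring

theorem stepOp_nonbacktracking_single [DecidableEq V] [DecidableEq X.Dart] (e : X.Dart) :
    stepOp (nonbacktracking X) (Pi.single e 1) =
      pullSnd X (Pi.single e.fst 1) - Pi.single e.symm 1 := by
  funext d
  rw [stepOp_nonbacktracking]
  simp only [Finset.sum_pi_single', mem_outDarts, Pi.sub_apply, pullSnd, LinearMap.funLeft_apply]
  congr 1
  · rw [Pi.single_apply]
    exact if_congr eq_comm rfl rfl
  · rw [Pi.single_apply, Pi.single_apply]
    refine if_congr ?_ rfl rfl
    constructor
    · rintro rfl
      exact (SimpleGraph.Dart.symm_symm _).symm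
    · rintro rfl
      exact SimpleGraph.Dart.symm_symm _

/-- One step turns the indicator of `e` into a pulled back function minus the indicator of the
reversed dart. A second step returns to `e`, whence the recursion in steps of two. -/
theorem stepOp_nonbacktracking_pow_single [DecidableEq V] [DecidableEq X.Dart] (m : ℕ)
    (e : X.Dart) :
    (stepOp (nonbacktracking X) ^ (m + 2)) (Pi.single e 1) =
      (stepOp (nonbacktracking X) ^ (m + 1)) (pullSnd X (Pi.single e.fst 1)) -
        (stepOp (nonbacktracking X) ^ m) (pullSnd X (Pi.single e.snd 1)) +
        (stepOp (nonbacktracking X) ^ m) (Pi.single e 1) := by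
  rw [pow_succ, Module.End.mul_apply, stepOp_nonbacktracking_single, map_sub, pow_succ,
    Module.End.mul_apply _ _ (Pi.single e.symm 1), stepOp_nonbacktracking_single e.symm, map_sub,
    SimpleGraph.Dart.symm_symm]
  rw [sub_sub_eq_add_sub, add_sub_right_comm]
  rfl

/-- The polynomial `p` of the adjacency operator, applied to the indicator function of `v`. -/
def polyKernel [DecidableEq V] (X : SimpleGraph V) [X.LocallyFinite] (p : Polynomial ℂ) (v : V) :
    V → ℂ :=
  Polynomial.aeval (stepOp fun v => X.neighborFinset v) p (Pi.single v 1)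

section PolyKernel

variable [DecidableEq V]

theorem polyKernel_one (v : V) : polyKernel X 1 v = Pi.single v 1 := by
  simp [polyKernel]

theorem polyKernel_zero (v : V) : polyKernel X 0 v = 0 := by
  simp [polyKernel]

theorem polyKernel_sub (p p' : Polynomial ℂ) (v : V) :
    polyKernel X (p - p') v = polyKernel X p v - polyKernel X p' v := by
  simp [polyKernel]

theorem polyKernel_natCast_mul (n : ℕ) (p : Polynomial ℂ) (v : V) :
    polyKernel X (n * p) v = (n : ℂ) • polyKernel X p v := by
  simp [polyKernel]
  rfl

theorem stepOp_single (v : V) :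
    stepOp (fun v => X.neighborFinset v) (Pi.single v 1) =
      ∑ w ∈ X.neighborFinset v, Pi.single w 1 := by
  funext x
  rw [stepOp_apply, Finset.sum_apply]
  have h : v ∈ X.neighborFinset x ↔ x ∈ X.neighborFinset v := by
    rw [SimpleGraph.mem_neighborFinset, SimpleGraph.mem_neighborFinset, SimpleGraph.adj_comm]
  simp only [Finset.sum_pi_single', Finset.sum_pi_single, h]

theorem polyKernel_X_mul (p : Polynomial ℂ) (v : V) :
    polyKernel X (Polynomial.X * p) v = ∑ w ∈ X.neighborFinset v, polyKernel X p w := by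
  rw [mul_comm]
  simp only [polyKernel, map_mul, Polynomial.aeval_X, Module.End.mul_apply]
  rw [stepOp_single, map_sum]

theorem polyKernel_X_mul_apply (p : Polynomial ℂ) (v w : V) :
    polyKernel X (Polynomial.X * p) v w = ∑ x ∈ X.neighborFinset w, polyKernel X p v x := by
  simp only [polyKernel, map_mul, Polynomial.aeval_X, Module.End.mul_apply]
  rfl

end PolyKernel

/-- By local finiteness, finitely many exceptional vertices have finitely many neighbours. -/
theorem eventually_neighbors {p : V → Prop} (h : ∀ᶠ v in cofinite, p v) :
    ∀ᶠ v in cofinite, ∀ w ∈ X.neighborFinset v, p w := by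
  rw [eventually_cofinite] at h ⊢
  refine (h.biUnion fun w _ => (X.neighborFinset w).finite_toSet).subset ?_
  intro v hv
  simp only [Set.mem_ofPred_eq, not_forall] at hv
  obtain ⟨w, hw, hpw⟩ := hv
  refine Set.mem_biUnion (x := w) hpw ?_
  rw [SimpleGraph.mem_neighborFinset] at hw
  simpa using hw.symm

/-- Where the degree is `q + 1`, two applications of the block matrix give the recursion `U_{a+2} =
X U_{a+1} - q U_a`. For each `a` only degrees at bounded distance from `v` are involved, so finitely
many `v` are lost, and averages do not see them. -/
theorem eventually_pow_pullSnd [DecidableEq V] {q : ℕ}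
    (hreg : {v | X.degree v ≠ q + 1}.Finite) (a : ℕ) :
    ∀ᶠ v in cofinite, (stepOp (nonbacktracking X) ^ a) (pullSnd X (Pi.single v 1)) =
      pullSnd X (polyKernel X (secondKind q (a + 1)) v) -
        pullFst X (polyKernel X (secondKind q a) v) := by
  induction a using Nat.twoStepInduction with
  | zero =>
    refine Eventually.of_forall fun v => ?_
    simp [secondKind, polyKernel_one, polyKernel_zero]
  | one =>
    refine Eventually.of_forall fun v => ?_
    rw [pow_one, stepOp_nonbacktracking_pullSnd]
    have h1 : secondKind q (1 + 1) = Polynomial.X := by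
      simp [secondKind]
    have h2 : secondKind q 1 = 1 := rfl
    rw [h1, h2, polyKernel_one, polyKernel, Polynomial.aeval_X]
  | more a h1 h2 =>
    have hreg' : ∀ᶠ v in cofinite, X.degree v = q + 1 := hreg
    filter_upwards [h1, eventually_neighbors (X := X) h2, hreg'] with v hv1 hv2 hv
    have e1 : (fun w => ((X.degree w : ℂ) - 1) * (Pi.single v 1 : V → ℂ) w) =
        (q : ℂ) • Pi.single v 1 := by
      funext w
      by_cases hw : w = v
      · subst hw
        simp [hv]
      · simp [hw]
    have e2 (k : ℕ) : secondKind q (k + 2) = Polynomial.X * secondKind q (k + 1) -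
      (q : Polynomial ℂ) * secondKind q k := rfl
    rw [pow_succ, Module.End.mul_apply, stepOp_nonbacktracking_pullSnd, map_sub, stepOp_single,
      map_sum, map_sum, Finset.sum_congr rfl hv2, pow_succ,
      Module.End.mul_apply _ _ (pullFst X _), stepOp_nonbacktracking_pullFst, e1, map_smul,
      map_smul, hv1, Finset.sum_sub_distrib, ← map_sum, ← map_sum, ← polyKernel_X_mul,
      ← polyKernel_X_mul, e2 (a + 1), e2 a, polyKernel_sub, polyKernel_sub,
      polyKernel_natCast_mul, polyKernel_natCast_mul, map_sub, map_sub, map_smul, map_smul,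
      smul_sub]
    abel

/-- The number of reduced closed paths of length `m` with origin `v`, as a sum of diagonal
entries. -/
def reducedDiag [DecidableEq X.Dart] (m : ℕ) (v : V) : ℂ :=
  ∑ e ∈ outDarts X v, (stepOp (nonbacktracking X) ^ m) (Pi.single e 1) e

theorem reducedDiag_zero [DecidableEq X.Dart] (v : V) : reducedDiag (X := X) 0 v = X.degree v := by
  simp [reducedDiag, card_outDarts]

theorem reducedDiag_one [DecidableEq X.Dart] (v : V) : reducedDiag (X := X) 1 v = 0 := by
  classical
  refine Finset.sum_eq_zero fun e _ => ?_
  rw [pow_one, stepOp_nonbacktracking_single]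
  have h1 : e ≠ e.symm := fun h => e.adj.ne (congrArg (fun d : X.Dart => d.fst) h)
  have h2 : e.snd ≠ e.fst := e.adj.ne'
  simp [pullSnd, LinearMap.funLeft_apply, h1, h2]

/-- The recursion for one dart `e`, read at `e` and summed over the `q + 1` darts leaving `v`. Sums
of matrix entries over neighbours become products with `X`, except for the sum of diagonal entries
at the neighbours, which is handled by averaging. -/
theorem eventually_reducedDiag [DecidableEq V] [DecidableEq X.Dart] {q : ℕ}
    (hreg : {v | X.degree v ≠ q + 1}.Finite) (m : ℕ) :
    ∀ᶠ v in cofinite, reducedDiag (X := X) (m + 2) v =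
      polyKernel X (Polynomial.X * secondKind q (m + 2)) v v -
        ((q + 1 : ℕ) : ℂ) * polyKernel X (secondKind q (m + 1)) v v -
        ∑ w ∈ X.neighborFinset v, polyKernel X (secondKind q (m + 1)) w w +
        polyKernel X (Polynomial.X * secondKind q m) v v + reducedDiag (X := X) m v := by
  have hreg' : ∀ᶠ v in cofinite, X.degree v = q + 1 := hreg
  filter_upwards [eventually_pow_pullSnd hreg (m + 1),
    eventually_neighbors (X := X) (eventually_pow_pullSnd hreg m), hreg'] with v h1 h2 hv
  have h3 : ∀ e ∈ outDarts X v, (stepOp (nonbacktracking X) ^ (m + 2)) (Pi.single e 1) e =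
      (fun w => polyKernel X (secondKind q (m + 2)) v w) e.snd -
        polyKernel X (secondKind q (m + 1)) v v -
        (fun w => polyKernel X (secondKind q (m + 1)) w w) e.snd +
        (fun w => polyKernel X (secondKind q m) w v) e.snd +
        (stepOp (nonbacktracking X) ^ m) (Pi.single e 1) e := by
    intro e he
    rw [mem_outDarts] at he
    have he' : e.snd ∈ X.neighborFinset v := by
      rw [SimpleGraph.mem_neighborFinset, ← he]
      exact e.adj
    rw [stepOp_nonbacktracking_pow_single, he, h1, h2 _ he']
    simp only [Pi.add_apply, Pi.sub_apply, pullSnd, pullFst, LinearMap.funLeft_apply, he]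
    ring
  rw [reducedDiag, Finset.sum_congr rfl h3]
  simp only [Finset.sum_add_distrib, Finset.sum_sub_distrib]
  rw [sum_outDarts v fun w => polyKernel X (secondKind q (m + 2)) v w,
    sum_outDarts v fun w => polyKernel X (secondKind q (m + 1)) w w,
    sum_outDarts v fun w => polyKernel X (secondKind q m) w v, ← polyKernel_X_mul_apply,
    Finset.sum_const, card_outDarts, hv, polyKernel_X_mul (secondKind q m), Finset.sum_apply,
    nsmul_eq_mul]
  rfl

/-- The reduced closed paths as closed sequences of darts. -/
theorem reducedSeq_through_ncard {m : ℕ} (hm : 0 < m) (v : V) :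
    {c | c ∈ reducedSeq X m ∧ c 0 = v}.ncard =
      ∑ e ∈ outDarts X v, (closedSeq (nonbacktracking X) m e).ncard := by
  classical
  rw [← Set.ncard_biUnion_eq_sum]
  rotate_left
  · exact fun e _ => closedSeq_finite _ hm e
  · intro e _ e' _ hne
    rw [Set.disjoint_left]
    rintro c ⟨-, -, h⟩ ⟨-, -, h'⟩
    exact hne (h.symm.trans h')
  symm
  refine Set.ncard_congr (fun c _ i => (c i).fst) ?_ ?_ ?_
  · intro c hc
    simp only [Set.mem_iUnion, exists_prop] at hc
    obtain ⟨e, he, h1, h2, h3⟩ := hc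
    simp only [mem_nonbacktracking] at h2
    refine ⟨⟨⟨fun i => by simp only [h1], fun i => ?_⟩, fun i => ?_⟩, ?_⟩
    · simp only
      rw [(h2 i).1]
      exact (c i).adj
    · have h4 := h2 (i - 1)
      rw [sub_add_cancel] at h4
      simp only
      rw [(h2 i).1]
      exact h4.2.symm
    · simp only
      rw [h3, mem_outDarts.1 he]
  · intro c c' hc hc' h
    simp only [Set.mem_iUnion, exists_prop] at hc hc'
    obtain ⟨e, he, h1, h2, h3⟩ := hc
    obtain ⟨e', he', h1', h2', h3'⟩ := hc'
    simp only [mem_nonbacktracking] at h2 h2'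
    funext i
    have h4 := congrFun h i
    have h5 := congrFun h (i + 1)
    rw [(h2 i).1, (h2' i).1] at h5
    exact SimpleGraph.Dart.ext _ _ (Prod.ext h4 h5)
  · rintro c ⟨⟨⟨h1, h2⟩, h3⟩, h4⟩
    refine ⟨fun i => ⟨(c i, c (i + 1)), h2 i⟩, ?_, rfl⟩
    simp only [Set.mem_iUnion, exists_prop]
    refine ⟨⟨(c 0, c (0 + 1)), h2 0⟩, mem_outDarts.2 h4, fun i => ?_, fun i => ?_, rfl⟩
    · have h5 := h1 (i + 1)
      rw [add_right_comm] at h5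
      exact SimpleGraph.Dart.ext _ _ (Prod.ext (h1 i) h5)
    · rw [mem_nonbacktracking]
      refine ⟨rfl, ?_⟩
      have h5 := h3 (i + 1)
      rw [add_sub_cancel_right] at h5
      exact h5.symm

theorem reducedDiag_eq [DecidableEq X.Dart] {m : ℕ} (hm : 0 < m) (v : V) :
    reducedDiag (X := X) m v = ({c | c ∈ reducedSeq X m ∧ c 0 = v}.ncard : ℂ) := by
  rw [reducedSeq_through_ncard hm, reducedDiag, Nat.cast_sum]
  exact Finset.sum_congr rfl fun e _ => closedSeq_ncard_eq _ hm e

theorem reducedSeq_through_ncard_le {q : ℕ} (h : ∀ v, X.degree v ≤ q + 1) {m : ℕ} (hm : 0 < m)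
    (v : V) : {c | c ∈ reducedSeq X m ∧ c 0 = v}.ncard ≤ (q + 1) * q ^ m := by
  rw [reducedSeq_through_ncard hm]
  refine (Finset.sum_le_card_nsmul _ _ (q ^ m) fun e _ => ?_).trans ?_
  · refine closedSeq_ncard_le _ (fun e => ?_) hm e
    rw [card_nonbacktracking]
    have := h e.snd
    omega
  · rw [card_outDarts, smul_eq_mul]
    exact Nat.mul_le_mul_right _ (h v)

end Hashimoto

end

noncomputable section

/-! The average number of reduced closed paths -/

namespace GraphTower

variable {V : Type*} {X : SimpleGraph V} [X.LocallyFinite] {S : GraphTower X}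

/-- Edges inside `K n` contribute symmetrically to both sums and cancel. What remains are edges
leaving `K n`, and these start on the frontier. -/
theorem sum_neighbors_sub (F : V → ℂ) {C : ℝ} (hC : ∀ v, ‖F v‖ ≤ C) {d : ℕ}
    (hd : ∀ v, X.degree v ≤ d) (n : ℕ) :
    ‖∑ v ∈ S.K n, ∑ w ∈ X.neighborFinset v, F w - ∑ v ∈ S.K n, X.degree v * F v‖ ≤
      (d * (2 * C)) * (vertexFrontier X (S.K n)).ncard := by
  classical
  have h1 : ∑ v ∈ S.K n, ∑ w ∈ X.neighborFinset v with w ∈ S.K n, F w =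
      ∑ w ∈ S.K n, ∑ v ∈ X.neighborFinset w with v ∈ S.K n, F w := by
    refine Finset.sum_comm' fun v w => ?_
    simp only [Finset.mem_filter, SimpleGraph.mem_neighborFinset, X.adj_comm v w]
    tauto
  have h2 : ∑ v ∈ S.K n, ∑ w ∈ X.neighborFinset v, F w - ∑ v ∈ S.K n, X.degree v * F v =
      ∑ v ∈ S.K n, ∑ w ∈ X.neighborFinset v with w ∉ S.K n, (F w - F v) := by
    have h3 : ∀ v, (X.degree v : ℂ) * F v = ∑ w ∈ X.neighborFinset v, F v := fun v => by
      rw [Finset.sum_const, SimpleGraph.card_neighborFinset_eq_degree, nsmul_eq_mul]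
    simp only [h3, Finset.sum_sub_distrib,
      ← Finset.sum_filter_add_sum_filter_not (X.neighborFinset _) (fun w => w ∈ S.K n) fun w => F w,
      ← Finset.sum_filter_add_sum_filter_not (X.neighborFinset _) (fun w => w ∈ S.K n) fun _ => F _,
      Finset.sum_add_distrib]
    rw [h1]
    ring
  have hC0 : ∀ v w, ‖F w - F v‖ ≤ 2 * C := fun v w =>
    (norm_sub_le _ _).trans (by linarith [hC v, hC w])
  rw [h2]
  have h4 : ∀ v ∈ S.K n, v ∉ (S.vertexFrontier_finite n).toFinset →
      ∑ w ∈ X.neighborFinset v with w ∉ S.K n, (F w - F v) = 0 := by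
    intro v hv hv'
    rw [Finset.sum_eq_zero]
    intro w hw
    rw [Finset.mem_filter, SimpleGraph.mem_neighborFinset] at hw
    exact absurd ((S.vertexFrontier_finite n).mem_toFinset.2 ⟨hv, w, hw.2, hw.1⟩) hv'
  rw [← Finset.sum_subset (s₁ := (S.vertexFrontier_finite n).toFinset)
    (fun v hv => ((S.vertexFrontier_finite n).mem_toFinset.1 hv).1) h4]
  refine (norm_sum_le _ _).trans ?_
  rw [Set.ncard_eq_toFinset_card _ (S.vertexFrontier_finite n), mul_comm, ← nsmul_eq_mul]
  refine Finset.sum_le_card_nsmul _ _ _ fun v _ => (norm_sum_le _ _).trans ?_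
  have hC' : 0 ≤ 2 * C := (norm_nonneg _).trans (hC0 v v)
  calc _ ≤ ∑ w ∈ X.neighborFinset v with w ∉ S.K n, 2 * C :=
        Finset.sum_le_sum fun w _ => hC0 v w
    _ ≤ ∑ w ∈ X.neighborFinset v, 2 * C :=
        Finset.sum_le_sum_of_subset_of_nonneg (Finset.filter_subset _ _) fun _ _ _ => hC'
    _ ≤ d * (2 * C) := by
        rw [Finset.sum_const, SimpleGraph.card_neighborFinset_eq_degree, nsmul_eq_mul]
        exact mul_le_mul_of_nonneg_right (by exact_mod_cast hd v) hC'

theorem HasAverage.sum_neighbors [Infinite V] (hS : S.IsSelfSimilar) {q d : ℕ}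
    (hd : ∀ v, X.degree v ≤ d) (hreg : {v | X.degree v ≠ q + 1}.Finite) {F : V → ℂ} {L : ℂ}
    (hF : S.HasAverage F L) {C : ℝ} (hC : ∀ v, ‖F v‖ ≤ C) :
    S.HasAverage (fun v => ∑ w ∈ X.neighborFinset v, F w) (((q + 1 : ℕ) : ℂ) * L) := by
  have h1 : S.HasAverage (fun v => X.degree v * F v) (((q + 1 : ℕ) : ℂ) * L) := by
    refine (hF.const_mul ((q + 1 : ℕ) : ℂ)).congr_cofinite hS (hreg.subset fun v hv hv' => hv ?_)
    simp only [hv']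
  exact HasAverage.of_sub_le h1 (tendsto_frontier_div_card hS _)
    fun n => sum_neighbors_sub F hC hd n

theorem polyKernel_eq [DecidableEq V] {hd : ∃ d : ℕ, ∀ v, X.degree v ≤ d} (p : Polynomial ℂ)
    (v : V) : polyKernel X p v =
      (Polynomial.aeval (adjacencyOp X hd) p (lp.single 2 v 1) : V → ℂ) := by
  rw [aeval_adjacencyOp_coe, lp.coeFn_single]
  rfl

theorem norm_polyKernel_le [DecidableEq V] (hd : ∃ d : ℕ, ∀ v, X.degree v ≤ d)
    (p : Polynomial ℂ) (v : V) :
    ‖polyKernel X p v v‖ ≤ ‖Polynomial.aeval (adjacencyOp X hd) p‖ := by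
  rw [polyKernel_eq (hd := hd)]
  refine (lp.norm_apply_le_norm (by norm_num) _ _).trans
    ((ContinuousLinearMap.le_opNorm _ _).trans ?_)
  rw [lp.norm_single (by norm_num)]
  simp

namespace IsSpectralTrace

variable {hd : ∃ d : ℕ, ∀ v, X.degree v ≤ d}

theorem hasAverage_polyKernel [DecidableEq V] {d : ℕ} {h : ∀ v, X.degree v ≤ d}
    {τ : C(Set.Icc (-(d : ℝ)) d, ℂ) →L[ℂ] ℂ} (hτ : S.IsSpectralTrace hd h τ) (p : Polynomial ℂ) :
    S.HasAverage (fun v => polyKernel X p v v) (τ (Polynomial.aeval (ofRealMap d) p)) := by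
  have h1 := hτ (Polynomial.aeval (ofRealMap d) p)
  rw [tendsto_normalizedTrace_iff, adjacencyCalculus_aeval] at h1
  convert h1 using 2 with v
  rw [polyKernel_eq (hd := hd)]

variable {q : ℕ} {h : ∀ v, X.degree v ≤ q + 1}
  {τ : C(Set.Icc (-((q + 1 : ℕ) : ℝ)) ((q + 1 : ℕ) : ℝ), ℂ) →L[ℂ] ℂ}

/-- The correction has period two in `m`, like the step of the recursion. Its value is fixed at the
start: `q + 1` darts per vertex against `τ 2 = 2` for `m = 0`, and no closed walks on either side
for `m = 1`. -/
theorem hasAverage_reducedDiag [Infinite V] [DecidableEq X.Dart] (hS : S.IsSelfSimilar)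
    (hτ : S.IsSpectralTrace hd h τ) (hreg : {v | X.degree v ≠ q + 1}.Finite) (m : ℕ) :
    S.HasAverage (reducedDiag (X := X) m) (τ (Polynomial.aeval (ofRealMap (q + 1)) (firstKind q m)) +
      (q - 1) / 2 * (1 + (-1) ^ m)) := by
  classical
  induction m using Nat.twoStepInduction with
  | zero =>
    have h2 : τ (Polynomial.aeval (ofRealMap (q + 1)) (firstKind q 0)) = 2 := by
      have : Polynomial.aeval (ofRealMap (q + 1)) (firstKind q 0) = (2 : ℂ) • 1 := by
        rw [firstKind]
        ext x
        simp
      rw [this, map_smul, hτ.map_one hS, smul_eq_mul, mul_one]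
    rw [h2]
    refine HasAverage.congr_cofinite hS (hasAverage_const hS _) (hreg.subset fun v hv hv' => hv ?_)
    rw [reducedDiag_zero, hv']
    push_cast
    ring
  | one =>
    have h2 : τ (Polynomial.aeval (ofRealMap (q + 1)) (firstKind q 1)) = 0 := by
      refine (hτ.hasAverage_polyKernel _).unique ?_
      convert hasAverage_const hS 0 using 2 with v
      rw [firstKind, polyKernel, Polynomial.aeval_X, stepOp_apply]
      refine Finset.sum_eq_zero fun w hw => ?_
      rw [SimpleGraph.mem_neighborFinset] at hw
      exact Pi.single_eq_of_ne hw.ne' _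
    rw [h2]
    convert hasAverage_const hS 0 using 1
    · funext v
      exact reducedDiag_one v
    · ring
  | more m h1 h2 =>
    have h3 := (((((hτ.hasAverage_polyKernel (Polynomial.X * secondKind q (m + 2))).sub
      ((hτ.hasAverage_polyKernel (secondKind q (m + 1))).const_mul ((q + 1 : ℕ) : ℂ))).sub
      ((hτ.hasAverage_polyKernel (secondKind q (m + 1))).sum_neighbors hS h hreg
        (norm_polyKernel_le hd _))).add
      (hτ.hasAverage_polyKernel (Polynomial.X * secondKind q m))).add h1).congr_cofinite hS
      (eventually_cofinite.1 (eventually_reducedDiag hreg m))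
    convert h3 using 1
    rw [firstKind_sub]
    have e : ∀ p : Polynomial ℂ, τ (Polynomial.aeval (ofRealMap (q + 1)) (2 * ((q : Polynomial ℂ) + 1) * p)) =
        2 * (q + 1) * τ (Polynomial.aeval (ofRealMap (q + 1)) p) := by
      intro p
      have : Polynomial.aeval (ofRealMap (q + 1)) (2 * ((q : Polynomial ℂ) + 1) * p) =
          (2 * ((q : ℂ) + 1)) • Polynomial.aeval (ofRealMap (q + 1)) p := by
        ext x
        simp
      rw [this, map_smul, smul_eq_mul]
    simp only [map_add, map_sub, e]
    push_cast
    ring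

/-- Two evaluations of the average number of reduced closed paths: as powers of prime ones, and as
diagonal entries of the nonbacktracking operator. -/
theorem sum_primeDensity_eq [Infinite V] (hS : S.IsSelfSimilar)
    (hτ : S.IsSpectralTrace hd h τ) (hreg : {v | X.degree v ≠ q + 1}.Finite) {m : ℕ}
    (hm : 0 < m) :
    ((∑ l ∈ m.divisors, l * S.primeDensity l : ℝ) : ℂ) =
      τ (Polynomial.aeval (ofRealMap (q + 1)) (firstKind q m)) +
        (q - 1) / 2 * (1 + (-1) ^ m) := by
  classical
  have h1 := (localFamily_of_subset (S := S) h hm (P := reducedSeq X m) (fun _ hc => hc.1)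
    fun n k f hf c => reducedSeq_copy_iff hf c m).hasAverage hS (tendsto_reducedSeq hS h hm)
  refine h1.unique ?_
  convert hτ.hasAverage_reducedDiag hS hreg m using 1
  funext v
  exact (reducedDiag_eq hm v).symm

end IsSpectralTrace

/-- A nonbacktracking walk has at most `q` continuations at each step. This growth rate gives the
radius `1 / q` used for the Euler product. -/
theorem sum_primeDensity_le [Infinite V] (hS : S.IsSelfSimilar) {q : ℕ}
    (h : ∀ v, X.degree v ≤ q + 1) {m : ℕ} (hm : 0 < m) :
    ∑ l ∈ m.divisors, l * S.primeDensity l ≤ (q + 1) * q ^ m := by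
  have h1 := (localFamily_of_subset (S := S) h hm (P := reducedSeq X m) (fun _ hc => hc.1)
    fun n k f hf c => reducedSeq_copy_iff hf c m).hasAverage hS (tendsto_reducedSeq hS h hm)
  have h2 := h1.norm
  rw [Complex.norm_real] at h2
  refine (le_abs_self _).trans (le_of_tendsto' h2 fun n => ?_)
  rw [norm_div, Complex.norm_natCast]
  refine div_le_of_le_mul₀ (by positivity) (by positivity) ((norm_sum_le _ _).trans ?_)
  rw [mul_comm, ← nsmul_eq_mul]
  refine Finset.sum_le_card_nsmul _ _ _ fun v _ => ?_
  rw [Complex.norm_natCast]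
  exact_mod_cast reducedSeq_through_ncard_le h hm v

end GraphTower

end

noncomputable section

/-! Sums over divisors -/

theorem sum_divisorsAntidiagonal_pow {K : Type*} [Field K] [CharZero K] (p : ℕ → K) (w : K)
    (m : ℕ+) :
    ∑ x : Nat.divisorsAntidiagonal m, p x.1.1 * w ^ (x.1.1 * x.1.2) / x.1.2 =
      (∑ l ∈ (m : ℕ).divisors, l * p l) * w ^ (m : ℕ) / (m : ℕ) := by
  rw [Finset.sum_coe_sort (Nat.divisorsAntidiagonal m)
    (fun x => p x.1 * w ^ (x.1 * x.2) / (x.2 : K)),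
    ← Nat.sum_divisorsAntidiagonal fun l _ => (l : K) * p l, Finset.sum_mul, Finset.sum_div]
  refine Finset.sum_congr rfl fun x hx => ?_
  rw [Nat.mem_divisorsAntidiagonal] at hx
  have h1 : (x.1 : K) ≠ 0 := by
    rintro h
    rw [Nat.cast_eq_zero] at h
    exact hx.2 (by rw [← hx.1, h, zero_mul])
  have h2 : (x.2 : K) ≠ 0 := by
    rintro h
    rw [Nat.cast_eq_zero] at h
    exact hx.2 (by rw [← hx.1, h, mul_zero])
  rw [← hx.1]
  push_cast
  field_simp

theorem hasSum_pnat_iff_of_zero {f : ℕ → ℂ} (h0 : f 0 = 0) {T : ℂ} :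
    HasSum (fun m : ℕ+ => f m) T ↔ HasSum f T := by
  refine PNat.coe_injective.hasSum_iff fun x hx => ?_
  rcases Nat.eq_zero_or_pos x with rfl | hpos
  · exact h0
  · exact absurd ⟨⟨x, hpos⟩, rfl⟩ hx

/-- Rearrangement of the absolutely convergent double sum of `p l * u ^ (l k) / k`: collecting by
the product `l k` gives the series for `T`, summing over `k` first gives logarithms. -/
theorem hasSum_mul_log_one_sub_pow {p : ℕ → ℝ} (hp : ∀ l, 0 < l → 0 ≤ p l) {u T : ℂ}
    (hu : ‖u‖ < 1)
    (hs : Summable fun m : ℕ+ =>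
      (∑ l ∈ (m : ℕ).divisors, l * p l) * ‖u‖ ^ (m : ℕ) / (m : ℕ))
    (hT : HasSum (fun m : ℕ => ((∑ l ∈ m.divisors, l * p l : ℝ) : ℂ) * u ^ m / m) T) :
    HasSum (fun l : ℕ => -((p l : ℂ) * Complex.log (1 - u ^ l))) T := by
  let F : ℕ+ × ℕ+ → ℂ := fun x => p x.1 * u ^ ((x.1 : ℕ) * x.2) / (x.2 : ℕ)
  have hnorm : ∀ x, ‖F x‖ = p x.1 * ‖u‖ ^ ((x.1 : ℕ) * x.2) / (x.2 : ℕ) := fun x => by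
    simp only [F, norm_div, norm_mul, norm_pow, Complex.norm_natCast, Complex.norm_real]
    rw [Real.norm_of_nonneg (hp x.1 x.1.2)]
  have hF : Summable F := by
    rw [← summable_norm_iff, ← sigmaAntidiagonalEquivProd.summable_iff,
      summable_sigma_of_nonneg (f := (fun x => ‖F x‖) ∘ sigmaAntidiagonalEquivProd)
        fun _ => norm_nonneg _]
    refine ⟨fun m => (hasSum_fintype _).summable, hs.congr fun m => ?_⟩
    rw [tsum_fintype, ← sum_divisorsAntidiagonal_pow]
    exact Finset.sum_congr rfl fun x _ => (hnorm (sigmaAntidiagonalEquivProd ⟨m, x⟩)).symm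
  have hsum : ∑' x, F x = T := by
    have h1 := (sigmaAntidiagonalEquivProd.hasSum_iff.2 hF.hasSum).sigma
      fun m => hasSum_fintype _
    refine h1.unique ?_
    rw [← hasSum_pnat_iff_of_zero (by simp)] at hT
    convert hT using 2 with m
    have := sum_divisorsAntidiagonal_pow (fun l => (p l : ℂ)) u m
    push_cast
    exact this
  have hF' := hF.hasSum
  rw [hsum] at hF'
  rw [← hasSum_pnat_iff_of_zero (by simp)]
  refine hF'.prod_fiberwise fun l => ?_
  have hl : ‖u ^ (l : ℕ)‖ < 1 := by
    rw [norm_pow]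
    exact pow_lt_one₀ (norm_nonneg _) hu l.ne_zero
  have h2 := ((hasSum_pnat_iff_of_zero (by simp)).2 (Complex.hasSum_taylorSeries_neg_log hl)).mul_left
    (p l : ℂ)
  rw [mul_neg] at h2
  refine h2.congr_fun fun k => ?_
  simp only [F, pow_mul, mul_div_assoc]

/-! The Euler product -/

namespace GraphTower

variable {V : Type*} {X : SimpleGraph V} [X.LocallyFinite] {S : GraphTower X} {q : ℕ}

/-- The logarithms of the factors are grouped by length. The classes of length `l` share the value
`log (1 - u ^ l)` and their multiplicities add up to the prime density. Absolute convergence comes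
from `|log (1 - u ^ l)| ≤ C |u| ^ l` and a density of at most `(q + 1) q ^ l`. -/
theorem hasProd_eulerFactor [Infinite V] (hS : S.IsSelfSimilar) (hq : 0 < q)
    (h : ∀ v, X.degree v ≤ q + 1) {u T : ℂ} (hu : ‖u‖ < 1 / q)
    (hT : HasSum (fun m : ℕ =>
      ((∑ l ∈ m.divisors, l * S.primeDensity l : ℝ) : ℂ) * u ^ m / m) T) :
    HasProd (S.eulerFactor u) (Complex.exp T) := by
  have hq' : (1 : ℝ) ≤ q := by exact_mod_cast hq
  have hqu : q * ‖u‖ < 1 := by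
    rwa [lt_div_iff₀' (by linarith)] at hu
  have hu1 : ‖u‖ < 1 := lt_of_le_of_lt (by nlinarith [norm_nonneg u]) hqu
  have hp : ∀ l, 0 < l → 0 ≤ S.primeDensity l := fun l hl => primeDensity_nonneg hS h hl
  have hgeo : Summable fun m : ℕ => ((q : ℝ) + 1) * (q * ‖u‖) ^ m :=
    (summable_geometric_of_lt_one (by positivity) hqu).mul_left _
  have hsum0 : ∀ m : ℕ, 0 ≤ ∑ l ∈ m.divisors, l * S.primeDensity l := fun m =>
    Finset.sum_nonneg fun l hl => mul_nonneg (by positivity) (hp l (Nat.pos_of_mem_divisors hl))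
  have hs : Summable fun m : ℕ+ =>
      (∑ l ∈ (m : ℕ).divisors, l * S.primeDensity l) * ‖u‖ ^ (m : ℕ) / (m : ℕ) := by
    refine Summable.of_nonneg_of_le (fun m => ?_) (fun m => ?_)
      (hgeo.comp_injective PNat.coe_injective)
    · exact div_nonneg (mul_nonneg (hsum0 m) (by positivity)) (by positivity)
    · have h1 := sum_primeDensity_le hS h m.pos
      have h2 : (1 : ℝ) ≤ (m : ℕ) := by exact_mod_cast m.pos
      refine (div_le_self (mul_nonneg (hsum0 m) (by positivity)) h2).trans ?_
      simp only [Function.comp_apply]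
      rw [mul_pow, ← mul_assoc]
      exact mul_le_mul_of_nonneg_right h1 (by positivity)
  have hlog := hasSum_mul_log_one_sub_pow hp hu1 hs hT
  let a : S.PrimeClass → ℂ := fun ξ =>
    -((S.avgMultiplicity ξ : ℂ) * Complex.log (1 - u ^ S.classLength ξ))
  have hbound : ∀ l : ℕ, 0 < l →
      S.primeDensity l * ‖Complex.log (1 - u ^ l)‖ ≤
        ((1 - ‖u‖)⁻¹ + 1) * (((q : ℝ) + 1) * (q * ‖u‖) ^ l) := by
    intro l hl
    have h1 : S.primeDensity l ≤ ((q : ℝ) + 1) * q ^ l := by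
      refine le_trans ?_ (sum_primeDensity_le hS h hl)
      have h2 : (1 : ℝ) ≤ l := by exact_mod_cast hl
      refine (le_mul_of_one_le_left (hp l hl) h2).trans ?_
      exact Finset.single_le_sum (f := fun l : ℕ => (l : ℝ) * S.primeDensity l)
        (fun l hl => mul_nonneg (by positivity) (hp l (Nat.pos_of_mem_divisors hl)))
        (Nat.mem_divisors_self l hl.ne')
    have h3 : ‖u‖ ^ l ≤ ‖u‖ := pow_le_of_le_one (norm_nonneg _) hu1.le hl.ne'
    have h4 : ‖Complex.log (1 - u ^ l)‖ ≤ ((1 - ‖u‖)⁻¹ + 1) * ‖u‖ ^ l := by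
      have h5 : ‖-u ^ l‖ = ‖u‖ ^ l := by rw [norm_neg, norm_pow]
      have h6 := Complex.norm_log_one_add_le (z := -u ^ l) (by rw [h5]; exact h3.trans_lt hu1)
      rw [h5, ← sub_eq_add_neg] at h6
      refine h6.trans ?_
      have h7 : (1 - ‖u‖ ^ l)⁻¹ ≤ (1 - ‖u‖)⁻¹ :=
        inv_anti₀ (by linarith) (by linarith)
      have h8 : 0 ≤ ‖u‖ ^ l := by positivity
      have h9 : 0 ≤ (1 - ‖u‖)⁻¹ := inv_nonneg.2 (by linarith)
      have h10 : (‖u‖ ^ l) ^ 2 * (1 - ‖u‖ ^ l)⁻¹ / 2 ≤ ‖u‖ ^ l * (1 - ‖u‖)⁻¹ := by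
        calc (‖u‖ ^ l) ^ 2 * (1 - ‖u‖ ^ l)⁻¹ / 2 ≤ (‖u‖ ^ l) ^ 2 * (1 - ‖u‖)⁻¹ / 2 := by gcongr
          _ ≤ ‖u‖ ^ l * (1 - ‖u‖)⁻¹ := by
            have : (‖u‖ ^ l) ^ 2 ≤ ‖u‖ ^ l := pow_le_of_le_one h8 (h3.trans hu1.le) two_ne_zero
            nlinarith [mul_le_mul_of_nonneg_right this h9, mul_nonneg h8 h9]
      linarith
    calc _ ≤ (((q : ℝ) + 1) * q ^ l) * (((1 - ‖u‖)⁻¹ + 1) * ‖u‖ ^ l) :=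
          mul_le_mul h1 h4 (norm_nonneg _) (by positivity)
      _ = _ := by
          rw [mul_pow]
          ring
  have hfib : ∀ l : ℕ, HasSum
      (fun ξ : {ξ : S.PrimeClass // S.classLength ξ = l} => S.avgMultiplicity ξ *
        ‖Complex.log (1 - u ^ l)‖) (S.primeDensity l * ‖Complex.log (1 - u ^ l)‖) := by
    intro l
    -- For `l = 0` both sides vanish because `Complex.log 0 = 0`, whatever `primeDensity 0` may be.
    rcases Nat.eq_zero_or_pos l with rfl | hl
    · simp
    · exact (hasSum_avgMultiplicity hS h hl).mul_right _
  have hfibc : ∀ l : ℕ, HasSum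
      (fun ξ : {ξ : S.PrimeClass // S.classLength ξ = l} => a ξ)
      (-((S.primeDensity l : ℂ) * Complex.log (1 - u ^ l))) := by
    intro l
    have h1 : (fun ξ : {ξ : S.PrimeClass // S.classLength ξ = l} => a ξ) =
        fun ξ => -((S.avgMultiplicity ξ.1 : ℂ) * Complex.log (1 - u ^ l)) := by
      funext ξ
      simp only [a, ξ.2]
    rw [h1]
    rcases Nat.eq_zero_or_pos l with rfl | hl
    · simp
    · exact ((Complex.hasSum_ofReal.2 (hasSum_avgMultiplicity hS h hl)).mul_right _).neg
  have hsa : Summable (a ∘ Equiv.sigmaFiberEquiv S.classLength) := by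
    rw [← summable_norm_iff, summable_sigma_of_nonneg fun _ => norm_nonneg _]
    have e : ∀ l : ℕ, ∀ ξ : {ξ : S.PrimeClass // S.classLength ξ = l},
        ‖(a ∘ Equiv.sigmaFiberEquiv S.classLength) ⟨l, ξ⟩‖ =
          S.avgMultiplicity ξ * ‖Complex.log (1 - u ^ l)‖ := by
      rintro l ⟨ξ, rfl⟩
      simp only [Function.comp_apply, Equiv.sigmaFiberEquiv_apply, a, norm_neg, norm_mul,
        Complex.norm_real, Real.norm_of_nonneg (avgMultiplicity_nonneg hS h ξ)]
    refine ⟨fun l => ?_, ?_⟩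
    · simp only [e]
      exact (hfib l).summable
    · simp only [e, (hfib _).tsum_eq]
      refine Summable.of_norm_bounded_eventually_nat (hgeo.mul_left ((1 - ‖u‖)⁻¹ + 1)) ?_
      filter_upwards [eventually_gt_atTop 0] with l hl
      rw [Real.norm_of_nonneg (mul_nonneg (hp l hl) (norm_nonneg _))]
      exact hbound l hl
  have ha : HasSum a T := by
    rw [← (Equiv.sigmaFiberEquiv S.classLength).hasSum_iff]
    have h1 := hsa.hasSum.sigma (g := fun l : ℕ =>
      -((S.primeDensity l : ℂ) * Complex.log (1 - u ^ l))) fun l => hfibc l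
    have h2 := hsa.hasSum
    rwa [h1.unique hlog] at h2
  convert ha.cexp using 1
  funext ξ
  have hne : 1 - u ^ S.classLength ξ ≠ 0 := by
    intro h0
    have h1 : ‖u ^ S.classLength ξ‖ < 1 := by
      rw [norm_pow]
      exact pow_lt_one₀ (norm_nonneg _) hu1 (classLength_pos ξ).ne'
    rw [← sub_eq_zero.1 h0, norm_one] at h1
    exact lt_irrefl _ h1
  rw [eulerFactor, Complex.cpow_def_of_ne_zero hne, Function.comp_apply]
  congr 1
  simp only [a]
  ring

end GraphTower

end

noncomputable section

/-! The determinant on the disc `|u| < 1 / q` -/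

theorem eval_firstKind {q : ℕ} {x α β : ℂ} (h1 : α + β = x) (h2 : α * β = q) (m : ℕ) :
    (firstKind q m).eval x = α ^ m + β ^ m := by
  induction m using Nat.twoStepInduction with
  | zero => simp [firstKind]; norm_num
  | one => simp [firstKind, h1]
  | more m ih1 ih2 =>
    rw [firstKind, Polynomial.eval_sub, Polynomial.eval_mul, Polynomial.eval_mul, ih1, ih2,
      Polynomial.eval_X, Polynomial.eval_natCast, ← h1, ← h2]
    ring

/-- A root that is not real has `|α|² = q`. For a real root, `|x| ≤ q + 1` gives `(|α| - 1)(|α| - q)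
≤ 0`. -/
theorem norm_le_of_quadratic {q : ℕ} (hq : 0 < q) {x : ℝ} (hx : |x| ≤ q + 1) {α : ℂ}
    (h : α ^ 2 - x * α + q = 0) : ‖α‖ ≤ q := by
  have hq' : (1 : ℝ) ≤ q := by exact_mod_cast hq
  have hre := congrArg Complex.re h
  have him := congrArg Complex.im h
  simp only [sq, Complex.add_re, Complex.sub_re, Complex.mul_re, Complex.ofReal_re,
    Complex.ofReal_im, Complex.natCast_re, Complex.zero_re, Complex.add_im, Complex.sub_im,
    Complex.mul_im, Complex.natCast_im, Complex.zero_im] at hre him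
  have hn : ‖α‖ ^ 2 = α.re ^ 2 + α.im ^ 2 := by
    rw [← Complex.normSq_eq_norm_sq, Complex.normSq_apply]
    ring
  have him' : α.im * (2 * α.re - x) = 0 := by linarith
  rcases mul_eq_zero.1 him' with h0 | h0
  · have hr : ‖α‖ = |α.re| := by
      rw [Complex.abs_re_eq_norm.2 h0]
    rw [hr]
    by_contra! hlt
    have h1 : α.re ^ 2 + q = x * α.re := by
      rw [h0] at hre
      linarith
    have h2 : x * α.re ≤ (q + 1) * |α.re| := by
      calc x * α.re ≤ |x * α.re| := le_abs_self _
        _ = |x| * |α.re| := abs_mul _ _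
        _ ≤ _ := by gcongr
    have h3 : α.re ^ 2 = |α.re| ^ 2 := (sq_abs _).symm
    nlinarith [mul_pos (show 0 < |α.re| - 1 by linarith) (show 0 < |α.re| - q by linarith)]
  · have h1 : ‖α‖ ^ 2 = q := by
      rw [hn]
      have : x = 2 * α.re := by linarith
      rw [this] at hre
      linarith
    by_contra! hlt
    nlinarith

theorem exists_roots (q : ℕ) (x : ℂ) : ∃ α β : ℂ, α + β = x ∧ α * β = q := by
  obtain ⟨s, hs⟩ := IsAlgClosed.exists_pow_nat_eq (x ^ 2 - 4 * q) two_pos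
  exact ⟨(x + s) / 2, (x - s) / 2, by ring, by linear_combination (- hs) / 4⟩

theorem mem_domainΩ_of_norm_lt {q : ℕ} (hq : 0 < q) {u : ℂ} (hu : ‖u‖ < 1 / q) :
    u ∈ domainΩ q := by
  have hq' : (1 : ℝ) ≤ q := by exact_mod_cast hq
  rintro (h | ⟨-, h, -⟩)
  · have h1 : ‖u‖ < 1 := hu.trans_le (by rw [div_le_one (by linarith)]; exact hq')
    rw [Set.mem_ofPred_eq] at h
    nlinarith [norm_nonneg u]
  · exact absurd hu (not_lt.2 (h.trans (Complex.abs_re_le_norm u)))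

/-- The logarithm of `1 - λ u + q u²` as a power series in `u`. -/
theorem exists_isSpectralLog_hasSum {q : ℕ} (hq : 0 < q) {u : ℂ} (hu : ‖u‖ < 1 / q) :
    ∃ g, IsSpectralLog q u g ∧
      HasSum (fun m : ℕ => (u ^ m / m) • Polynomial.aeval (ofRealMap (q + 1)) (firstKind q m))
        (-g) := by
  have hq' : (1 : ℝ) ≤ q := by exact_mod_cast hq
  have hqu : q * ‖u‖ < 1 := by
    rwa [lt_div_iff₀' (by linarith)] at hu
  have hroots : ∀ x : Set.Icc (-((q + 1 : ℕ) : ℝ)) ((q + 1 : ℕ) : ℝ), ∃ α β : ℂ,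
      α + β = (x : ℝ) ∧ α * β = q ∧ ‖α‖ ≤ q ∧ ‖β‖ ≤ q := by
    intro x
    obtain ⟨α, β, h1, h2⟩ := exists_roots q (x : ℝ)
    have hx : |(x : ℝ)| ≤ q + 1 := by
      have := abs_le.2 x.2
      push_cast at this
      exact this
    refine ⟨α, β, h1, h2, norm_le_of_quadratic hq hx ?_, norm_le_of_quadratic hq hx ?_⟩
    · rw [← h1, ← h2]
      ring
    · rw [← h1, ← h2]
      ring
  have hnorm : ∀ m : ℕ, ‖(u ^ m / m) • Polynomial.aeval (ofRealMap (q + 1)) (firstKind q m)‖ ≤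
      2 * (q * ‖u‖) ^ m := by
    intro m
    have h1 : ‖Polynomial.aeval (ofRealMap (q + 1)) (firstKind q m)‖ ≤ 2 * q ^ m := by
      rw [ContinuousMap.norm_le _ (by positivity)]
      intro x
      obtain ⟨α, β, h1, h2, h3, h4⟩ := hroots x
      rw [aeval_ofRealMap_apply, eval_firstKind h1 h2]
      refine (norm_add_le _ _).trans ?_
      rw [norm_pow, norm_pow, two_mul]
      gcongr
    have h2 : ‖u ^ m / m‖ ≤ ‖u‖ ^ m := by
      rw [norm_div, norm_pow, Complex.norm_natCast]
      rcases Nat.eq_zero_or_pos m with rfl | hm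
      · simp
      · exact div_le_self (by positivity) (by exact_mod_cast hm)
    rw [norm_smul, mul_pow]
    calc _ ≤ ‖u‖ ^ m * (2 * q ^ m) := mul_le_mul h2 h1 (norm_nonneg _) (by positivity)
      _ = _ := by ring
  have hsum : Summable fun m : ℕ =>
      (u ^ m / m) • Polynomial.aeval (ofRealMap (q + 1)) (firstKind q m) :=
    Summable.of_norm_bounded
      ((summable_geometric_of_lt_one (by positivity) hqu).mul_left 2) hnorm
  -- The bound `|α ^ m + β ^ m| ≤ 2 q ^ m` makes the series converge in the sup norm, so that `τ`
  -- can be applied termwise. Pointwise it is the sum of the Taylor series of `-log (1 - α u)` and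
  -- `-log (1 - β u)`.
  refine ⟨-∑' m : ℕ, (u ^ m / m) • Polynomial.aeval (ofRealMap (q + 1)) (firstKind q m), ?_, ?_⟩
  · intro x
    obtain ⟨α, β, h1, h2, h3, h4⟩ := hroots x
    have hz : ∀ z : ℂ, ‖z‖ ≤ q → ‖z * u‖ < 1 := fun z hz => by
      rw [norm_mul]
      exact lt_of_le_of_lt (by gcongr) hqu
    have hne : ∀ z : ℂ, ‖z‖ ≤ q → 1 - z * u ≠ 0 := fun z hz' h0 => by
      have := hz z hz'
      rw [← sub_eq_zero.1 h0, norm_one] at this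
      exact lt_irrefl _ this
    have h5 := (Complex.hasSum_taylorSeries_neg_log (hz α h3)).add
      (Complex.hasSum_taylorSeries_neg_log (hz β h4))
    have h6 := hsum.hasSum.map (ContinuousMap.evalAlgHom ℂ ℂ x) 
      (continuous_eval_const x)
    have h7 : (∑' m : ℕ, (u ^ m / m) •
        Polynomial.aeval (ofRealMap (q + 1)) (firstKind q m)) x =
        -Complex.log (1 - α * u) + -Complex.log (1 - β * u) := by
      refine HasSum.unique h6 ?_
      convert h5 using 2 with m
      simp only [Function.comp_apply, ContinuousMap.evalAlgHom_apply, ContinuousMap.smul_apply,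
        smul_eq_mul]
      rw [aeval_ofRealMap_apply, eval_firstKind h1 h2]
      ring
    rw [ContinuousMap.neg_apply, h7, neg_add, neg_neg, neg_neg, Complex.exp_add,
      Complex.exp_log (hne α h3), Complex.exp_log (hne β h4), spectralFactor, ← h1, ← h2]
    ring
  · rw [neg_neg]
    exact hsum.hasSum

/-- Both `1 - u` and `1 + u` have positive real part, so their arguments add up without leaving
`(-π, π)`. -/
theorem log_one_sub_sq {u : ℂ} (hu : ‖u‖ < 1) :
    Complex.log (1 - u ^ 2) = Complex.log (1 - u) + Complex.log (1 + u) := by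
  have hre : ∀ z : ℂ, ‖z‖ < 1 → 0 < (1 + z).re := fun z hz => by
    have := (abs_lt.1 ((Complex.abs_re_le_norm z).trans_lt hz)).1
    simp only [Complex.add_re, Complex.one_re]
    linarith
  have h1 := hre (-u) (by rwa [norm_neg])
  rw [← sub_eq_add_neg] at h1
  have h2 := hre u hu
  have hne : ∀ z : ℂ, 0 < z.re → z ≠ 0 := by
    rintro z hz rfl
    simp at hz
  have h3 := abs_lt.1 (Complex.abs_arg_lt_pi_div_two_iff.2 (Or.inl h1))
  have h4 := abs_lt.1 (Complex.abs_arg_lt_pi_div_two_iff.2 (Or.inl h2))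
  rw [← Complex.log_mul (hne _ h1) (hne _ h2) ⟨by linarith [h3.1, h4.1], by linarith [h3.2, h4.2]⟩]
  congr 1
  ring

theorem halfPow_eq_exp (a : ℤ) {u : ℂ} (hu : ‖u‖ < 1) :
    halfPow a u = Complex.exp (a / 2 * (Complex.log (1 - u) + Complex.log (1 + u))) := by
  have hne : 1 - u ^ 2 ≠ 0 := by
    intro h0
    have h1 : ‖u ^ 2‖ < 1 := by
      rw [norm_pow]
      exact pow_lt_one₀ (norm_nonneg _) hu two_ne_zero
    rw [← sub_eq_zero.1 h0, norm_one] at h1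
    exact lt_irrefl _ h1
  rw [halfPow, Complex.cpow_def_of_ne_zero hne, log_one_sub_sq hu, mul_comm]

/-- The period two correction to the number of reduced paths sums to a multiple of `log (1 - u²)`,
which produces the exponent `(1 - q) / 2`. -/
theorem hasSum_even_pow_div {u : ℂ} (hu : ‖u‖ < 1) :
    HasSum (fun m : ℕ => (1 + (-1) ^ m) * u ^ m / m)
      (-(Complex.log (1 - u) + Complex.log (1 + u))) := by
  have h1 := (Complex.hasSum_taylorSeries_neg_log hu).add
    (Complex.hasSum_taylorSeries_neg_log (z := -u) (by rwa [norm_neg]))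
  rw [sub_neg_eq_add, ← neg_add] at h1
  refine h1.congr_fun fun m => ?_
  rw [neg_pow u]
  ring

namespace GraphTower.IsSpectralTrace

variable {V : Type*} {X : SimpleGraph V} [X.LocallyFinite] {S : GraphTower X}
  {hd : ∃ d : ℕ, ∀ v, X.degree v ≤ d} {q : ℕ} {h : ∀ v, X.degree v ≤ q + 1}
  {τ : C(Set.Icc (-((q + 1 : ℕ) : ℝ)) ((q + 1 : ℕ) : ℝ), ℂ) →L[ℂ] ℂ}

/-- The determinant formula on the disc of convergence. -/
theorem hasProd_eulerFactor [Infinite V] (hS : S.IsSelfSimilar)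
    (hτ : S.IsSpectralTrace hd h τ) (hq : 0 < q) (hreg : {v | X.degree v ≠ q + 1}.Finite) {u : ℂ}
    (hu : ‖u‖ < 1 / q) :
    HasProd (S.eulerFactor u)
      (halfPow (1 - q) u * (S.det (deformedLaplacian X hd q u))⁻¹) := by
  have hq' : (1 : ℝ) ≤ q := by exact_mod_cast hq
  have hu1 : ‖u‖ < 1 := hu.trans_le (by rw [div_le_one (by linarith)]; exact hq')
  obtain ⟨g, hg, hsum⟩ := exists_isSpectralLog_hasSum hq hu
  have h1 := hsum.map τ τ.continuous
  have h2 := h1.add ((hasSum_even_pow_div hu1).mul_left (((q : ℂ) - 1) / 2))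
  have h3 : HasSum (fun m : ℕ =>
      ((∑ l ∈ m.divisors, l * S.primeDensity l : ℝ) : ℂ) * u ^ m / m)
      (τ (-g) + (q - 1) / 2 * (-(Complex.log (1 - u) + Complex.log (1 + u)))) := by
    refine h2.congr_fun fun m => ?_
    -- The term `m = 0` is zero on both sides, as division by `0` gives `0`.
    rcases Nat.eq_zero_or_pos m with rfl | hm
    · simp
    · rw [hτ.sum_primeDensity_eq hS hreg hm, Function.comp_apply, map_smul, smul_eq_mul]
      ring
  convert GraphTower.hasProd_eulerFactor hS hq h hu h3 using 1
  rw [hτ.det_eq hS hq (mem_domainΩ_of_norm_lt hq hu) hg, halfPow_eq_exp _ hu1, ← Complex.exp_neg,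
    ← Complex.exp_add, map_neg]
  congr 1
  push_cast
  ring

end GraphTower.IsSpectralTrace

end

noncomputable section

/-! Connectedness of the domain -/

theorem isOpen_domainΩ' (q : ℕ) : IsOpen (domainΩ' q) := by
  refine IsClosed.isOpen_compl (self := IsClosed.union ?_ ?_)
  · exact (isClosed_eq (continuous_norm.pow 2) continuous_const).inter
      (isClosed_le Complex.continuous_im continuous_const)
  · refine (isClosed_eq Complex.continuous_im continuous_const).inter
      ((isClosed_le continuous_const Complex.continuous_re.abs).inter
        (isClosed_le Complex.continuous_re.abs continuous_const))

theorem domainΩ_subset (q : ℕ) : domainΩ q ⊆ domainΩ' q := by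
  refine Set.compl_subset_compl.2 (Set.union_subset_union_left _ ?_)
  exact fun u hu => hu.1

theorem mem_domainΩ'_iff {q : ℕ} {u : ℂ} : u ∈ domainΩ' q ↔
    (‖u‖ ^ 2 = 1 / q → 0 < u.im) ∧ (u.im = 0 → 1 / q ≤ |u.re| → 1 < |u.re|) := by
  rw [domainΩ', Set.mem_compl_iff, Set.mem_union, not_or]
  simp only [Set.mem_ofPred_eq, not_and, not_le]

section Domain

variable {q : ℕ}

theorem norm_sq_eq_re_sq_add_im_sq (u : ℂ) : ‖u‖ ^ 2 = u.re ^ 2 + u.im ^ 2 := by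
  rw [← Complex.normSq_eq_norm_sq, Complex.normSq_apply]
  ring

theorem im_pos_subset : {u : ℂ | 0 < u.im} ⊆ domainΩ' q := by
  intro u hu
  exact mem_domainΩ'_iff.2 ⟨fun _ => hu, fun h => absurd h (ne_of_gt hu)⟩

theorem mem_domainΩ'_of_one_lt (hq : 0 < q) {u : ℂ} (hu : 1 < ‖u‖) : u ∈ domainΩ' q := by
  have hq' : (1 : ℝ) / q ≤ 1 := by
    rw [div_le_one (by exact_mod_cast hq)]
    exact_mod_cast hq
  refine mem_domainΩ'_iff.2 ⟨fun h => ?_, fun h _ => ?_⟩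
  · nlinarith
  · rwa [Complex.abs_re_eq_norm.2 h]

/-- The connected hub `W` consists of the upper half-plane and three half-planes outside the unit
disc. Inside the circle a point is joined to it through `0` and up the imaginary axis, in the lower
half-plane outside the circle along a ray to infinity. -/
theorem isPreconnected_domainΩ' (hq : 0 < q) : IsPreconnected (domainΩ' q) := by
  have hq0 : (0 : ℝ) < q := by exact_mod_cast hq
  let H : Set ℂ := {u | 0 < u.im}
  let W : Set ℂ := H ∪ {u | 1 < u.re} ∪ {u | u.re < -1} ∪ {u | u.im < -1}
  have hHc : IsPreconnected H := (convex_halfSpace_im_gt 0).isPreconnected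
  have hW : IsPreconnected W := by
    refine IsPreconnected.union (2 - 2 * Complex.I) ?_ ?_ (IsPreconnected.union (-2 + Complex.I) ?_ ?_
      (IsPreconnected.union (2 + Complex.I) ?_ ?_ hHc
        (convex_halfSpace_re_gt 1).isPreconnected) (convex_halfSpace_re_lt (-1)).isPreconnected)
      (convex_halfSpace_im_lt (-1)).isPreconnected
    all_goals simp [H]
  have hWΩ : W ⊆ domainΩ' q := by
    rintro u (((h | h) | h) | h)
    · exact im_pos_subset h
    · refine mem_domainΩ'_of_one_lt hq (lt_of_lt_of_le ?_ (Complex.abs_re_le_norm u))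
      exact lt_of_lt_of_le h (le_abs_self _)
    · refine mem_domainΩ'_of_one_lt hq (lt_of_lt_of_le ?_ (Complex.abs_re_le_norm u))
      rw [Set.mem_ofPred_eq] at h
      exact lt_of_lt_of_le (by linarith) (neg_le_abs _)
    · refine mem_domainΩ'_of_one_lt hq (lt_of_lt_of_le ?_ (Complex.abs_im_le_norm u))
      rw [Set.mem_ofPred_eq] at h
      exact lt_of_lt_of_le (by linarith) (neg_le_abs _)
  have hHW : H ⊆ W := fun u hu => Or.inl (Or.inl (Or.inl hu))
  have hI : Complex.I ∈ W := hHW (by simp [H])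
  refine isPreconnected_of_forall Complex.I fun u hu => ?_
  have hu' := mem_domainΩ'_iff.1 hu
  have hsmul : ∀ t : ℝ, ‖(t : ℂ) * u‖ ^ 2 = t ^ 2 * ‖u‖ ^ 2 := fun t => by
    rw [norm_mul, Complex.norm_real, mul_pow, Real.norm_eq_abs, sq_abs]
  by_cases hpos : 0 < u.im
  · exact ⟨W, hWΩ, hI, hHW hpos, hW⟩
  rcases lt_trichotomy (‖u‖ ^ 2) (1 / q) with hlt | heq | hgt
  -- `D` is the segment from `0` to `u`; `D'` joins `0` to `I / (2 q)`, which is in the upper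
  -- half-plane.
  · let D : Set ℂ := (fun t : ℝ => (t : ℂ) * u) '' Set.Icc 0 1
    let D' : Set ℂ := (fun t : ℝ => (t : ℂ) * (((1 / (2 * q) : ℝ) : ℂ) * Complex.I)) '' Set.Icc 0 1
    have hD : IsPreconnected D := isPreconnected_Icc.image _ (by fun_prop)
    have hD' : IsPreconnected D' := isPreconnected_Icc.image _ (by fun_prop)
    have h0 : (0 : ℂ) ∈ domainΩ' q := mem_domainΩ'_iff.2
      ⟨fun h => by
        rw [norm_zero, zero_pow two_ne_zero] at h
        exact absurd h (by positivity), fun _ h => by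
        rw [Complex.zero_re, abs_zero] at h
        exact absurd h (not_le.2 (by positivity))⟩
    refine ⟨W ∪ (D' ∪ D), ?_, Or.inl hI, Or.inr (Or.inr ⟨1, by simp, by simp⟩), ?_⟩
    · refine Set.union_subset hWΩ (Set.union_subset ?_ ?_)
      · rintro _ ⟨t, ht, rfl⟩
        rcases ht.1.eq_or_lt with rfl | ht0
        · simpa using h0
        · refine im_pos_subset ?_
          have : 0 < t * (1 / (2 * q)) := by positivity
          simpa [Complex.mul_im] using this
      · rintro _ ⟨t, ht, rfl⟩
        refine mem_domainΩ'_iff.2 ⟨fun h => ?_, fun him hre => ?_⟩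
        · simp only [hsmul] at h
          have : t ^ 2 * ‖u‖ ^ 2 ≤ ‖u‖ ^ 2 := mul_le_of_le_one_left (by positivity)
            (pow_le_one₀ ht.1 ht.2)
          linarith
        · simp only [Complex.re_ofReal_mul, Complex.im_ofReal_mul] at him hre
          rcases mul_eq_zero.1 him with rfl | him
          · rw [zero_mul, abs_zero] at hre
            exact absurd hre (not_le.2 (by positivity))
          · have h1 : |t * u.re| ≤ |u.re| := by
              rw [abs_mul, abs_of_nonneg ht.1]
              exact mul_le_of_le_one_left (abs_nonneg _) ht.2
            have h2 := hu'.2 him (hre.trans h1)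
            have h3 : (1 : ℝ) / q ≤ 1 := by
              rw [div_le_one hq0]
              exact_mod_cast hq
            rw [norm_sq_eq_re_sq_add_im_sq, him, ← sq_abs] at hlt
            nlinarith
    · refine IsPreconnected.union (((1 / (2 * q) : ℝ) : ℂ) * Complex.I) (hHW ?_)
        (Or.inl ⟨1, by simp, by simp⟩) hW (IsPreconnected.union 0 ⟨0, by simp, by simp⟩
          ⟨0, by simp, by simp⟩ hD' hD)
      have : (0 : ℝ) < 1 / (2 * q) := by positivity
      simpa [H, Complex.mul_im] using this
  · exact absurd (hu'.1 heq) hpos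
  · by_cases him : u.im = 0
    · have h1 : 1 < |u.re| := by
        refine hu'.2 him ?_
        by_contra! hlt
        rw [norm_sq_eq_re_sq_add_im_sq, him, ← sq_abs] at hgt
        have h3 : (1 : ℝ) / q ≤ 1 := by
          rw [div_le_one hq0]
          exact_mod_cast hq
        have h4 := abs_nonneg u.re
        nlinarith
      refine ⟨W, hWΩ, hI, ?_, hW⟩
      rcases lt_abs.1 h1 with h2 | h2
      · exact Or.inl (Or.inl (Or.inr h2))
      · exact Or.inl (Or.inr (by rw [Set.mem_ofPred_eq]; linarith))
    · have hneg : u.im < 0 := lt_of_le_of_ne (not_lt.1 hpos) him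
      let R : Set ℂ := (fun t : ℝ => (t : ℂ) * u) '' Set.Ici 1
      have hR : IsPreconnected R := isPreconnected_Ici.image _ (by fun_prop)
      refine ⟨W ∪ R, Set.union_subset hWΩ ?_, Or.inl hI,
        Or.inr ⟨1, by simp, by simp⟩, ?_⟩
      · rintro _ ⟨t, ht, rfl⟩
        rw [Set.mem_Ici] at ht
        refine mem_domainΩ'_iff.2 ⟨fun h => ?_, fun h => ?_⟩
        · simp only [hsmul] at h
          have : ‖u‖ ^ 2 ≤ t ^ 2 * ‖u‖ ^ 2 := le_mul_of_one_le_left (by positivity)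
            (one_le_pow₀ ht)
          linarith
        · simp only [Complex.im_ofReal_mul] at h
          rcases mul_eq_zero.1 h with h | h
          · linarith
          · exact absurd h him
      · have h1 : -u.im⁻¹ * 2 * u.im = -2 := by
          field_simp
        have h2 : 0 < -u.im⁻¹ := neg_pos.2 (inv_lt_zero.2 hneg)
        refine IsPreconnected.union (((1 + -u.im⁻¹ * 2 : ℝ) : ℂ) * u) (Or.inr ?_) ⟨_, ?_, rfl⟩ hW hR
        · rw [Set.mem_ofPred_eq, Complex.im_ofReal_mul, add_mul, h1]
          linarith
        · rw [Set.mem_Ici]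
          linarith

end Domain

/-! The branches of the powers on the domain -/

/-- For `Re w > 0` the imaginary parts of `w²` and `1 + w⁻²` have opposite signs, so the sum of the
arguments stays in `(-π, π]`. -/
theorem log_one_add_sq {w : ℂ} (hw : 0 < w.re) :
    Complex.log (1 + w ^ 2) = 2 * Complex.log w + Complex.log (1 + (w⁻¹) ^ 2) := by
  have hw0 : w ≠ 0 := by
    rintro rfl
    simp at hw
  have harg := abs_lt.1 (Complex.abs_arg_lt_pi_div_two_iff.2 (Or.inl hw))
  have h1 : Complex.log (w ^ 2) = 2 * Complex.log w := by
    rw [sq, Complex.log_mul hw0 hw0 ⟨by linarith [harg.1], by linarith [harg.2]⟩]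
    ring
  have him : (w ^ 2).im = 2 * w.re * w.im := by
    rw [sq, Complex.mul_im]
    ring
  have hN : 0 < Complex.normSq w := Complex.normSq_pos.2 hw0
  have him' : (1 + (w⁻¹) ^ 2).im = -(2 * w.re * w.im / Complex.normSq w ^ 2) := by
    rw [sq, Complex.add_im, Complex.mul_im, Complex.inv_im, Complex.inv_re, Complex.one_im]
    field_simp
    ring
  have hy : 1 + (w⁻¹) ^ 2 ≠ 0 := by
    intro h0
    have h2 : w ^ 2 = -1 := by
      field_simp at h0
      linear_combination h0
    have h3 := congrArg Complex.im h2
    rw [him] at h3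
    have h4 : w.im = 0 := by
      simpa [hw.ne'] using h3
    have h5 := congrArg Complex.re h2
    rw [sq, Complex.mul_re, h4] at h5
    simp at h5
    nlinarith
  rw [← h1, ← Complex.log_mul (pow_ne_zero 2 hw0) hy]
  · congr 1
    field_simp
    ring
  · rcases lt_trichotomy w.im 0 with h | h | h
    · have h2 : (w ^ 2).arg < 0 := Complex.arg_neg_iff.2 (by rw [him]; nlinarith)
      have h3 : 0 ≤ (1 + (w⁻¹) ^ 2).arg := Complex.arg_nonneg_iff.2 (by
        rw [him']
        have : 0 ≤ 2 * w.re * -w.im / Complex.normSq w ^ 2 :=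
          div_nonneg (by nlinarith) (by positivity)
        rw [mul_neg, neg_div] at this
        exact this)
      exact ⟨by linarith [Complex.neg_pi_lt_arg (w ^ 2)],
        by linarith [Complex.arg_le_pi (1 + (w⁻¹) ^ 2)]⟩
    · have hwr : w = (w.re : ℂ) := Complex.ext rfl h
      have h2 : (w ^ 2).arg = 0 := by
        rw [hwr, ← Complex.ofReal_pow]
        exact Complex.arg_ofReal_of_nonneg (by positivity)
      have h3 : (1 + (w⁻¹) ^ 2).arg = 0 := by
        rw [hwr, ← Complex.ofReal_inv, ← Complex.ofReal_pow, ← Complex.ofReal_one,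
          ← Complex.ofReal_add]
        exact Complex.arg_ofReal_of_nonneg (by positivity)
      rw [h2, h3, add_zero]
      exact ⟨neg_lt_zero.2 Real.pi_pos, Real.pi_pos.le⟩
    · have h2 : 0 ≤ (w ^ 2).arg := Complex.arg_nonneg_iff.2 (by rw [him]; positivity)
      have h3 : (1 + (w⁻¹) ^ 2).arg < 0 := Complex.arg_neg_iff.2 (by
        rw [him']
        exact neg_lt_zero.2 (by positivity))
      exact ⟨by linarith [Complex.neg_pi_lt_arg (1 + (w⁻¹) ^ 2)],
        by linarith [Complex.arg_le_pi (w ^ 2)]⟩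

/-- The branch of `(1 - u²) ^ (a / 2)` in the exterior of the unit disc. -/
def outerHalfPow (a : ℤ) (u : ℂ) : ℂ :=
  (-Complex.I * u) ^ a * (1 - (u⁻¹) ^ 2) ^ ((a : ℂ) / 2)

/-- The rotation `w = -iu` carries the upper to the right half-plane and `1 - u²` to `1 + w²`. Half
the exponent times `2 log w` gives the integer power `w ^ a`, which continues to the whole exterior.
-/
theorem halfPow_eq_outerHalfPow (a : ℤ) {u : ℂ} (hu : 0 < u.im) :
    halfPow a u = outerHalfPow a u := by
  set w := -Complex.I * u with hwdef
  have hw : 0 < w.re := by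
    simpa [hwdef] using hu
  have hw0 : w ≠ 0 := by
    intro h
    rw [h] at hw
    simp at hw
  have hu0 : u ≠ 0 := by
    rintro rfl
    simp at hu
  have h1 : 1 - u ^ 2 = 1 + w ^ 2 := by
    rw [hwdef, mul_pow, neg_sq, Complex.I_sq]
    ring
  have h2 : 1 - (u⁻¹) ^ 2 = 1 + (w⁻¹) ^ 2 := by
    rw [hwdef, mul_inv, mul_pow, inv_pow (-Complex.I), neg_sq, Complex.I_sq]
    ring
  have h3 := log_one_add_sq hw
  have hne : 1 + w ^ 2 ≠ 0 := by
    rw [← h1]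
    intro h
    have h4 := congrArg Complex.im h
    have h5 := congrArg Complex.re h
    simp [sq] at h4 h5
    have h6 : u.re = 0 := by
      rcases mul_eq_zero.1 (show u.re * u.im = 0 by linarith) with h | h
      · exact h
      · exact absurd h hu.ne'
    rw [h6] at h5
    nlinarith
  have hne' : 1 + (w⁻¹) ^ 2 ≠ 0 := by
    intro h
    apply hne
    field_simp at h
    linear_combination h
  have h4 : (-Complex.I * u) ^ a = Complex.exp (a * Complex.log w) := by
    rw [Complex.exp_int_mul, Complex.exp_log hw0]
  rw [halfPow, outerHalfPow, h1, h2, Complex.cpow_def_of_ne_zero hne,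
    Complex.cpow_def_of_ne_zero hne', h3, h4, ← Complex.exp_add]
  congr 1
  ring

/-- `1 - z²` is a nonpositive real number only if `z` is real with `|z| ≥ 1`. -/
theorem one_sub_sq_mem_slitPlane {z : ℂ} (hz : z.im = 0 → |z.re| < 1) :
    1 - z ^ 2 ∈ Complex.slitPlane := by
  rw [Complex.mem_slitPlane_iff]
  have hre : (1 - z ^ 2).re = 1 - (z.re ^ 2 - z.im ^ 2) := by
    rw [sq, Complex.sub_re, Complex.mul_re, Complex.one_re]
    ring
  have him : (1 - z ^ 2).im = -(2 * z.re * z.im) := by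
    rw [sq, Complex.sub_im, Complex.mul_im, Complex.one_im]
    ring
  rw [hre, him]
  by_cases h : z.im = 0
  · left
    have := (sq_lt_one_iff_abs_lt_one z.re).2 (hz h)
    rw [h]
    linarith
  · by_cases h' : z.re = 0
    · left
      rw [h']
      nlinarith [sq_nonneg z.im]
    · right
      simp [h, h']

theorem differentiableAt_halfPow (a : ℤ) {z : ℂ} (hz : z.im = 0 → |z.re| < 1) :
    DifferentiableAt ℂ (halfPow a) z :=
  ((differentiableAt_const _).sub (differentiableAt_id.pow 2)).cpow_const
    (one_sub_sq_mem_slitPlane hz)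

theorem inv_re_lt_one {z : ℂ} (hz : z.im = 0 → 1 < |z.re|) :
    (z⁻¹).im = 0 → |(z⁻¹).re| < 1 := by
  intro h
  by_cases hz0 : z = 0
  · simp [hz0]
  have hN : Complex.normSq z ≠ 0 := (Complex.normSq_pos.2 hz0).ne'
  have h1 : z.im = 0 := by
    rw [Complex.inv_im, div_eq_zero_iff, neg_eq_zero] at h
    exact h.resolve_right hN
  have h2 := hz h1
  have hzr : z = (z.re : ℂ) := Complex.ext rfl h1
  rw [hzr, ← Complex.ofReal_inv, Complex.ofReal_re, abs_inv]
  exact inv_lt_one_of_one_lt₀ h2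

theorem differentiableAt_outerHalfPow (a : ℤ) {z : ℂ} (h0 : z ≠ 0) (hz : z.im = 0 → 1 < |z.re|) :
    DifferentiableAt ℂ (outerHalfPow a) z := by
  refine DifferentiableAt.mul ?_ ?_
  · refine DifferentiableAt.zpow ((differentiableAt_const _).mul differentiableAt_id) (Or.inl ?_)
    simpa using h0
  · exact ((differentiableAt_const _).sub ((differentiableAt_inv h0).pow 2)).cpow_const
      (one_sub_sq_mem_slitPlane (inv_re_lt_one hz))

open Classical in
/-- The holomorphic extension of `u ↦ (1 - c² u²) ^ (a / 2)`. -/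
def extendedHalfPow (q : ℕ) (a : ℤ) (c : ℝ) (u : ℂ) : ℂ :=
  if 0 < u.im ∨ ‖u‖ ^ 2 < 1 / q then halfPow a (c * u) else outerHalfPow a (c * u)

/-! ### The extended powers and their behaviour under inversion -/

section Extension

variable {q : ℕ} {c : ℝ} {u : ℂ}

theorem extendedHalfPow_inner (a : ℤ) (h : ‖u‖ ^ 2 < 1 / q) :
    extendedHalfPow q a c u = halfPow a (c * u) := if_pos (Or.inr h)

/-- In the upper half-plane both formulas agree, so the definition by cases is given by a single
formula near each point of `Ω'`. -/
theorem extendedHalfPow_outer (a : ℤ) (hc : 0 < c) (h : 1 / q < ‖u‖ ^ 2) :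
    extendedHalfPow q a c u = outerHalfPow a (c * u) := by
  by_cases him : 0 < u.im
  · rw [extendedHalfPow, if_pos (Or.inl him)]
    refine halfPow_eq_outerHalfPow a ?_
    rw [Complex.im_ofReal_mul]
    positivity
  · exact if_neg (not_or.2 ⟨him, not_lt.2 h.le⟩)

theorem abs_re_lt_of_inner (hq : 0 < q) (hu : u ∈ domainΩ' q) (h : 0 < u.im ∨ ‖u‖ ^ 2 < 1 / q)
    (him : u.im = 0) : |u.re| < 1 / q := by
  have hq0 : (0 : ℝ) < q := by exact_mod_cast hq
  have h3 : (1 : ℝ) / q ≤ 1 := by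
    rw [div_le_one hq0]
    exact_mod_cast hq
  rcases h with h | h
  · exact absurd him h.ne'
  · by_contra! hle
    have h1 := (mem_domainΩ'_iff.1 hu).2 him hle
    rw [norm_sq_eq_re_sq_add_im_sq, him, ← sq_abs] at h
    nlinarith

theorem one_lt_abs_re_of_outer (hq : 0 < q) (hu : u ∈ domainΩ' q) (h : 1 / q < ‖u‖ ^ 2)
    (him : u.im = 0) : 1 < |u.re| := by
  have hq0 : (0 : ℝ) < q := by exact_mod_cast hq
  have h3 : (1 : ℝ) / q ≤ 1 := by
    rw [div_le_one hq0]
    exact_mod_cast hq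
  refine (mem_domainΩ'_iff.1 hu).2 him ?_
  by_contra! hlt
  rw [norm_sq_eq_re_sq_add_im_sq, him, ← sq_abs] at h
  have h4 := abs_nonneg u.re
  nlinarith

theorem inner_or_outer (hu : u ∈ domainΩ' q) :
    (0 < u.im ∨ ‖u‖ ^ 2 < 1 / q) ∨ 1 / q < ‖u‖ ^ 2 := by
  rcases lt_trichotomy (‖u‖ ^ 2) (1 / q) with h | h | h
  · exact Or.inl (Or.inr h)
  · exact Or.inl (Or.inl ((mem_domainΩ'_iff.1 hu).1 h))
  · exact Or.inr h

/-- On the real axis the inner branch requires `|c u| < 1` for `|u| < 1 / q`, hence `c ≤ q`; the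
outer one requires `|c u| > 1` for `|u| > 1`, hence `1 ≤ c`. -/
theorem differentiableOn_extendedHalfPow (hq : 0 < q) (a : ℤ) (hc : 1 ≤ c) (hcq : c ≤ q) :
    DifferentiableOn ℂ (extendedHalfPow q a c) (domainΩ' q) := by
  have hq0 : (0 : ℝ) < q := by exact_mod_cast hq
  have hc0 : 0 < c := by linarith
  intro u hu
  refine DifferentiableAt.differentiableWithinAt ?_
  have hmul : DifferentiableAt ℂ (fun u : ℂ => (c : ℂ) * u) u :=
    (differentiableAt_const _).mul differentiableAt_id
  rcases inner_or_outer hu with h | h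
  · have hz : ((c : ℂ) * u).im = 0 → |((c : ℂ) * u).re| < 1 := by
      intro him
      rw [Complex.im_ofReal_mul] at him
      have h1 := abs_re_lt_of_inner hq hu h ((mul_eq_zero.1 him).resolve_left hc0.ne')
      rw [Complex.re_ofReal_mul, abs_mul, abs_of_pos hc0]
      rw [lt_div_iff₀' hq0] at h1
      exact lt_of_le_of_lt (by gcongr) h1
    refine ((differentiableAt_halfPow a hz).comp u hmul).congr_of_eventuallyEq ?_
    have hopen : IsOpen ({u : ℂ | 0 < u.im} ∪ {u : ℂ | ‖u‖ ^ 2 < 1 / q}) :=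
      (isOpen_lt continuous_const Complex.continuous_im).union
        (isOpen_lt (continuous_norm.pow 2) continuous_const)
    filter_upwards [hopen.mem_nhds h] with z hz
    exact if_pos hz
  · have hz : ((c : ℂ) * u).im = 0 → 1 < |((c : ℂ) * u).re| := by
      intro him
      rw [Complex.im_ofReal_mul] at him
      have h1 := one_lt_abs_re_of_outer hq hu h ((mul_eq_zero.1 him).resolve_left hc0.ne')
      rw [Complex.re_ofReal_mul, abs_mul, abs_of_pos hc0]
      nlinarith
    have hu0 : u ≠ 0 := by
      rintro rfl
      rw [norm_zero, zero_pow two_ne_zero] at h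
      exact absurd h (not_lt.2 (by positivity))
    have hcu : (c : ℂ) * u ≠ 0 := mul_ne_zero (Complex.ofReal_ne_zero.2 hc0.ne') hu0
    refine ((differentiableAt_outerHalfPow a hcu hz).comp u hmul).congr_of_eventuallyEq ?_
    have hopen : IsOpen {u : ℂ | 1 / q < ‖u‖ ^ 2} :=
      isOpen_lt continuous_const (continuous_norm.pow 2)
    filter_upwards [hopen.mem_nhds h] with z hz
    exact extendedHalfPow_outer a hc0 hz

theorem extendedHalfPow_add (hq : 0 < q) (a b : ℤ) (hu : u ∈ domainΩ' q) :
    extendedHalfPow q a 1 u * extendedHalfPow q b 1 u = extendedHalfPow q (a + b) 1 u := by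
  have hq0 : (0 : ℝ) < q := by exact_mod_cast hq
  rcases inner_or_outer hu with h | h
  · have hz : u.im = 0 → |u.re| < 1 := by
      intro him
      refine (abs_re_lt_of_inner hq hu h him).trans_le ?_
      rw [div_le_one hq0]
      exact_mod_cast hq
    have hne := Complex.slitPlane_ne_zero (one_sub_sq_mem_slitPlane hz)
    simp only [extendedHalfPow, if_pos h, Complex.ofReal_one, one_mul, halfPow]
    rw [← Complex.cpow_add _ _ hne]
    congr 1
    push_cast
    ring
  · have hu0 : u ≠ 0 := by
      rintro rfl
      rw [norm_zero, zero_pow two_ne_zero] at h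
      exact absurd h (not_lt.2 (by positivity))
    have hne := Complex.slitPlane_ne_zero
      (one_sub_sq_mem_slitPlane (inv_re_lt_one (one_lt_abs_re_of_outer hq hu h)))
    rw [extendedHalfPow_outer a one_pos h, extendedHalfPow_outer b one_pos h,
      extendedHalfPow_outer (a + b) one_pos h]
    simp only [Complex.ofReal_one, one_mul, outerHalfPow]
    rw [zpow_add₀ (by simpa using hu0), Int.cast_add, add_div, Complex.cpow_add _ _ hne]
    ring

theorem extendedHalfPow_zero (q : ℕ) (c : ℝ) (u : ℂ) : extendedHalfPow q 0 c u = 1 := by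
  simp [extendedHalfPow, halfPow, outerHalfPow]

theorem norm_sq_lt_of_norm_lt (hq : 0 < q) (hu : ‖u‖ < 1 / q) : ‖u‖ ^ 2 < 1 / q := by
  have hq0 : (0 : ℝ) < q := by exact_mod_cast hq
  have h3 : (1 : ℝ) / q ≤ 1 := by
    rw [div_le_one hq0]
    exact_mod_cast hq
  nlinarith [norm_nonneg u]

theorem isHolomorphicExtension_halfPow (hq : 0 < q) (a : ℤ) :
    IsHolomorphicExtension q (halfPow a) (extendedHalfPow q a 1) := by
  refine ⟨differentiableOn_extendedHalfPow hq a le_rfl (by exact_mod_cast hq), fun u hu => ?_⟩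
  rw [extendedHalfPow_inner a (norm_sq_lt_of_norm_lt hq hu), Complex.ofReal_one, one_mul]

theorem isHolomorphicExtension_sqrtFactor (hq : 0 < q) :
    IsHolomorphicExtension q (sqrtFactor q) (extendedHalfPow q 1 q) := by
  refine ⟨differentiableOn_extendedHalfPow hq 1 (by exact_mod_cast hq) le_rfl, fun u hu => ?_⟩
  rw [extendedHalfPow_inner 1 (norm_sq_lt_of_norm_lt hq hu), halfPow, sqrtFactor,
    Complex.ofReal_natCast, mul_pow, Int.cast_one]

/-- On the small disc the product of powers is `(1 - u²) ^ ((q - 1) / 2) * (1 - u)`, so no new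
branch is needed. -/
theorem isHolomorphicExtension_xiFactor (hq : 0 < q) :
    IsHolomorphicExtension q (xiFactor q) fun u => extendedHalfPow q (q - 1) 1 u * (1 - u) := by
  obtain ⟨h1, h2⟩ := isHolomorphicExtension_halfPow hq (q - 1)
  refine ⟨h1.mul ((differentiable_const _).sub differentiable_id).differentiableOn, fun u hu => ?_⟩
  have hq' : (1 : ℝ) ≤ q := by exact_mod_cast hq
  have hu1 : ‖u‖ < 1 := hu.trans_le (by rw [div_le_one (by linarith)]; exact hq')
  have hne : ∀ z : ℂ, ‖z‖ < 1 → 1 + z ≠ 0 := fun z hz =>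
    Complex.slitPlane_ne_zero (Complex.mem_slitPlane_of_norm_lt_one hz)
  have hp := hne u hu1
  have hm := hne (-u) (by rwa [norm_neg])
  rw [← sub_eq_add_neg] at hm
  calc extendedHalfPow q (q - 1) 1 u * (1 - u)
      = Complex.exp (((q - 1 : ℤ) : ℂ) / 2 * (Complex.log (1 - u) + Complex.log (1 + u))) *
          Complex.exp (Complex.log (1 - u)) := by
        rw [h2 u hu, halfPow_eq_exp _ hu1, Complex.exp_log hm]
    _ = xiFactor q u := by
        rw [xiFactor, Complex.cpow_def_of_ne_zero hp, Complex.cpow_def_of_ne_zero hm,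
          ← Complex.exp_add, ← Complex.exp_add]
        congr 1
        push_cast
        ring

/-- Identity theorem on the connected set `Ω'`. It allows the chosen extensions to be computed with
the explicit branches. -/
theorem IsHolomorphicExtension.eqOn (hq : 0 < q) {f F G : ℂ → ℂ}
    (hF : IsHolomorphicExtension q f F) (hG : IsHolomorphicExtension q f G) :
    Set.EqOn F G (domainΩ' q) := by
  have hq0 : (0 : ℝ) < q := by exact_mod_cast hq
  refine AnalyticOnNhd.eqOn_of_preconnected_of_eventuallyEq
    (hF.1.analyticOnNhd (isOpen_domainΩ' q)) (hG.1.analyticOnNhd (isOpen_domainΩ' q))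
    (isPreconnected_domainΩ' hq) (z₀ := 0) ?_ ?_
  · exact domainΩ_subset q (mem_domainΩ_of_norm_lt hq (by simpa using hq))
  · filter_upwards [Metric.ball_mem_nhds (0 : ℂ) (show (0 : ℝ) < 1 / q by positivity)] with u hu
    rw [mem_ball_zero_iff] at hu
    rw [hF.2 u hu, hG.2 u hu]

theorem IsHolomorphicExtension.holomorphicExtension {f F : ℂ → ℂ}
    (hF : IsHolomorphicExtension q f F) :
    IsHolomorphicExtension q f (holomorphicExtension q f) := by
  have h : ∃ F, IsHolomorphicExtension q f F := ⟨F, hF⟩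
  rw [_root_.holomorphicExtension, dif_pos h]
  exact Classical.choose_spec h

theorem IsHolomorphicExtension.holomorphicExtension_eq (hq : 0 < q) {f F : ℂ → ℂ}
    (hF : IsHolomorphicExtension q f F) (hu : u ∈ domainΩ' q) :
    _root_.holomorphicExtension q f u = F u :=
  IsHolomorphicExtension.eqOn hq hF.holomorphicExtension hF hu

/-- The behaviour of `(1 - u²) ^ (1 / 2) (1 - q² u²) ^ (1 / 2)` under `u ↦ 1 / (q u)`. -/
theorem extendedHalfPow_inv_of_inner (hq : 0 < q) (h0 : u ≠ 0) (h : ‖u‖ ^ 2 < 1 / q) :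
    extendedHalfPow q 1 1 (1 / (q * u)) * extendedHalfPow q 1 q (1 / (q * u)) =
      -(extendedHalfPow q 1 1 u * extendedHalfPow q 1 q u) / (q * u ^ 2) := by
  have hq0 : (0 : ℝ) < q := by exact_mod_cast hq
  have hqc : (q : ℂ) ≠ 0 := by exact_mod_cast hq.ne'
  have hn : 0 < ‖u‖ := norm_pos_iff.2 h0
  have hv : 1 / q < ‖1 / (q * u)‖ ^ 2 := by
    rw [norm_div, norm_one, norm_mul, Complex.norm_natCast]
    rw [lt_div_iff₀ hq0] at h
    rw [div_pow, one_pow, div_lt_div_iff₀ hq0 (by positivity)]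
    nlinarith
  rw [extendedHalfPow_outer 1 one_pos hv, extendedHalfPow_outer 1 hq0 hv,
    extendedHalfPow_inner 1 h, extendedHalfPow_inner 1 h]
  have e1 : ((1 : ℝ) : ℂ) * (1 / (q * u)) = (q * u)⁻¹ := by
    rw [Complex.ofReal_one, one_mul, one_div]
  have e2 : ((q : ℝ) : ℂ) * (1 / (q * u)) = u⁻¹ := by
    rw [Complex.ofReal_natCast]
    field_simp
  rw [e1, e2, Complex.ofReal_one, one_mul, Complex.ofReal_natCast, outerHalfPow, outerHalfPow,
    inv_inv, inv_inv, zpow_one, zpow_one, halfPow, halfPow]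
  -- The outer branches contribute `(-I / (q u)) (-I / u) = -1 / (q u²)`; this is the source of the
  -- sign in the functional equation of `Λ`.
  field_simp
  rw [Complex.I_sq]
  ring

/-- Inversion is an involution that exchanges the inside and the outside of the circle, so the outer
case is the inner one at `1 / (q u)`. -/
theorem extendedHalfPow_inv (hq : 0 < q) (hu : u ∈ domainΩ q) (h0 : u ≠ 0) :
    extendedHalfPow q 1 1 (1 / (q * u)) * extendedHalfPow q 1 q (1 / (q * u)) =
      -(extendedHalfPow q 1 1 u * extendedHalfPow q 1 q u) / (q * u ^ 2) := by
  have hq0 : (0 : ℝ) < q := by exact_mod_cast hq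
  have hqc : (q : ℂ) ≠ 0 := by exact_mod_cast hq.ne'
  have hn : 0 < ‖u‖ := norm_pos_iff.2 h0
  rcases lt_trichotomy (‖u‖ ^ 2) (1 / q) with h | h | h
  · exact extendedHalfPow_inv_of_inner hq h0 h
  · exact absurd (Or.inl h) hu
  · have hv0 : 1 / (q * u) ≠ 0 := one_div_ne_zero (mul_ne_zero hqc h0)
    have hv : ‖1 / (q * u)‖ ^ 2 < 1 / q := by
      rw [norm_div, norm_one, norm_mul, Complex.norm_natCast]
      rw [div_lt_iff₀ hq0] at h
      rw [div_pow, one_pow, div_lt_div_iff₀ (by positivity) hq0]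
      nlinarith
    have h1 := extendedHalfPow_inv_of_inner hq hv0 hv
    have e : 1 / (q * (1 / (q * u))) = u := by
      field_simp
    rw [e] at h1
    rw [h1]
    field_simp

end Extension

end

noncomputable section

/-! The zeta function and its functional equations -/

namespace GraphTower.IsSpectralTrace

variable {V : Type*} {X : SimpleGraph V} [X.LocallyFinite] {S : GraphTower X}
  {hd : ∃ d : ℕ, ∀ v, X.degree v ≤ d} {q : ℕ} {h : ∀ v, X.degree v ≤ q + 1}
  {τ : C(Set.Icc (-((q + 1 : ℕ) : ℝ)) ((q + 1 : ℕ) : ℝ), ℂ) →L[ℂ] ℂ} {u : ℂ}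

theorem zeta_eq [Infinite V] (hS : S.IsSelfSimilar) (hτ : S.IsSpectralTrace hd h τ) (hq : 0 < q)
    (hreg : {v | X.degree v ≠ q + 1}.Finite) (u : ℂ) :
    S.zeta hd q u = S.determinantExpression hd q u := by
  rw [zeta]
  split_ifs with hu
  · rw [eulerProduct, (hτ.hasProd_eulerFactor hS hq hreg hu).tprod_eq, determinantExpression,
      (isHolomorphicExtension_halfPow hq _).holomorphicExtension.2 u hu]
  · rfl

theorem zeta_eq_of_mem [Infinite V] (hS : S.IsSelfSimilar) (hτ : S.IsSpectralTrace hd h τ)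
    (hq : 0 < q) (hreg : {v | X.degree v ≠ q + 1}.Finite) (hu : u ∈ domainΩ q) :
    S.zeta hd q u =
      extendedHalfPow q (1 - q) 1 u * (S.det (deformedLaplacian X hd q u))⁻¹ := by
  rw [hτ.zeta_eq hS hq hreg, determinantExpression,
    (isHolomorphicExtension_halfPow hq _).holomorphicExtension_eq hq (domainΩ_subset q hu)]

theorem differentiableOn_zeta [Infinite V] (hS : S.IsSelfSimilar)
    (hτ : S.IsSpectralTrace hd h τ) (hq : 0 < q) (hreg : {v | X.degree v ≠ q + 1}.Finite) :
    DifferentiableOn ℂ (S.zeta hd q) (domainΩ q) := by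
  have h1 : S.zeta hd q = S.determinantExpression hd q := funext (hτ.zeta_eq hS hq hreg)
  rw [h1]
  exact ((isHolomorphicExtension_halfPow hq _).holomorphicExtension.1.mono
    (domainΩ_subset q)).mul ((hτ.differentiableOn_det hS hq).inv fun u _ => Complex.exp_ne_zero _)

/-- The exponents `q / 2` and `(1 - q) / 2` add up to `1 / 2`. In `completedξ_eq` and
`completedΞ_eq` the exponents cancel and no root remains. -/
theorem completedΛ_eq [Infinite V] (hS : S.IsSelfSimilar) (hτ : S.IsSpectralTrace hd h τ)
    (hq : 0 < q) (hreg : {v | X.degree v ≠ q + 1}.Finite) (hu : u ∈ domainΩ q) :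
    S.completedΛ hd q u = extendedHalfPow q 1 1 u * extendedHalfPow q 1 q u *
      (S.det (deformedLaplacian X hd q u))⁻¹ := by
  have hu' := domainΩ_subset q hu
  rw [completedΛ, hτ.zeta_eq_of_mem hS hq hreg hu,
    (isHolomorphicExtension_halfPow hq _).holomorphicExtension_eq hq hu',
    (isHolomorphicExtension_sqrtFactor hq).holomorphicExtension_eq hq hu']
  have h1 := extendedHalfPow_add hq q (1 - q) hu'
  rw [add_sub_cancel] at h1
  rw [← h1]
  ring

theorem completedξ_eq [Infinite V] (hS : S.IsSelfSimilar) (hτ : S.IsSpectralTrace hd h τ)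
    (hq : 0 < q) (hreg : {v | X.degree v ≠ q + 1}.Finite) (hu : u ∈ domainΩ q) :
    S.completedξ hd q u =
      (1 - u) * (1 - q * u) * (S.det (deformedLaplacian X hd q u))⁻¹ := by
  have hu' := domainΩ_subset q hu
  rw [completedξ, hτ.zeta_eq_of_mem hS hq hreg hu,
    (isHolomorphicExtension_xiFactor hq).holomorphicExtension_eq hq hu']
  have h1 := extendedHalfPow_add hq (q - 1) (1 - q) hu'
  rw [sub_add_sub_cancel, sub_self, extendedHalfPow_zero] at h1
  linear_combination (1 - u) * (1 - q * u) * (S.det (deformedLaplacian X hd q u))⁻¹ * h1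

theorem completedΞ_eq [Infinite V] (hS : S.IsSelfSimilar) (hτ : S.IsSpectralTrace hd h τ)
    (hq : 0 < q) (hreg : {v | X.degree v ≠ q + 1}.Finite) (hu : u ∈ domainΩ q) :
    S.completedΞ hd q u =
      (1 + q * u ^ 2) * (S.det (deformedLaplacian X hd q u))⁻¹ := by
  have hu' := domainΩ_subset q hu
  rw [completedΞ, hτ.zeta_eq_of_mem hS hq hreg hu,
    (isHolomorphicExtension_halfPow hq _).holomorphicExtension_eq hq hu']
  have h1 := extendedHalfPow_add hq (q - 1) (1 - q) hu'
  rw [sub_add_sub_cancel, sub_self, extendedHalfPow_zero] at h1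
  linear_combination (1 + q * u ^ 2) * (S.det (deformedLaplacian X hd q u))⁻¹ * h1

/-- Under inversion the determinant is multiplied by `(q u²)⁻¹`, and so are the numerators `(1 -
u)(1 - q u)` and `1 + q u²`; the product of square roots is multiplied by `-(q u²)⁻¹`. -/
theorem functional_equations [Infinite V] (hS : S.IsSelfSimilar)
    (hτ : S.IsSpectralTrace hd h τ) (hq : 0 < q) (hreg : {v | X.degree v ≠ q + 1}.Finite)
    (hu : u ∈ domainΩ q) (h0 : u ≠ 0) :
    S.completedΛ hd q u = -S.completedΛ hd q (1 / (q * u)) ∧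
      S.completedξ hd q u = S.completedξ hd q (1 / (q * u)) ∧
      S.completedΞ hd q u = S.completedΞ hd q (1 / (q * u)) := by
  have hv := inv_mem_domainΩ hq hu h0
  have hqc : (q : ℂ) ≠ 0 := by exact_mod_cast hq.ne'
  have hD : S.det (deformedLaplacian X hd q u) ≠ 0 := Complex.exp_ne_zero _
  rw [hτ.completedΛ_eq hS hq hreg hu, hτ.completedΛ_eq hS hq hreg hv,
    hτ.completedξ_eq hS hq hreg hu, hτ.completedξ_eq hS hq hreg hv,
    hτ.completedΞ_eq hS hq hreg hu, hτ.completedΞ_eq hS hq hreg hv,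
    hτ.det_inv hS hq hu h0, extendedHalfPow_inv hq hu h0]
  refine ⟨?_, ?_, ?_⟩
  · field_simp
  · field_simp
    ring
  · field_simp
    ring

end GraphTower.IsSpectralTrace

end

theorem mainTheorem4 {V : Type*} [Countable V] [Infinite V] (X : SimpleGraph V)
    [X.LocallyFinite] (hX : X.Connected) (hd : ∃ d : ℕ, ∀ v, X.degree v ≤ d)
    (S : GraphTower X) (hS : S.IsSelfSimilar) (q : ℕ) (hq : 0 < q)
    (hreg : {v | X.degree v ≠ q + 1}.Finite) :
    -- the average multiplicities exist
    (∀ ξ : S.PrimeClass, Tendsto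
      (fun n => (S.multiplicity ξ n : ℝ) / ((S.K n).card : ℝ)) atTop
      (𝓝 (S.avgMultiplicity ξ))) ∧
    -- they are given by the numbers of copies if each `K n` is one of its copies in `K (n + 1)`
    -- and no prime cycle lies in two copies
    ((∀ n, ∃ γ ∈ S.G n, ∀ v, (γ v : V) = v) →
      (∀ p k, ∀ γ ∈ S.copies p k, ∀ γ' ∈ S.copies p k, γ ≠ γ' →
        ∀ c : PrimeCycle X, ¬ c.support ⊆ S.image γ ∩ S.image γ') →
      ∀ c : PrimeCycle X, Tendsto
        (fun k => ((S.copies (S.size c) k).ncard : ℝ) / ((S.K (S.size c + k)).card : ℝ)) atTop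
        (𝓝 (S.avgMultiplicity (Quot.mk S.Maps c)))) ∧
    -- the determinant is defined on the open set
    (∀ u ∈ domainΩ q,
      (0 : ℂ) ∉ convexHull ℝ (spectrum ℂ (deformedLaplacian X hd q u)) ∧
      Tendsto (S.normalizedTrace (analyticLog (deformedLaplacian X hd q u))) atTop
        (𝓝 (S.trace (analyticLog (deformedLaplacian X hd q u))))) ∧
    -- the holomorphic extensions of the powers exist
    (∀ f ∈ ({halfPow (1 - q), halfPow q, halfPow (q - 1), sqrtFactor q, xiFactor q} :
        Set (ℂ → ℂ)), IsHolomorphicExtension q f (holomorphicExtension q f)) ∧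
    -- the Euler product converges, and the determinant formula extends it holomorphically
    (∀ u : ℂ, ‖u‖ < 1 / q → Multipliable (S.eulerFactor u)) ∧
    (∀ u ∈ domainΩ q, S.zeta hd q u = S.determinantExpression hd q u) ∧
    DifferentiableOn ℂ (S.zeta hd q) (domainΩ q) ∧
    -- the functional equations
    (∀ u ∈ domainΩ q, u ≠ 0 →
      S.completedΛ hd q u = -S.completedΛ hd q (1 / (q * u)) ∧
      S.completedξ hd q u = S.completedξ hd q (1 / (q * u)) ∧
      S.completedΞ hd q u = S.completedΞ hd q (1 / (q * u))) := by
  -- The bound holds at every vertex, including the finitely many exceptional ones; without it the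
  -- spectrum could exceed `[-(q+1), q+1]`.
  have h : ∀ v, X.degree v ≤ q + 1 := GraphTower.degree_le_of_essentiallyRegular hS hd hreg
  obtain ⟨τ, hτ : S.IsSpectralTrace hd h τ⟩ := GraphTower.exists_spectralTrace (hd := hd) hS h
  refine ⟨GraphTower.tendsto_multiplicity hS h, GraphTower.tendsto_copies_ncard hS hd,
    fun u hu => ⟨zero_notMem_convexHull h hq hu, hτ.tendsto_analyticLog hq hu⟩, ?_,
    fun u hu => (hτ.hasProd_eulerFactor hS hq hreg hu).multipliable,
    fun u _ => hτ.zeta_eq hS hq hreg u, hτ.differentiableOn_zeta hS hq hreg,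
    fun u hu h0 => hτ.functional_equations hS hq hreg hu h0⟩
  rintro f (rfl | rfl | rfl | rfl | rfl)
  · exact (isHolomorphicExtension_halfPow hq _).holomorphicExtension
  · exact (isHolomorphicExtension_halfPow hq _).holomorphicExtension
  · exact (isHolomorphicExtension_halfPow hq _).holomorphicExtension
  · exact (isHolomorphicExtension_sqrtFactor hq).holomorphicExtension
  · exact (isHolomorphicExtension_xiFactor hq).holomorphicExtension
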